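/- Let $W$ be a commutative ring, let $N,M>0$ be integers that are invertible in $W$, put $d=\gcd(N,M)$, and suppose that $W$ contains a primitive $d$-th root of unity $\zeta$, that is, a root of the $d$-th cyclotomic polynomial (if $W$ is a domain: an element of $W^\times$ of exact order $d$). Let $$X=\operatorname{Spec}W[[x,y]]\supset C=\operatorname{Spec}W[[x,y]]/(x^N+y^M),$$ and let $O\subset X$ be the section $x=y=0$. Conventions. A scheme $Y$ over $X$ is called smooth over $W$ if, locally on $Y$, it is the base change along $\operatorname{Spec}W[[x,y]]\to\mathbb A^2_W=\operatorname{Spec}W[x,y]$ of an $\mathbb A^2_W$-scheme $V$ that is smooth over $W$ in the usual sense. A divisor $D$ on $Y$ is a relative normal crossing divisor (NCD) over $W$ if, locally on $Y$, there are such a $V$ and an étale $W$-morphism $(t_0,t_1):V\to\mathbb A^2_W$ such that $D$ is defined by $1$, $t_0$, $t_1$ or $t_0t_1$. A sum $\sum_iD_i$ of effective Cartier divisors is a simple relative NCD if it is a relative NCD and each $D_i$ is smooth over $W$. Then there is a proper morphism $\rho:X'\to X$, which is a composite of finitely many blow-ups, each along a section over $W$ that lies above $O$, such that, with $D:=\rho^{-1}(C)$: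 1. $X'$ is smooth over $W$, and $\rho$ restricts to an isomorphism $X'\setminus D\cong X\setminus C$. 2. $D=C'+\sum_{i=1}^n m_iE_i$, where $C'$ is the proper transform of $C$ (the scheme-theoretic closure of $\rho^{-1}(C\setminus O)$), the $E_i$ are exceptional, i.e. $E_i\subset\rho^{-1}(O)$, and they are integral if $W$ is a domain. The divisor $C'+\sum_iE_i$ is a simple relative NCD over $W$ with the components $C'$ and $E_i$. 3. Each multiplicity $m_i$ is either of the form $aN$ with $a\in\{1,\dots,M\}$ or of the form $bM$ with $b\in\{1,\dots,N\}$; thus all multiplicities of $D$ are among $1$, $aN$, $bM$. 4. $E_1,\dots,E_n$ form a chain: the scheme-theoretic intersection $E_i\cap E_{i+1}$ maps isomorphically to $\operatorname{Spec}W$, and $E_i\cap E_j=\emptyset$ if $|i-j|>1$. There is an index $k$ such that $C'\cap E_i=\emptyset$ for $i\ne k$ and $C'\cap E_k\cong\operatorname{Spec}W[T]/(T^d+1)$ over $W$. 5. If moreover $-1$ is a $d$-th power in $W$ (which always holds if $d$ is odd), then $C'=\sum_{l=1}^dC'_l$ with $d$ pairwise disjoint components $C'_l$, such that $\sum_lC'_l+\sum_iE_i$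 is a simple relative NCD over $W$ with the components $C'_l$ and $E_i$, each $C'_l\cap E_k$ maps isomorphically to $\operatorname{Spec}W$, and each $C'_l$ is integral if $W$ is a domain. -/

import Mathlib

open CategoryTheory AlgebraicGeometry

universe u

noncomputable section

namespace FermatResolution

variable (W : Type u) [CommRing W]

/-- The scheme `Spec W`. -/
abbrev base : Scheme.{u} := Spec (CommRingCat.of W)

/-- The affine plane `𝔸²_W = Spec W[x₀, x₁]`. -/
abbrev plane : Scheme.{u} := Spec (CommRingCat.of (MvPolynomial (Fin 2) W))

/-- The structure morphism `𝔸²_W ⟶ Spec W`. -/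
abbrev planeStr : plane W ⟶ base W :=
  Spec.map (CommRingCat.ofHom (algebraMap W (MvPolynomial (Fin 2) W)))

/-- The scheme `X = Spec W[[x, y]]`, with `x = X 0` and `y = X 1`. -/
abbrev germ : Scheme.{u} := Spec (CommRingCat.of (MvPowerSeries (Fin 2) W))

/-- The structure morphism `Spec W[[x, y]] ⟶ Spec W`. -/
abbrev germStr : germ W ⟶ base W :=
  Spec.map (CommRingCat.ofHom (algebraMap W (MvPowerSeries (Fin 2) W)))

/-- The completion morphism `Spec W[[x, y]] ⟶ 𝔸²_W = Spec W[x, y]`. -/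
abbrev germToPlane : germ W ⟶ plane W :=
  Spec.map (CommRingCat.ofHom (MvPolynomial.coeToMvPowerSeries.ringHom (σ := Fin 2) (R := W)))

/-- The section `x = y = 0` of `Spec W[[x, y]]`. -/
abbrev origin : base W ⟶ germ W :=
  Spec.map (CommRingCat.ofHom (MvPowerSeries.constantCoeff (σ := Fin 2) (R := W)))

/-- The closed subscheme `Spec A/I` of `Spec A`, as an ideal sheaf. -/
def idealSheaf {A : Type u} [CommRing A] (I : Ideal A) :
    (Spec (CommRingCat.of A)).IdealSheafData :=
  (Spec.map (CommRingCat.ofHom (Ideal.Quotient.mk I))).ker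

/-- The curve `C = Spec W[[x, y]]/(x ^ N + y ^ M)`, as a closed subscheme of `Spec W[[x, y]]`. -/
def curve (N M : ℕ) : (germ W).IdealSheafData :=
  idealSheaf (Ideal.span
    {(MvPowerSeries.X 0 ^ N + MvPowerSeries.X 1 ^ M : MvPowerSeries (Fin 2) W)})

variable {W}

/-- Smoothness over `W` of a scheme `f : Y ⟶ Spec W[[x, y]]`. Since `W[[x, y]]` is the completion
of `W[x, y]` along `x = y = 0`, and is not of finite type over `W`, a `W[[x, y]]`-scheme is called
smooth over `W` if, locally on `Y`, it is the base change along `Spec W[[x, y]] ⟶ 𝔸²_W` of an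
`𝔸²_W`-scheme `q : V ⟶ 𝔸²_W` such that `V` is smooth over `W` in the usual sense. In particular
the completion of `Y` along `x = y = 0` is then locally the completion of a smooth `W`-scheme along
a closed subscheme. -/
def IsSmoothOver {Y : Scheme.{u}} (f : Y ⟶ germ W) : Prop :=
  ∀ y : Y, ∃ (U : Y.Opens) (V : Scheme.{u}) (j : U.toScheme ⟶ V) (q : V ⟶ plane W),
    y ∈ U ∧ IsPullback j (U.ι ≫ f) q (germToPlane W) ∧ Smooth (q ≫ planeStr W)

/-- A relative normal crossing divisor over `W` on a surface `f : Y ⟶ Spec W[[x, y]]`: locally it is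
defined by a product of some of the members of a system `(t₀, t₁)` of local coordinates over `W`.
As for `IsSmoothOver`, a system of local coordinates on the open set `U` comes from
a presentation of `U` as the base change of a `W`-scheme `q : V ⟶ 𝔸²_W`; here the coordinates are
an étale `W`-morphism `t = (t₀, t₁) : V ⟶ 𝔸²_W` (so that `V` is smooth over `W` of relative
dimension two). -/
def IsRelNCD {Y : Scheme.{u}} (f : Y ⟶ germ W) (D : Y.IdealSheafData) : Prop :=
  ∀ y : Y, ∃ (U : Y.Opens) (V : Scheme.{u}) (j : U.toScheme ⟶ V) (q t : V ⟶ plane W)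
    (S : Finset (Fin 2)),
    y ∈ U ∧ IsPullback j (U.ι ≫ f) q (germToPlane W) ∧
    Etale t ∧ t ≫ planeStr W = q ≫ planeStr W ∧
    D.comap U.ι =
      (idealSheaf (Ideal.span {∏ i ∈ S, (MvPolynomial.X i : MvPolynomial (Fin 2) W)})).comap
        (j ≫ t)

/-- An effective Cartier divisor: a closed subscheme which is locally the zero locus
of one nonzerodivisor. -/
def IsEffectiveCartier {Y : Scheme.{u}} (D : Y.IdealSheafData) : Prop :=
  ∀ y : Y, ∃ U : Y.affineOpens, y ∈ U.1 ∧
    ∃ a ∈ nonZeroDivisors Γ(Y, U.1), D.ideal U = Ideal.span {a}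

/-- The divisor `∑ i, D i` is a simple relative normal crossing divisor over `W` with
the components `D i`. The sum of divisors is the product of their ideal sheaves. -/
structure IsSimpleRelNCD {Y : Scheme.{u}} (f : Y ⟶ germ W) {ι : Type} [Fintype ι]
    (D : ι → Y.IdealSheafData) : Prop where
  cartier : ∀ i, IsEffectiveCartier (D i)
  smooth : ∀ i, IsSmoothOver ((D i).subschemeι ≫ f)
  ncd : IsRelNCD f (∏ i, D i)

/-- `π : Y' ⟶ Y` is the blow-up of `Y` along the closed subscheme `Z`, characterized by its
universal property: it is terminal among the `Y`-schemes on which the preimage of `Z` is an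
effective Cartier divisor. -/
structure IsBlowup {Y' Y : Scheme.{u}} (π : Y' ⟶ Y) (Z : Y.IdealSheafData) : Prop where
  cartier : IsEffectiveCartier (Z.comap π)
  universal : ∀ {T : Scheme.{u}} (g : T ⟶ Y), IsEffectiveCartier (Z.comap g) →
    ∃! h : T ⟶ Y', h ≫ π = g

/-- `f : Y ⟶ Spec W[[x, y]]` is a composite of finitely many blow-ups, each of them along
a section `s` over `W` which lies above the origin `x = y = 0`. -/
inductive IsIteratedBlowup : {Y : Scheme.{u}} → (Y ⟶ germ W) → Prop
  | iso {Y : Scheme.{u}} (f : Y ⟶ germ W) (hf : IsIso f) : IsIteratedBlowup f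
  | step {Y' Y : Scheme.{u}} (π : Y' ⟶ Y) (f : Y ⟶ germ W) (s : base W ⟶ Y)
      (hs : s ≫ f = origin W) (hf : IsIteratedBlowup f) (hπ : IsBlowup π s.ker) :
      IsIteratedBlowup (π ≫ f)

/-- The proper transform in `Y` of a closed subscheme `Z` of `Spec W[[x, y]]`: the scheme theoretic
closure in `Y` of the preimage of `Z` without the origin. -/
def properTransform {Y : Scheme.{u}} (f : Y ⟶ germ W) (Z : (germ W).IdealSheafData) :
    Y.IdealSheafData :=
  ((Z.comap f).comap (f ⁻¹ᵁ (origin W).ker.support.compl).ι).map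
    (f ⁻¹ᵁ (origin W).ker.support.compl).ι

/-- The closed subschemes `D` and `D'` of `Y` cross exactly once over `W`: their scheme
theoretic intersection maps isomorphically to `Spec W`. -/
def MeetOnce {Y : Scheme.{u}} (f : Y ⟶ germ W) (D D' : Y.IdealSheafData) : Prop :=
  IsIso ((D ⊔ D').subschemeι ≫ f ≫ germStr W)

/-- The closed subschemes `D` and `D'` of `Y` are disjoint. -/
def AreDisjoint {Y : Scheme.{u}} (D D' : Y.IdealSheafData) : Prop := D ⊔ D' = ⊤

end FermatResolution

end

/-!
The modification is toric, and is determined by a subdivision of the first quadrant, as over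
a field. Let `d = gcd (N, M)`, `N = d N'`, `M = d M'`, and let `w = (M', N')` be the ray on which
`x ^ N` and `y ^ M` have the same order. Blowing up the origin of the chart of a cone spanned by
two rays `p`, `q` subdivides this cone by the ray `p + q`. Starting from the whole quadrant and
always subdividing the cone which contains `w`, one reaches `w` by the subtractive Euclidean
algorithm (`exists_isModel_ray`); all the rays which occur are bounded by `w`, and this bounds
the multiplicities. The structure `IsModel` collects what is needed of such a modification, and
`IsModel.blowup` is the induction step. The blow-ups are constructed by gluing two affine charts
(`exists_blowup`), which suffices because the center is defined by a regular pair `(u, v)` in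
a single affine chart.

The chart of the cone spanned by `p` and `q` is the base change to `W[[x, y]]` of `W[u, v]`, with
`x = u ^ p₁ * v ^ q₁` and `y = u ^ p₂ * v ^ q₂`. Only its universal property, the regularity of `u`
and `v`, and the preservation of nonzerodivisors are used (`IsMonomialChart`), so that neither
flatness nor a description of its ring by power series is needed. In this chart, the
pullback of `x ^ N + y ^ M` is a monomial in `u` and `v` times `1 + (u ^ δ * v ^ δ') ^ d`, where `δ`
and `δ'` are the distances of `p` and `q` from `w`, measured by determinants. The second factor is
prime to `u` unless `p = w`, and to `v` unless `q = w`. Moreover `u` and `v` are never zero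
divisors modulo it, so it defines the proper transform (`IsModel.hasEquation`), which meets only the
divisor of `w`. In the chart which follows `w`
its equation is `1 + v ^ d`. Since `d` is invertible, `(u, 1 + v ^ d)` are étale coordinates where
`v` is invertible (`etale_powMap`), whence the normal crossings (`IsModel.hasCoordinates`), and
the intersection with `u = 0` is `Spec W[T]/(T ^ d + 1)`.

If `η ^ d = -1`, the powers of a root `ζ` of the cyclotomic polynomial yield a factorization of
`1 + v ^ d` into the linear factors `1 - η ζ ^ l v`
(`pow_sub_pow_eq_prod_of_isRoot_cyclotomic`), and their differences are units because the
derivative of `s ^ d + 1` is a unit at its roots `η ζ ^ l` (`isUnit_sub_of_prod_eq`). That a branch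
is integral over a domain `W` follows from its parametrization by `W[[τ]]`
(`IsMonomialChart.isPrime_span`); the kernel of the corresponding parametrization of
the branch of a cusp in `W[[x, y]]` is computed in `dvd_of_subst_eq_zero`.
-/

noncomputable section

namespace FermatResolution

open Limits TopologicalSpace Scheme.IdealSheafData

/-! ### Ideal sheaves on affine schemes and along open immersions -/

section AffineIdealSheaf

variable {A B : Type u} [CommRing A] [CommRing B]

lemma ker_specMap (φ : A →+* B) :
    (Spec.map (CommRingCat.ofHom φ)).ker =
      equivOfIsAffine.symm
        ((RingHom.ker φ).comap (Scheme.ΓSpecIso (CommRingCat.of A)).hom.hom) := by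
  rw [Scheme.ker_of_isAffine]
  simp only [equivOfIsAffine_symm_apply]
  congr 1
  rw [RingHom.comap_ker, ← CommRingCat.hom_ofHom φ, ← CommRingCat.hom_comp,
    ← Scheme.ΓSpecIso_naturality]
  ext x
  simp only [RingHom.mem_ker, CommRingCat.hom_comp, RingHom.comp_apply]
  exact (map_eq_zero_iff _ (ConcreteCategory.bijective_of_isIso
    (Scheme.ΓSpecIso (CommRingCat.of B)).hom).1).symm

lemma idealSheaf_eq (I : Ideal A) :
    idealSheaf I = equivOfIsAffine.symm
      (I.comap (Scheme.ΓSpecIso (CommRingCat.of A)).hom.hom) := by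
  rw [idealSheaf, ker_specMap, Ideal.mk_ker]

lemma ker_specMap_eq (φ : A →+* B) :
    (Spec.map (CommRingCat.ofHom φ)).ker = idealSheaf (RingHom.ker φ) := by
  rw [ker_specMap, idealSheaf_eq]

lemma comap_ΓSpecIso_eq_map (I : Ideal A) :
    I.comap (Scheme.ΓSpecIso (CommRingCat.of A)).hom.hom =
      I.map (Scheme.ΓSpecIso (CommRingCat.of A)).symm.commRingCatIsoToRingEquiv :=
  (Ideal.map_symm (Scheme.ΓSpecIso (CommRingCat.of A)).commRingCatIsoToRingEquiv).symm

lemma idealSheaf_mul (I J : Ideal A) : idealSheaf (I * J) = idealSheaf I * idealSheaf J := by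
  simp only [idealSheaf_eq]
  rw [comap_ΓSpecIso_eq_map, comap_ΓSpecIso_eq_map, comap_ΓSpecIso_eq_map, ← map_mul,
    Ideal.map_mul]

lemma idealSheaf_sup (I J : Ideal A) : idealSheaf (I ⊔ J) = idealSheaf I ⊔ idealSheaf J := by
  simp only [idealSheaf_eq, ← add_eq_sup]
  rw [comap_ΓSpecIso_eq_map, comap_ΓSpecIso_eq_map, comap_ΓSpecIso_eq_map, ← map_add,
    Ideal.map_sup]
  rfl

lemma idealSheaf_le_iff {I J : Ideal A} : idealSheaf I ≤ idealSheaf J ↔ I ≤ J := by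
  rw [idealSheaf_eq, idealSheaf_eq, map_le_map_iff]
  exact Ideal.comap_le_comap_iff_of_surjective _
    (ConcreteCategory.bijective_of_isIso (Scheme.ΓSpecIso (CommRingCat.of A)).hom).2 _ _

lemma idealSheaf_injective : Function.Injective (idealSheaf (A := A)) := fun _ _ h ↦
  le_antisymm (idealSheaf_le_iff.mp h.le) (idealSheaf_le_iff.mp h.ge)

lemma idealSheaf_surjective : Function.Surjective (idealSheaf (A := A)) := by
  intro D
  refine ⟨(equivOfIsAffine D).comap (Scheme.ΓSpecIso (CommRingCat.of A)).inv.hom, ?_⟩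
  rw [idealSheaf_eq, Ideal.comap_comap, ← CommRingCat.hom_comp, Iso.hom_inv_id]
  exact equivOfIsAffine.symm_apply_apply D

@[simp]
lemma idealSheaf_top : idealSheaf (⊤ : Ideal A) = ⊤ := by
  obtain ⟨I, hI⟩ := idealSheaf_surjective (A := A) ⊤
  exact top_le_iff.mp (hI ▸ idealSheaf_le_iff.mpr le_top)

lemma idealSheaf_pow (I : Ideal A) (n : ℕ) : idealSheaf (I ^ n) = idealSheaf I ^ n := by
  induction n with
  | zero => simp [Ideal.one_eq_top]
  | succ n ih => rw [pow_succ, pow_succ, idealSheaf_mul, ih]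

lemma idealSheaf_prod {ι : Type*} (s : Finset ι) (I : ι → Ideal A) :
    idealSheaf (∏ i ∈ s, I i) = ∏ i ∈ s, idealSheaf (I i) := by
  classical
  induction s using Finset.induction_on with
  | empty => simp [Ideal.one_eq_top]
  | insert a s ha ih => rw [Finset.prod_insert ha, Finset.prod_insert ha, idealSheaf_mul, ih]

lemma map_idealSheaf (φ : A →+* B) (J : Ideal B) :
    (idealSheaf J).map (Spec.map (CommRingCat.ofHom φ)) = idealSheaf (J.comap φ) := by
  rw [idealSheaf, map_ker, ← Spec.map_comp, ← CommRingCat.ofHom_comp, ker_specMap_eq,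
    ← RingHom.comap_ker, Ideal.mk_ker]

lemma comap_idealSheaf (φ : A →+* B) (I : Ideal A) :
    (idealSheaf I).comap (Spec.map (CommRingCat.ofHom φ)) = idealSheaf (I.map φ) := by
  refine eq_of_forall_ge_iff fun D ↦ ?_
  obtain ⟨J, rfl⟩ := idealSheaf_surjective D
  rw [← le_map_iff_comap_le, map_idealSheaf, idealSheaf_le_iff, idealSheaf_le_iff,
    Ideal.map_le_iff_le_comap]

instance isClosedImmersion_specMap_mk (I : Ideal A) :
    IsClosedImmersion (Spec.map (CommRingCat.ofHom (Ideal.Quotient.mk I))) :=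
  IsClosedImmersion.spec_of_surjective _ Ideal.Quotient.mk_surjective

lemma mem_support_idealSheaf (I : Ideal A) (x : Spec (CommRingCat.of A)) :
    x ∈ (idealSheaf I).support ↔ I ≤ x.asIdeal := by
  rw [← SetLike.mem_coe, idealSheaf, Scheme.Hom.support_ker]
  have h : Set.range (Spec.map (CommRingCat.ofHom (Ideal.Quotient.mk I))) =
      PrimeSpectrum.zeroLocus (I : Set A) := by
    have := range_comap_of_surjective _ (Ideal.Quotient.mk I) Ideal.Quotient.mk_surjective
    rw [Ideal.mk_ker] at this
    exact this
  have hc : IsClosed (Set.range (Spec.map (CommRingCat.ofHom (Ideal.Quotient.mk I)))) :=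
    (Spec.map (CommRingCat.ofHom (Ideal.Quotient.mk I))).isClosedMap.isClosed_range
  rw [hc.closure_eq, h]
  rfl

end AffineIdealSheaf

section OpenImmersion

variable {X Y : Scheme.{u}}

lemma comap_mul_of_isOpenImmersion (I J : Y.IdealSheafData) (f : X ⟶ Y) [IsOpenImmersion f] :
    (I * J).comap f = I.comap f * J.comap f := by
  ext U : 2
  simp only [ideal_comap_of_isOpenImmersion, ideal_mul, Pi.mul_apply]
  have h (K : Ideal Γ(Y, f ''ᵁ U)) : K.comap (f.appIso U).inv.hom =
      K.map (f.appIso U).commRingCatIsoToRingEquiv := by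
    exact (Ideal.map_symm (f.appIso U).symm.commRingCatIsoToRingEquiv).symm
  rw [h, h, h, Ideal.map_mul]

lemma comap_pow_of_isOpenImmersion (I : Y.IdealSheafData) (f : X ⟶ Y) [IsOpenImmersion f]
    (n : ℕ) : (I ^ n).comap f = I.comap f ^ n := by
  induction n with
  | zero => simp
  | succ n ih => rw [pow_succ, pow_succ, comap_mul_of_isOpenImmersion, ih]

lemma comap_prod_of_isOpenImmersion {ι : Type*} (s : Finset ι) (I : ι → Y.IdealSheafData)
    (f : X ⟶ Y) [IsOpenImmersion f] :
    (∏ i ∈ s, I i).comap f = ∏ i ∈ s, (I i).comap f := by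
  classical
  induction s using Finset.induction_on with
  | empty => simp
  | insert a s ha ih =>
    rw [Finset.prod_insert ha, Finset.prod_insert ha, comap_mul_of_isOpenImmersion, ih]

/-- The ring of an affine chart is identified with the sections over its range, so that ideals of
the former and sections of ideal sheaves correspond. -/
lemma exists_ringEquiv_ideal_opensRange {B : Type u} [CommRing B] (j : Spec (CommRingCat.of B) ⟶ Y)
    [IsOpenImmersion j] :
    ∃ e : Γ(Y, j.opensRange) ≃+* B, ∀ (D : Y.IdealSheafData) (I : Ideal B),
      D.comap j = idealSheaf I ↔
        D.ideal ⟨j.opensRange, isAffineOpen_opensRange j⟩ = I.comap (e : _ →+* B) := by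
  have hj : j.opensRange = j ''ᵁ ⊤ := by simp
  let e₁ : Γ(Y, j.opensRange) ≅ Γ(Y, j ''ᵁ ⊤) := Y.presheaf.mapIso (eqToIso hj.symm).op
  let e₂ := e₁ ≪≫ j.appIso ⊤
  let e := e₂ ≪≫ Scheme.ΓSpecIso (CommRingCat.of B)
  refine ⟨e.commRingCatIsoToRingEquiv, fun D I ↦ ?_⟩
  have h1 : equivOfIsAffine (D.comap j) =
      (D.ideal ⟨j.opensRange, isAffineOpen_opensRange j⟩).comap e₂.inv.hom := by
    rw [equivOfIsAffine_apply, ideal_comap_of_isOpenImmersion]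
    have h2 : D.ideal ⟨j ''ᵁ ⊤, (isAffineOpen_top _).image_of_isOpenImmersion j⟩ =
        (D.ideal ⟨j.opensRange, isAffineOpen_opensRange j⟩).comap e₁.inv.hom := by
      have h3 := D.map_ideal' (U := ⟨j ''ᵁ ⊤, (isAffineOpen_top _).image_of_isOpenImmersion j⟩)
        (V := ⟨j.opensRange, isAffineOpen_opensRange j⟩) (eqToIso hj.symm).op.hom
      rw [← h3]
      exact (Ideal.map_symm e₁.symm.commRingCatIsoToRingEquiv)
    rw [h2, Ideal.comap_comap]
    rfl
  have hs : Function.Surjective e₂.inv.hom :=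
    (ConcreteCategory.bijective_of_isIso e₂.inv).2
  rw [idealSheaf_eq, ← EquivLike.apply_eq_iff_eq equivOfIsAffine, h1]
  erw [OrderRingIso.apply_symm_apply]
  have hse : Function.Surjective e₂.hom.hom :=
    (ConcreteCategory.bijective_of_isIso e₂.hom).2
  rw [← (Ideal.comap_injective_of_surjective _ hse).eq_iff, Ideal.comap_comap, Ideal.comap_comap,
    ← CommRingCat.hom_comp, ← CommRingCat.hom_comp, Iso.hom_inv_id]
  rfl

/-- Ideal sheaves that agree on jointly surjective affine charts are equal. -/
lemma ext_of_charts {ι : Type*} {B : ι → Type u} [∀ i, CommRing (B i)]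
    (j : ∀ i, Spec (CommRingCat.of (B i)) ⟶ Y) [∀ i, IsOpenImmersion (j i)]
    (hj : ∀ y : Y, ∃ i, y ∈ (j i).opensRange) {I J : Y.IdealSheafData}
    (h : ∀ i, I.comap (j i) = J.comap (j i)) : I = J := by
  refine ext_of_iSup_eq_top (fun i ↦ ⟨(j i).opensRange, isAffineOpen_opensRange (j i)⟩) ?_ ?_
  · exact top_le_iff.mp fun y _ ↦ TopologicalSpace.Opens.mem_iSup.mpr (hj y)
  · intro i
    obtain ⟨e, he⟩ := exists_ringEquiv_ideal_opensRange (j i)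
    obtain ⟨K, hK⟩ := idealSheaf_surjective (I.comap (j i))
    rw [(he I K).mp hK.symm, (he J K).mp (by rw [← h, hK])]

lemma isEffectiveCartier_of_charts {D : Y.IdealSheafData}
    (h : ∀ y : Y, ∃ (B : Type u) (_ : CommRing B) (j : Spec (CommRingCat.of B) ⟶ Y)
      (_ : IsOpenImmersion j) (a : B), y ∈ j.opensRange ∧ a ∈ nonZeroDivisors B ∧
        D.comap j = idealSheaf (Ideal.span {a})) : IsEffectiveCartier D := by
  intro y
  obtain ⟨B, _, j, _, a, hy, ha, hD⟩ := h y
  obtain ⟨e, he⟩ := exists_ringEquiv_ideal_opensRange j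
  refine ⟨⟨j.opensRange, isAffineOpen_opensRange j⟩, hy, e.symm a, ?_, ?_⟩
  · rw [mem_nonZeroDivisors_iff_right] at ha ⊢
    intro x hx
    have h0 : e x * a = 0 := by
      rw [← e.apply_symm_apply a, ← map_mul]
      exact (map_eq_zero_iff e e.injective).mpr hx
    exact (map_eq_zero_iff e e.injective).mp (ha _ h0)
  · rw [(he D _).mp hD, ← Set.image_singleton, ← Ideal.map_span]
    exact (Ideal.map_symm e).symm

lemma comap_ker_of_isPullback {U V W : Scheme.{u}} {f' : U ⟶ V} {g : U ⟶ W} {j : V ⟶ Y}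
    {f : W ⟶ Y} [IsOpenImmersion j] [QuasiCompact f] (h : IsPullback f' g j f) :
    f.ker.comap j = f'.ker := by
  ext K : 2
  rw [Scheme.ker_ideal_of_isPullback_of_isOpenImmersion f f' g j h, ideal_comap_of_isOpenImmersion]

/-- Pushforward of ideal sheaves along a quasi-compact open immersion commutes with restriction
to an open subscheme. -/
lemma comap_map_of_isPullback {U V W : Scheme.{u}} {f' : U ⟶ V} {g : U ⟶ W} {j : V ⟶ Y}
    {f : W ⟶ Y} [IsOpenImmersion j] [QuasiCompact f] (h : IsPullback f' g j f)
    (I : W.IdealSheafData) : (I.map f).comap j = (I.comap g).map f' := by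
  have h1 : IsPullback (I.comap g).subschemeι (subschemeMap _ _ g (I.le_map_comap g))
      g I.subschemeι :=
    isPullback_of_isClosedImmersion _ _ _ _ (by simp) (by simp)
  rw [Scheme.IdealSheafData.map, Scheme.IdealSheafData.map,
    comap_ker_of_isPullback (h1.paste_horiz h)]

/-- The complement of an effective Cartier divisor is schematically dense. -/
lemma ker_compl_support_eq_bot {D : Y.IdealSheafData} (hD : IsEffectiveCartier D) :
    (Scheme.Opens.ι D.support.compl).ker = ⊥ := by
  choose U hU a ha hDa using hD
  refine le_bot_iff.mp (le_of_iSup_eq_top U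
    (top_le_iff.mp fun y _ ↦ TopologicalSpace.Opens.mem_iSup.mpr ⟨y, hU y⟩) fun y s hs ↦ ?_)
  have hs' := Scheme.Hom.ideal_ker_le _ _ hs
  have hb : (Y.basicOpen (a y)) ≤ D.support.compl := by
    intro z hz hzD
    have := (mem_support_iff_of_mem (I := D) (U := U y) (Y.basicOpen_le _ hz)).mp hzD
    rw [hDa, Scheme.mem_zeroLocus_iff] at this
    exact this _ (Ideal.mem_span_singleton_self _) hz
  have h0 : Y.presheaf.map (homOfLE (Y.basicOpen_le (a y))).op s = 0 := by
    have h1 := RingHom.mem_ker.mp hs'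
    rw [Scheme.Opens.ι_app] at h1
    have hle : Y.basicOpen (a y) ≤ (Scheme.Opens.ι D.support.compl) ''ᵁ
        (Scheme.Opens.ι D.support.compl) ⁻¹ᵁ (U y).1 := by
      rw [Scheme.Hom.image_preimage_eq_opensRange_inf, Scheme.Opens.opensRange_ι]
      exact le_inf hb (Y.basicOpen_le _)
    have h2 : Y.presheaf.map (homOfLE (Y.basicOpen_le (a y))).op =
        Y.presheaf.map (homOfLE ((Scheme.Opens.ι D.support.compl).image_preimage_le _)).op ≫
          Y.presheaf.map (homOfLE hle).op := by
      rw [← Functor.map_comp]; rfl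
    rw [h2, CommRingCat.comp_apply]
    exact (congrArg _ h1).trans (map_zero _)
  have := (U y).2.isLocalization_basicOpen (a y)
  obtain ⟨⟨_, n, rfl⟩, hc⟩ :=
    (IsLocalization.map_eq_zero_iff (.powers (a y)) Γ(Y, Y.basicOpen (a y)) s).mp h0
  simpa using (mem_nonZeroDivisors_iff.mp (pow_mem (ha y) n)).1 _ hc

end OpenImmersion

/-! ### Regular pairs and the affine charts of a blow-up -/

section BlowupAlgebra

variable {B : Type u} [CommRing B]

/-- Both orders of the pair `u, v` are regular sequences, without the condition that `u` and `v`
generate a proper ideal. -/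
structure RegPair (u v : B) : Prop where
  left : ∀ b, u * b = 0 → b = 0
  right : ∀ b, v * b = 0 → b = 0
  left_mod : ∀ b, v ∣ u * b → v ∣ b
  right_mod : ∀ b, u ∣ v * b → u ∣ b

lemma RegPair.symm {u v : B} (h : RegPair u v) : RegPair v u :=
  ⟨h.right, h.left, h.right_mod, h.left_mod⟩

/-- The algebra `B[v/u] = B[T]/(u T - v)`, an affine chart of the blow-up of `B` in `(u, v)`. -/
abbrev BlowupAlg (u v : B) : Type u :=
  AdjoinRoot (Polynomial.C u * Polynomial.X - Polynomial.C v)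

namespace BlowupAlg

open Polynomial AdjoinRoot

variable (u v : B)

/-- The structure map of `B[v/u]`. -/
abbrev incl : B →+* BlowupAlg u v := AdjoinRoot.of _

/-- The element `v/u` of `B[v/u]`. -/
abbrev ratio : BlowupAlg u v := AdjoinRoot.root _

lemma mul_ratio : incl u v u * ratio u v = incl u v v := by
  have h := mk_self (f := C u * X - C v)
  rwa [map_sub, map_mul, mk_C, mk_X, mk_C, sub_eq_zero] at h

lemma mk_X_eq : mk (C u * X - C v) X = ratio u v := rfl

variable {u v}

lemma hom_ext {R : Type*} [CommRing R] {f g : BlowupAlg u v →+* R}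
    (h : f.comp (incl u v) = g.comp (incl u v)) (h' : f (ratio u v) = g (ratio u v)) : f = g :=
  AdjoinRoot.ringHom_ext h h'

/-- A ring map out of `B[v/u]`, given by the image `t` of `v/u`. -/
def desc {R : Type*} [CommRing R] (f : B →+* R) (t : R) (ht : f u * t = f v) :
    BlowupAlg u v →+* R :=
  AdjoinRoot.lift f t (by simp [ht])

@[simp]
lemma desc_incl {R : Type*} [CommRing R] (f : B →+* R) (t : R) (ht : f u * t = f v) (b : B) :
    desc f t ht (incl u v b) = f b := AdjoinRoot.lift_of _

@[simp]
lemma desc_comp_incl {R : Type*} [CommRing R] (f : B →+* R) (t : R) (ht : f u * t = f v) :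
    (desc f t ht).comp (incl u v) = f := RingHom.ext (desc_incl f t ht)

@[simp]
lemma desc_ratio {R : Type*} [CommRing R] (f : B →+* R) (t : R) (ht : f u * t = f v) :
    desc f t ht (ratio u v) = t := AdjoinRoot.lift_root _

lemma eq_zero_of_mul_eq_zero (h : RegPair u v) (z : BlowupAlg u v)
    (hz : incl u v u * z = 0) : z = 0 := by
  obtain ⟨p, rfl⟩ := mk_surjective z
  rw [← mk_C, ← map_mul, mk_eq_zero] at hz
  obtain ⟨q, hq⟩ := hz
  have h1 : C u ∣ C v * q := ⟨X * q - p, by linear_combination hq⟩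
  have h2 : C u ∣ q := by
    rw [C_dvd_iff_dvd_coeff] at h1 ⊢
    exact fun i ↦ h.right_mod _ (by simpa using h1 i)
  obtain ⟨q', rfl⟩ := h2
  rw [mk_eq_zero]
  refine ⟨q', ?_⟩
  have h3 : C u * (p - (C u * X - C v) * q') = 0 := by linear_combination hq
  rw [← sub_eq_zero]
  ext i
  exact h.left _ (by simpa using congr(coeff $h3 i))

/-- The exceptional divisor and the strict transform of `v = 0` again form a regular pair in a
chart of the blow-up, so that the construction can be iterated. -/
lemma regPair (h : RegPair u v) : RegPair (incl u v u) (ratio u v) where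
  left := eq_zero_of_mul_eq_zero h
  right z hz := by
    obtain ⟨p, rfl⟩ := mk_surjective z
    rw [← mk_X_eq, ← map_mul, mk_eq_zero] at hz
    obtain ⟨q, hq⟩ := hz
    have h1 : X ∣ q := by
      rw [X_dvd_iff]
      refine h.right _ ?_
      simpa [mul_coeff_zero] using congr(coeff $hq 0)
    obtain ⟨q', rfl⟩ := h1
    rw [mk_eq_zero]
    refine ⟨q', ?_⟩
    have : X * (p - (C u * X - C v) * q') = 0 := by linear_combination hq
    rw [← sub_eq_zero]
    ext i
    simpa using congr(coeff $this (i + 1))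
  left_mod z hz := by
    obtain ⟨p, rfl⟩ := mk_surjective z
    obtain ⟨w, hw⟩ := hz
    obtain ⟨r, rfl⟩ := mk_surjective w
    rw [← mk_X_eq, ← mk_C, ← map_mul, ← map_mul, mk_eq_mk] at hw
    obtain ⟨q, hq⟩ := hw
    have h0 : u * p.coeff 0 = - (v * q.coeff 0) := by
      simpa [mul_coeff_zero] using congr(coeff $hq 0)
    obtain ⟨c, hc⟩ := h.right_mod (q.coeff 0) ⟨- p.coeff 0, by linear_combination h0⟩
    have h1 : p.coeff 0 = - (v * c) := by
      rw [← sub_eq_zero]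
      refine h.left _ ?_
      rw [hc] at h0
      linear_combination h0
    refine ⟨mk _ p.divX - incl u v u * incl u v c, ?_⟩
    conv_lhs => rw [← X_mul_divX_add p, map_add, map_mul, mk_X, mk_C, h1]
    rw [map_neg, map_mul, ← mul_ratio]
    ring
  right_mod z hz := by
    obtain ⟨p, rfl⟩ := mk_surjective z
    obtain ⟨w, hw⟩ := hz
    obtain ⟨r, rfl⟩ := mk_surjective w
    rw [← mk_X_eq, ← mk_C, ← map_mul, ← map_mul, mk_eq_mk] at hw
    obtain ⟨q, hq⟩ := hw
    have h1 : C u ∣ p + C v * q.divX := by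
      rw [C_dvd_iff_dvd_coeff]
      intro i
      refine ⟨r.coeff (i + 1) + q.coeff i, ?_⟩
      have := congr(coeff $hq (i + 1))
      simp only [coeff_sub, coeff_X_mul, coeff_C_mul, sub_mul, mul_assoc] at this
      simp only [coeff_add, coeff_C_mul, coeff_divX]
      linear_combination this
    obtain ⟨w, hw⟩ := h1
    refine ⟨mk _ w - ratio u v * mk _ q.divX, ?_⟩
    have := congr(mk (C u * X - C v) $hw)
    simp only [map_add, map_mul, mk_C] at this
    rw [← sub_eq_zero]
    linear_combination this + mk _ q.divX * mul_ratio u v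

/-- The algebra `B[v/u]` becomes equal to `B` when `u` is inverted. -/
lemma exists_pow_mul_eq_incl (z : BlowupAlg u v) :
    ∃ (n : ℕ) (b : B), incl u v u ^ n * z = incl u v b := by
  obtain ⟨p, rfl⟩ := mk_surjective z
  induction p using Polynomial.induction_on' with
  | add p q hp hq =>
    obtain ⟨n, b, hb⟩ := hp
    obtain ⟨m, c, hc⟩ := hq
    refine ⟨n + m, u ^ m * b + u ^ n * c, ?_⟩
    simp only [map_add, map_mul, map_pow]
    rw [← hb, ← hc]
    ring
  | monomial n a =>
    refine ⟨n, a * v ^ n, ?_⟩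
    rw [← C_mul_X_pow_eq_monomial, map_mul, map_pow, mk_X, mk_C, map_mul, map_pow, ← mul_ratio]
    ring

lemma incl_injective (hu : ∀ b, u * b = 0 → b = 0) : Function.Injective (incl u v) := by
  rw [injective_iff_map_eq_zero]
  intro b hb
  rw [← mk_C, mk_eq_zero] at hb
  obtain ⟨q, hq⟩ := hb
  have h0 : q.leadingCoeff = 0 := by
    refine hu _ ?_
    have := congr(coeff $hq (q.natDegree + 1))
    rw [coeff_C_succ, sub_mul, coeff_sub, mul_assoc, coeff_C_mul, coeff_X_mul, coeff_C_mul,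
      coeff_eq_zero_of_natDegree_lt (Nat.lt_succ_self _)] at this
    rw [leadingCoeff]
    linear_combination - this
  rw [leadingCoeff_eq_zero] at h0
  simpa [h0] using hq

lemma incl_mem_nonZeroDivisors (h : RegPair u v) {g : B} (hg : g ∈ nonZeroDivisors B) :
    incl u v g ∈ nonZeroDivisors (BlowupAlg u v) := by
  rw [mem_nonZeroDivisors_iff_right] at hg ⊢
  intro z hz
  obtain ⟨n, b, hb⟩ := exists_pow_mul_eq_incl z
  have h1 : b = 0 := by
    refine hg _ (incl_injective (v := v) h.left ?_)
    rw [map_mul, ← hb, mul_assoc, hz, mul_zero, map_zero]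
  rw [h1, map_zero] at hb
  clear hz
  induction n with
  | zero => simpa using hb
  | succ n ih => exact ih (eq_zero_of_mul_eq_zero h _ (by rw [← hb]; ring))

end BlowupAlg

end BlowupAlgebra

/-! ### Monomial charts -/

section MonomialChart

variable {W : Type u} [CommRing W]

/-- Splitting off the part of a power series divisible by the first variable. -/
lemma exists_eq_C_add_X_mul (a : MvPowerSeries (Fin 2) W) :
    ∃ a₀ a₁, a = MvPowerSeries.C (MvPowerSeries.constantCoeff a) + MvPowerSeries.X 0 * a₀ +
      MvPowerSeries.X 1 * a₁ := by
  classical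
  let a₀ : MvPowerSeries (Fin 2) W := fun m ↦ MvPowerSeries.coeff (m + Finsupp.single 0 1) a
  have h : (MvPowerSeries.X 1 : MvPowerSeries (Fin 2) W) ∣
      a - MvPowerSeries.C (MvPowerSeries.constantCoeff a) - MvPowerSeries.X 0 * a₀ := by
    rw [MvPowerSeries.X_dvd_iff]
    intro m hm
    rw [map_sub, map_sub, MvPowerSeries.coeff_C]
    by_cases h0 : m 0 = 0
    · have hm0 : m = 0 := by
        ext i; fin_cases i
        · exact h0
        · exact hm
      subst hm0
      simp
    · obtain ⟨k, rfl⟩ : ∃ k, m = Finsupp.single 0 1 + k :=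
        ⟨m - Finsupp.single 0 1, by
          rw [add_tsub_cancel_of_le]
          simpa [Finsupp.single_le_iff] using Nat.one_le_iff_ne_zero.mpr h0⟩
      have hk : (Finsupp.single 0 1 + k : Fin 2 →₀ ℕ) ≠ 0 := fun h ↦ h0 (by simp [h])
      rw [if_neg hk, MvPowerSeries.X, MvPowerSeries.coeff_add_monomial_mul]
      rw [one_mul, sub_zero, sub_eq_zero, add_comm]
      rfl
  obtain ⟨a₁, h₁⟩ := h
  exact ⟨a₀, a₁, by linear_combination h₁⟩

lemma regPair_X : RegPair (MvPowerSeries.X 0 : MvPowerSeries (Fin 2) W) (MvPowerSeries.X 1) := by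
  have hm (i k : Fin 2) (hik : i ≠ k) (b : MvPowerSeries (Fin 2) W)
      (h : MvPowerSeries.X k ∣ MvPowerSeries.X i * b) : MvPowerSeries.X k ∣ b := by
    rw [MvPowerSeries.X_dvd_iff] at h ⊢
    intro m hmk
    have := h (Finsupp.single i 1 + m) (by simp [hmk, hik])
    rwa [MvPowerSeries.X, MvPowerSeries.coeff_add_monomial_mul, one_mul] at this
  exact ⟨fun b hb ↦ (mem_nonZeroDivisors_iff.mp MvPowerSeries.X_mem_nonzeroDivisors).1 _ hb,
    fun b hb ↦ (mem_nonZeroDivisors_iff.mp MvPowerSeries.X_mem_nonzeroDivisors).1 _ hb,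
    hm _ _ (by decide), hm _ _ (by decide)⟩

/-- The `W[[x, y]]`-algebra `φ : W[[x, y]] → B` is the affine toric chart of the cone spanned by
the rays `p` and `q`: it is the base change along `W[x, y] → W[[x, y]]` of the polynomial ring
`W[u, v]`, in which `x = u ^ p₁ * v ^ q₁` and `y = u ^ p₂ * v ^ q₂`. This is
encoded by the universal property `existsUnique`. -/
structure IsMonomialChart {B : Type u} [CommRing B] (φ : MvPowerSeries (Fin 2) W →+* B) (u v : B)
    (p q : ℕ × ℕ) : Prop where
  map_X_zero : φ (MvPowerSeries.X 0) = u ^ p.1 * v ^ q.1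
  map_X_one : φ (MvPowerSeries.X 1) = u ^ p.2 * v ^ q.2
  existsUnique : ∀ {R : Type u} [CommRing R] (ψ : MvPowerSeries (Fin 2) W →+* R) (s t : R),
    ψ (MvPowerSeries.X 0) = s ^ p.1 * t ^ q.1 → ψ (MvPowerSeries.X 1) = s ^ p.2 * t ^ q.2 →
      ∃! θ : B →+* R, θ.comp φ = ψ ∧ θ u = s ∧ θ v = t
  regPair : RegPair u v
  map_mem : ∀ {g}, g ∈ nonZeroDivisors (MvPowerSeries (Fin 2) W) → φ g ∈ nonZeroDivisors B

namespace IsMonomialChart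

lemma id : IsMonomialChart (RingHom.id (MvPowerSeries (Fin 2) W)) (MvPowerSeries.X 0)
    (MvPowerSeries.X 1) (1, 0) (0, 1) where
  map_X_zero := by simp
  map_X_one := by simp
  existsUnique ψ s t hs ht := by
    refine ⟨ψ, ⟨rfl, by simpa using hs, by simpa using ht⟩, fun θ h ↦ ?_⟩
    simpa using h.1
  regPair := regPair_X
  map_mem := fun h ↦ h

variable {B : Type u} [CommRing B] {φ : MvPowerSeries (Fin 2) W →+* B} {u v : B} {p q : ℕ × ℕ}

lemma symm (h : IsMonomialChart φ u v p q) : IsMonomialChart φ v u q p where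
  map_X_zero := by rw [h.map_X_zero, mul_comm]
  map_X_one := by rw [h.map_X_one, mul_comm]
  existsUnique ψ s t hs ht := by
    obtain ⟨θ, ⟨h1, h2, h3⟩, hθ⟩ := h.existsUnique ψ t s (by rw [hs, mul_comm])
      (by rw [ht, mul_comm])
    exact ⟨θ, ⟨h1, h3, h2⟩, fun θ' ⟨h1', h2', h3'⟩ ↦ hθ θ' ⟨h1', h3', h2'⟩⟩
  regPair := h.regPair.symm
  map_mem := h.map_mem

/-- The blow-up of the origin of a chart subdivides its cone by the sum of the two rays. -/
lemma blowup (h : IsMonomialChart φ u v p q) :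
    IsMonomialChart ((BlowupAlg.incl u v).comp φ) (BlowupAlg.incl u v u) (BlowupAlg.ratio u v)
      (p + q) q where
  map_X_zero := by
    rw [RingHom.comp_apply, h.map_X_zero, map_mul, map_pow, map_pow, ← BlowupAlg.mul_ratio,
      Prod.fst_add]
    ring
  map_X_one := by
    rw [RingHom.comp_apply, h.map_X_one, map_mul, map_pow, map_pow, ← BlowupAlg.mul_ratio,
      Prod.snd_add]
    ring
  existsUnique ψ s t hs ht := by
    obtain ⟨θ, ⟨h1, h2, h3⟩, hθ⟩ := h.existsUnique ψ s (s * t)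
      (by rw [hs, Prod.fst_add]; ring) (by rw [ht, Prod.snd_add]; ring)
    refine ⟨BlowupAlg.desc θ t (by rw [h2, h3]), ⟨?_, by simp [h2], by simp⟩, ?_⟩
    · rw [← RingHom.comp_assoc, BlowupAlg.desc_comp_incl, h1]
    · rintro θ' ⟨h1', h2', h3'⟩
      refine BlowupAlg.hom_ext ?_ (by simp [h3'])
      rw [BlowupAlg.desc_comp_incl]
      refine hθ _ ⟨by rw [RingHom.comp_assoc, h1'], h2', ?_⟩
      rw [RingHom.comp_apply, ← BlowupAlg.mul_ratio, map_mul, h2', h3']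
  regPair := BlowupAlg.regPair h.regPair
  map_mem hg := BlowupAlg.incl_mem_nonZeroDivisors h.regPair (h.map_mem hg)

lemma hom_ext (h : IsMonomialChart φ u v p q) {R : Type u} [CommRing R] {f g : B →+* R}
    (h₁ : f.comp φ = g.comp φ) (h₂ : f u = g u) (h₃ : f v = g v) : f = g := by
  obtain ⟨θ, -, hθ⟩ := h.existsUnique (f.comp φ) (f u) (f v)
    (by rw [RingHom.comp_apply, h.map_X_zero, map_mul, map_pow, map_pow])
    (by rw [RingHom.comp_apply, h.map_X_one, map_mul, map_pow, map_pow])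
  rw [hθ f ⟨rfl, rfl, rfl⟩, hθ g ⟨h₁.symm, h₂.symm, h₃.symm⟩]

lemma mk_comp_eq {R : Type u} [CommRing R] (ψ : MvPowerSeries (Fin 2) W →+* R)
    (h0 : ψ (MvPowerSeries.X 0) = 0) (h1 : ψ (MvPowerSeries.X 1) = 0) :
    (ψ.comp MvPowerSeries.C).comp MvPowerSeries.constantCoeff = ψ := by
  ext a
  obtain ⟨a₀, a₁, ha⟩ := exists_eq_C_add_X_mul a
  conv_rhs => rw [ha]
  simp [h0, h1]

/-- The origin of a monomial chart is a copy of `Spec W`. -/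
lemma exists_origin (h : IsMonomialChart φ u v p q) (h₁ : p.1 + q.1 ≠ 0) (h₂ : p.2 + q.2 ≠ 0) :
    ∃ σ : B →+* W, σ.comp φ = MvPowerSeries.constantCoeff ∧ σ u = 0 ∧ σ v = 0 ∧
      Function.Surjective σ ∧ RingHom.ker σ = Ideal.span {u, v} := by
  obtain ⟨σ, ⟨hσ, hu, hv⟩, -⟩ := h.existsUnique (MvPowerSeries.constantCoeff (R := W)) 0 0
    (by rw [← pow_add, MvPowerSeries.constantCoeff_X, zero_pow h₁])
    (by rw [← pow_add, MvPowerSeries.constantCoeff_X, zero_pow h₂])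
  have hu' : Ideal.Quotient.mk (Ideal.span {u, v}) u = 0 :=
    Ideal.Quotient.eq_zero_iff_mem.mpr (Ideal.subset_span (by simp))
  have hv' : Ideal.Quotient.mk (Ideal.span {u, v}) v = 0 :=
    Ideal.Quotient.eq_zero_iff_mem.mpr (Ideal.subset_span (by simp))
  have hc : ((((Ideal.Quotient.mk (Ideal.span {u, v})).comp φ).comp MvPowerSeries.C).comp σ) =
      Ideal.Quotient.mk (Ideal.span {u, v}) := by
    refine h.hom_ext ?_ (by simp [hu, hu']) (by simp [hv, hv'])
    rw [RingHom.comp_assoc, hσ, mk_comp_eq]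
    · rw [RingHom.comp_apply, h.map_X_zero, map_mul, map_pow, map_pow, hu', hv', ← pow_add,
        zero_pow h₁]
    · rw [RingHom.comp_apply, h.map_X_one, map_mul, map_pow, map_pow, hu', hv', ← pow_add,
        zero_pow h₂]
  refine ⟨σ, hσ, hu, hv, fun w ↦ ⟨φ (MvPowerSeries.C w), ?_⟩, le_antisymm ?_ ?_⟩
  · rw [← RingHom.comp_apply, hσ, MvPowerSeries.constantCoeff_C]
  · intro b hb
    rw [← Ideal.Quotient.eq_zero_iff_mem, ← hc, RingHom.comp_apply, RingHom.mem_ker.mp hb,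
      map_zero]
  · rw [Ideal.span_le]
    rintro _ (rfl | rfl) <;> simpa

/-- The divisor of an exceptional ray in a monomial chart is an affine line over `W`. -/
lemma exists_line (h : IsMonomialChart φ u v p q) (h₁ : q.1 ≠ 0) (h₂ : q.2 ≠ 0) :
    ∃ σ : B →+* Polynomial W, σ.comp φ = Polynomial.C.comp MvPowerSeries.constantCoeff ∧
      σ u = Polynomial.X ∧ σ v = 0 ∧
      Function.Surjective σ ∧ RingHom.ker σ = Ideal.span {v} := by
  obtain ⟨σ, ⟨hσ, hu, hv⟩, -⟩ := h.existsUnique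
    (Polynomial.C.comp (MvPowerSeries.constantCoeff (R := W))) Polynomial.X 0
    (by simp [h₁]) (by simp [h₂])
  have hv' : Ideal.Quotient.mk (Ideal.span {v}) v = 0 :=
    Ideal.Quotient.eq_zero_iff_mem.mpr (Ideal.subset_span (by simp))
  have hc : (Polynomial.eval₂RingHom (((Ideal.Quotient.mk (Ideal.span {v})).comp φ).comp
      MvPowerSeries.C) (Ideal.Quotient.mk _ u)).comp σ = Ideal.Quotient.mk (Ideal.span {v}) := by
    refine h.hom_ext ?_ (by simp [hu]) (by simp [hv, hv'])
    rw [RingHom.comp_assoc, hσ, ← RingHom.comp_assoc, Polynomial.eval₂RingHom_comp_C, mk_comp_eq]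
    · rw [RingHom.comp_apply, h.map_X_zero, map_mul, map_pow, map_pow, hv', zero_pow h₁, mul_zero]
    · rw [RingHom.comp_apply, h.map_X_one, map_mul, map_pow, map_pow, hv', zero_pow h₂, mul_zero]
  refine ⟨σ, hσ, hu, hv, fun w ↦ ?_, le_antisymm ?_ ?_⟩
  · refine ⟨Polynomial.eval₂ (φ.comp MvPowerSeries.C) u w, ?_⟩
    rw [Polynomial.hom_eval₂, ← RingHom.comp_assoc, hσ, hu, RingHom.comp_assoc,
      MvPowerSeries.constantCoeff_comp_C, RingHom.comp_id, Polynomial.eval₂_C_X]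
  · intro b hb
    rw [← Ideal.Quotient.eq_zero_iff_mem, ← hc, RingHom.comp_apply, RingHom.mem_ker.mp hb,
      map_zero]
  · rw [Ideal.span_le]
    rintro _ rfl
    simpa

end IsMonomialChart

end MonomialChart

/-! ### Gluing along open immersions -/

section Glue

variable {U X Y S P : Scheme.{u}}

instance isOpenImmersion_pushout_inl (f : U ⟶ X) (g : U ⟶ Y) [IsOpenImmersion f]
    [IsOpenImmersion g] : IsOpenImmersion (pushout.inl f g) :=
  inferInstanceAs (IsOpenImmersion (colimit.ι (span f g) WalkingSpan.left))

instance isOpenImmersion_pushout_inr (f : U ⟶ X) (g : U ⟶ Y) [IsOpenImmersion f]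
    [IsOpenImmersion g] : IsOpenImmersion (pushout.inr f g) :=
  inferInstanceAs (IsOpenImmersion (colimit.ι (span f g) WalkingSpan.right))

lemma pushout_cases (f : U ⟶ X) (g : U ⟶ Y) [IsOpenImmersion f] [IsOpenImmersion g]
    (z : ↥(pushout f g)) :
    (∃ x, pushout.inl f g x = z) ∨ ∃ y, pushout.inr f g y = z := by
  obtain ⟨i, x, hx⟩ := Scheme.IsLocallyDirected.ι_jointly_surjective (span f g) z
  match i, x, hx with
  | none, x, hx =>
    have hw : colimit.ι (span f g) none = f ≫ pushout.inl f g :=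
      (colimit.w (span f g) WalkingSpan.Hom.fst).symm
    rw [hw] at hx
    exact .inl ⟨f.base x, hx⟩
  | some WalkingPair.left, x, hx => exact .inl ⟨x, hx⟩
  | some WalkingPair.right, x, hx => exact .inr ⟨x, hx⟩

/-- Points of two schemes glued along `U` are identified only if they come from `U`. -/
lemma exists_of_inl_eq_inr (f : U ⟶ X) (g : U ⟶ Y) [IsOpenImmersion f] [IsOpenImmersion g]
    {x : X} {y : Y} (h : pushout.inl f g x = pushout.inr f g y) : ∃ z, f z = x ∧ g z = y := by
  obtain ⟨k, a, b, z, hz, hz'⟩ := (Scheme.IsLocallyDirected.ι_eq_ι_iff (span f g)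
    (i := WalkingSpan.left) (j := WalkingSpan.right)).mp h
  match k, a, b, z, hz, hz' with
  | none, .init _, .init _, z, hz, hz' => exact ⟨z, hz, hz'⟩

lemma exists_isPullback_morphismRestrict {a' : P ⟶ X} {p' : P ⟶ S} {p : X ⟶ Y} {a : S ⟶ Y}
    [IsOpenImmersion a] (h : IsPullback a' p' p a) :
    ∃ x, IsPullback x (p ∣_ a.opensRange) p' a.isoOpensRange.inv := by
  have h1 := (isPullback_morphismRestrict p a.opensRange).flip
  let x : (p ⁻¹ᵁ a.opensRange).toScheme ⟶ P := h.lift (Scheme.Opens.ι _)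
    ((p ∣_ a.opensRange) ≫ a.isoOpensRange.inv) (by
      rw [Category.assoc, Scheme.Hom.isoOpensRange_inv_comp, morphismRestrict_ι])
  refine ⟨x, IsPullback.of_right (h₁₂ := a') (h₂₂ := a) ?_ (h.lift_snd _ _ _) h⟩
  rw [Scheme.Hom.isoOpensRange_inv_comp, h.lift_fst]
  exact h1

/-- If a base change of `p` along an open immersion with range `D` is an isomorphism, then so is
the restriction of `p` to `D`. -/
lemma isIso_morphismRestrict_of_isPullback {a' : P ⟶ X} {p' : P ⟶ S} {p : X ⟶ Y} {a : S ⟶ Y}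
    [IsOpenImmersion a] (h : IsPullback a' p' p a) (hp' : IsIso p') (D : Y.Opens)
    (hD : a.opensRange = D) : IsIso (p ∣_ D) := by
  subst hD
  obtain ⟨x, hx⟩ := exists_isPullback_morphismRestrict h
  exact MorphismProperty.of_isPullback (P := MorphismProperty.isomorphisms Scheme.{u}) hx hp'

lemma isIso_morphismRestrict_of_le (p : X ⟶ Y) {D D' : Y.Opens} (h : D' ≤ D) [IsIso (p ∣_ D)] :
    IsIso (p ∣_ D') := by
  have e := morphismRestrictRestrict p D (D.ι ⁻¹ᵁ D')
  have h1 : IsIso ((p ∣_ D) ∣_ (D.ι ⁻¹ᵁ D')) := inferInstance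
  have h2 : D.ι ''ᵁ D.ι ⁻¹ᵁ D' = D' := by
    rw [Scheme.Hom.image_preimage_eq_opensRange_inf, Scheme.Opens.opensRange_ι]
    exact inf_eq_right.mpr h
  have h3 : MorphismProperty.isomorphisms Scheme.{u} (p ∣_ (D.ι ''ᵁ D.ι ⁻¹ᵁ D')) :=
    ((MorphismProperty.isomorphisms Scheme.{u}).arrow_mk_iso_iff e).mp h1
  rwa [h2] at h3

lemma isIso_morphismRestrict_sup (p : X ⟶ Y) {D D' : Y.Opens} [IsIso (p ∣_ D)]
    [IsIso (p ∣_ D')] : IsIso (p ∣_ (D ⊔ D')) := by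
  have key (E : Y.Opens) (hE : E ≤ D ⊔ D') [IsIso (p ∣_ E)] :
      IsIso ((p ∣_ (D ⊔ D')) ∣_ ((D ⊔ D').ι ⁻¹ᵁ E)) := by
    have e := morphismRestrictRestrict p (D ⊔ D') ((D ⊔ D').ι ⁻¹ᵁ E)
    have h2 : (D ⊔ D').ι ''ᵁ (D ⊔ D').ι ⁻¹ᵁ E = E := by
      rw [Scheme.Hom.image_preimage_eq_opensRange_inf, Scheme.Opens.opensRange_ι]
      exact inf_eq_right.mpr hE
    refine ((MorphismProperty.isomorphisms Scheme.{u}).arrow_mk_iso_iff e).mpr ?_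
    rw [h2]
    assumption
  refine IsZariskiLocalAtTarget.of_iSup_eq_top (P := MorphismProperty.isomorphisms Scheme.{u})
    (fun b : Bool ↦ (D ⊔ D').ι ⁻¹ᵁ (cond b D D')) ?_ ?_
  · refine top_le_iff.mp fun x _ ↦ TopologicalSpace.Opens.mem_iSup.mpr ?_
    rcases x.2 with h | h
    · exact ⟨true, h⟩
    · exact ⟨false, h⟩
  · rintro (_ | _)
    · exact key D' le_sup_right
    · exact key D le_sup_left

/-- A modification `p` of an open subscheme `S` of `Y` that is an isomorphism over `V` extends to
a modification of `Y`, if `V` contains the complement of `S`. -/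
lemma exists_glue (j : S ⟶ Y) [IsOpenImmersion j] (p : P ⟶ S) (V : Y.Opens)
    (hp : IsIso (p ∣_ (j ⁻¹ᵁ V))) :
    ∃ (Y' : Scheme.{u}) (π : Y' ⟶ Y) (k : P ⟶ Y'), IsOpenImmersion k ∧ IsPullback k p π j ∧
      IsIso (π ∣_ V) ∧ ∀ y, π y ∈ V ∨ π y ∈ j.opensRange := by
  let f : (p ⁻¹ᵁ j ⁻¹ᵁ V).toScheme ⟶ P := Scheme.Opens.ι _
  let g : (p ⁻¹ᵁ j ⁻¹ᵁ V).toScheme ⟶ V.toScheme := (p ∣_ (j ⁻¹ᵁ V)) ≫ (j ∣_ V)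
  have hg : g ≫ V.ι = f ≫ p ≫ j := by
    simp only [g, f, Category.assoc, morphismRestrict_ι, morphismRestrict_ι_assoc]
  let π : pushout f g ⟶ Y := pushout.desc (p ≫ j) V.ι hg.symm
  have hl : pushout.inl f g ≫ π = p ≫ j := pushout.inl_desc _ _ _
  have hr : pushout.inr f g ≫ π = V.ι := pushout.inr_desc _ _ _
  have hl' (b) : π (pushout.inl f g b) = j (p b) := by
    rw [← Scheme.Hom.comp_apply, hl, Scheme.Hom.comp_apply]
  have hr' (v) : π (pushout.inr f g v) = v.1 := by
    rw [← Scheme.Hom.comp_apply, hr]; rfl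
  have hfg (z) : pushout.inl f g (f z) = pushout.inr f g (g z) := by
    rw [← Scheme.Hom.comp_apply, ← Scheme.Hom.comp_apply, pushout.condition]
  refine ⟨pushout f g, π, pushout.inl f g, inferInstance, ?_, ?_, ?_⟩
  · refine (IsOpenImmersion.isPullback _ _ _ _ hl ?_).flip
    refine le_antisymm ?_ ?_
    · intro y hy
      obtain ⟨b, rfl⟩ | ⟨v, rfl⟩ := pushout_cases f g y
      · exact ⟨b, rfl⟩
      · obtain ⟨s, hs⟩ := hy
        have hsV : s ∈ j ⁻¹ᵁ V := by
          change j s ∈ V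
          rw [hs, hr']
          exact v.2
        obtain ⟨z, hz⟩ := (p ∣_ (j ⁻¹ᵁ V)).homeomorph.surjective ⟨s, hsV⟩
        have hz' : (p ∣_ (j ⁻¹ᵁ V)) z = ⟨s, hsV⟩ := hz
        refine ⟨f z, ?_⟩
        rw [hfg]
        congr 1
        apply V.ι.isOpenEmbedding.injective
        rw [← Scheme.Hom.comp_apply, hg]
        have h1 : f ≫ p = (p ∣_ (j ⁻¹ᵁ V)) ≫ (j ⁻¹ᵁ V).ι := (morphismRestrict_ι _ _).symm
        rw [← Category.assoc, h1, Scheme.Hom.comp_apply, Scheme.Hom.comp_apply, hz']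
        exact hs.trans (hr' v)
    · rintro _ ⟨b, rfl⟩
      exact ⟨p b, (hl' b).symm⟩
  · refine isIso_morphismRestrict_of_isPullback (a' := pushout.inr f g) (p' := 𝟙 _) (a := V.ι)
      (IsOpenImmersion.isPullback _ _ _ _ (by rw [hr, Category.id_comp]) ?_).flip inferInstance V
      V.opensRange_ι
    rw [V.opensRange_ι]
    refine le_antisymm ?_ ?_
    · intro y hy
      obtain ⟨b, rfl⟩ | ⟨v, rfl⟩ := pushout_cases f g y
      · have hb : j (p b) ∈ V := by rw [← hl']; exact hy
        exact ⟨g ⟨b, hb⟩, (hfg ⟨b, hb⟩).symm⟩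
      · exact ⟨v, rfl⟩
    · rintro _ ⟨v, rfl⟩
      change π _ ∈ V
      rw [hr']
      exact v.2
  · intro y
    obtain ⟨b, rfl⟩ | ⟨v, rfl⟩ := pushout_cases f g y
    · exact .inr ⟨p b, (hl' b).symm⟩
    · exact .inl (by rw [hr']; exact v.2)

end Glue

/-! ### The blow-up of an affine scheme in a regular pair -/

section AffineBlowup

variable {B : Type u} [CommRing B]

/-- The ring of the overlap of the two charts of the blow-up in `(u, v)`. -/
abbrev OverlapAlg (u v : B) : Type u := Localization.Away (BlowupAlg.ratio u v)

/-- The second chart restricted to the overlap, on which `u/v` is the inverse of `v/u`. -/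
def toOverlap (u v : B) : BlowupAlg v u →+* OverlapAlg u v :=
  BlowupAlg.desc ((algebraMap _ (OverlapAlg u v)).comp (BlowupAlg.incl u v))
    (IsLocalization.Away.invSelf (BlowupAlg.ratio u v)) (by
      rw [RingHom.comp_apply, RingHom.comp_apply, ← BlowupAlg.mul_ratio u v, map_mul, mul_assoc,
        IsLocalization.Away.mul_invSelf, mul_one])

lemma toOverlap_incl (u v b : B) :
    toOverlap u v (BlowupAlg.incl v u b) = algebraMap _ _ (BlowupAlg.incl u v b) :=
  BlowupAlg.desc_incl _ _ _ _

lemma toOverlap_ratio (u v : B) :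
    toOverlap u v (BlowupAlg.ratio v u) =
      IsLocalization.Away.invSelf (BlowupAlg.ratio u v) :=
  BlowupAlg.desc_ratio _ _ _

lemma algebraMap_ratio_mul_toOverlap_ratio (u v : B) :
    algebraMap _ (OverlapAlg u v) (BlowupAlg.ratio u v) * toOverlap u v (BlowupAlg.ratio v u) =
      1 := by
  rw [toOverlap_ratio, IsLocalization.Away.mul_invSelf]

/-- The comparison of the two overlaps. -/
def overlapMap (u v : B) : OverlapAlg v u →+* OverlapAlg u v :=
  IsLocalization.Away.lift (g := toOverlap u v) (BlowupAlg.ratio v u)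
    (IsUnit.of_mul_eq_one_right _ (algebraMap_ratio_mul_toOverlap_ratio u v))

lemma overlapMap_comp (u v : B) :
    (overlapMap u v).comp (algebraMap (BlowupAlg v u) _) = toOverlap u v :=
  IsLocalization.Away.lift_comp _ _

lemma overlapMap_comp_toOverlap (u v : B) :
    (overlapMap u v).comp (toOverlap v u) = algebraMap (BlowupAlg u v) (OverlapAlg u v) := by
  refine BlowupAlg.hom_ext ?_ ?_
  · ext b
    simp only [RingHom.comp_apply, toOverlap_incl]
    rw [← RingHom.comp_apply, overlapMap_comp, toOverlap_incl]
  · have h1 := congr(overlapMap u v $(algebraMap_ratio_mul_toOverlap_ratio v u))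
    rw [map_mul, ← RingHom.comp_apply, overlapMap_comp, map_one] at h1
    rw [RingHom.comp_apply]
    calc _ = algebraMap _ (OverlapAlg u v) (BlowupAlg.ratio u v) *
          toOverlap u v (BlowupAlg.ratio v u) *
          overlapMap u v (toOverlap v u (BlowupAlg.ratio u v)) := by
          rw [algebraMap_ratio_mul_toOverlap_ratio, one_mul]
      _ = _ := by rw [mul_assoc, h1, mul_one]

lemma overlapMap_comp_overlapMap (u v : B) :
    (overlapMap u v).comp (overlapMap v u) = RingHom.id (OverlapAlg u v) := by
  refine IsLocalization.ringHom_ext (Submonoid.powers (BlowupAlg.ratio u v)) ?_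
  rw [RingHom.comp_assoc, overlapMap_comp, overlapMap_comp_toOverlap, RingHom.id_comp]

/-- The two overlaps agree. -/
def overlapEquiv (u v : B) : OverlapAlg v u ≃+* OverlapAlg u v :=
  RingEquiv.ofRingHom (overlapMap u v) (overlapMap v u) (overlapMap_comp_overlapMap u v)
    (overlapMap_comp_overlapMap v u)

instance isOpenImmersion_toOverlap (u v : B) :
    IsOpenImmersion (Spec.map (CommRingCat.ofHom (toOverlap u v))) := by
  have h : CommRingCat.ofHom (toOverlap u v) =
      CommRingCat.ofHom (algebraMap (BlowupAlg v u) (OverlapAlg v u)) ≫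
        (overlapEquiv u v).toCommRingCatIso.hom := by
    refine CommRingCat.hom_ext (RingHom.ext fun x ↦ ?_)
    exact congr($(overlapMap_comp u v) x).symm
  rw [h, Spec.map_comp]
  infer_instance

/-- A point of the second chart at which `u/v` does not vanish lies in the overlap. -/
lemma exists_toOverlap_eq (u v : B) (x : Spec (CommRingCat.of (BlowupAlg v u)))
    (hx : BlowupAlg.ratio v u ∉ x.asIdeal) :
    ∃ z, Spec.map (CommRingCat.ofHom (toOverlap u v)) z = x := by
  have h1 : x ∈ Set.range (Spec.map (CommRingCat.ofHom
      (algebraMap (BlowupAlg v u) (OverlapAlg v u)))) := by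
    have := PrimeSpectrum.localization_away_comap_range (OverlapAlg v u) (BlowupAlg.ratio v u)
    exact this.ge hx
  obtain ⟨z, hz⟩ := h1
  refine ⟨Spec.map (CommRingCat.ofHom (overlapMap v u)) z, ?_⟩
  rw [← hz, ← Scheme.Hom.comp_apply, ← Spec.map_comp, ← CommRingCat.ofHom_comp,
    overlapMap_comp_toOverlap]

/-- The blow-up of `Spec B` in `(u, v)`, glued from its two charts. -/
def AffineBlowup (u v : B) : Scheme.{u} :=
  pushout (Spec.map (CommRingCat.ofHom (algebraMap (BlowupAlg u v) (OverlapAlg u v))))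
    (Spec.map (CommRingCat.ofHom (toOverlap u v)))

namespace AffineBlowup

variable (u v : B)

/-- The chart `Spec B[v/u]`. -/
def chart₁ : Spec (CommRingCat.of (BlowupAlg u v)) ⟶ AffineBlowup u v := pushout.inl _ _

/-- The chart `Spec B[u/v]`. -/
def chart₂ : Spec (CommRingCat.of (BlowupAlg v u)) ⟶ AffineBlowup u v := pushout.inr _ _

instance : IsOpenImmersion (chart₁ u v) := isOpenImmersion_pushout_inl _ _
instance : IsOpenImmersion (chart₂ u v) := isOpenImmersion_pushout_inr _ _

lemma overlap_comp_chart₁ :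
    Spec.map (CommRingCat.ofHom (algebraMap (BlowupAlg u v) (OverlapAlg u v))) ≫ chart₁ u v =
      Spec.map (CommRingCat.ofHom (toOverlap u v)) ≫ chart₂ u v := pushout.condition

lemma overlap_comp_chart₂ :
    Spec.map (CommRingCat.ofHom (algebraMap (BlowupAlg v u) (OverlapAlg v u))) ≫ chart₂ u v =
      Spec.map (CommRingCat.ofHom (toOverlap v u)) ≫ chart₁ u v := by
  have h1 := congr(Spec.map (CommRingCat.ofHom (overlapMap v u)) ≫ $(overlap_comp_chart₁ u v))
  rw [← Spec.map_comp_assoc, ← Spec.map_comp_assoc, ← CommRingCat.ofHom_comp,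
    ← CommRingCat.ofHom_comp, overlapMap_comp, overlapMap_comp_toOverlap] at h1
  exact h1.symm

/-- The blow-down morphism. -/
def toSpec : AffineBlowup u v ⟶ Spec (CommRingCat.of B) :=
  pushout.desc (Spec.map (CommRingCat.ofHom (BlowupAlg.incl u v)))
    (Spec.map (CommRingCat.ofHom (BlowupAlg.incl v u))) (by
      rw [← Spec.map_comp, ← Spec.map_comp, ← CommRingCat.ofHom_comp, ← CommRingCat.ofHom_comp]
      congr 2
      ext b
      exact (toOverlap_incl u v b).symm)

lemma chart₁_toSpec :
    chart₁ u v ≫ toSpec u v = Spec.map (CommRingCat.ofHom (BlowupAlg.incl u v)) :=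
  pushout.inl_desc _ _ _

lemma chart₂_toSpec :
    chart₂ u v ≫ toSpec u v = Spec.map (CommRingCat.ofHom (BlowupAlg.incl v u)) :=
  pushout.inr_desc _ _ _

lemma cases (z : AffineBlowup u v) : (∃ x, chart₁ u v x = z) ∨ ∃ y, chart₂ u v y = z :=
  pushout_cases _ _ z

lemma mem_range_chart₁ (x : Spec (CommRingCat.of (BlowupAlg v u)))
    (hx : BlowupAlg.ratio v u ∉ x.asIdeal) : ∃ y, chart₁ u v y = chart₂ u v x := by
  obtain ⟨z, rfl⟩ := exists_toOverlap_eq u v x hx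
  refine ⟨Spec.map (CommRingCat.ofHom (algebraMap (BlowupAlg u v) (OverlapAlg u v))) z, ?_⟩
  rw [← Scheme.Hom.comp_apply, ← Scheme.Hom.comp_apply, overlap_comp_chart₁]

lemma mem_range_chart₂ (x : Spec (CommRingCat.of (BlowupAlg u v)))
    (hx : BlowupAlg.ratio u v ∉ x.asIdeal) : ∃ y, chart₂ u v y = chart₁ u v x := by
  obtain ⟨z, rfl⟩ := exists_toOverlap_eq v u x hx
  refine ⟨Spec.map (CommRingCat.ofHom (algebraMap (BlowupAlg v u) (OverlapAlg v u))) z, ?_⟩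
  rw [← Scheme.Hom.comp_apply, ← Scheme.Hom.comp_apply, overlap_comp_chart₂]

/-- The two charts of the blow-up, as an open cover. -/
def cover : (AffineBlowup u v).OpenCover :=
  Scheme.Cover.mkOfCovers Bool
    (fun b ↦ cond b (Spec (CommRingCat.of (BlowupAlg u v))) (Spec (CommRingCat.of (BlowupAlg v u))))
    (fun b ↦ match b with
      | true => chart₁ u v
      | false => chart₂ u v)
    (fun z ↦ by
      obtain ⟨x, hx⟩ | ⟨x, hx⟩ := cases u v z
      · exact ⟨true, x, hx⟩
      · exact ⟨false, x, hx⟩)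
    (fun b ↦ by cases b <;> dsimp <;> infer_instance)

lemma isPullback_charts : IsPullback
    (Spec.map (CommRingCat.ofHom (algebraMap (BlowupAlg u v) (OverlapAlg u v))))
    (Spec.map (CommRingCat.ofHom (toOverlap u v))) (chart₁ u v) (chart₂ u v) := by
  refine IsOpenImmersion.isPullback _ _ _ _ (overlap_comp_chart₁ u v).symm (le_antisymm ?_ ?_)
  · rintro y ⟨x, hx⟩
    obtain ⟨z, -, hz⟩ := exists_of_inl_eq_inr _ _ hx
    exact ⟨z, hz⟩
  · rintro _ ⟨z, rfl⟩
    refine ⟨Spec.map (CommRingCat.ofHom (algebraMap (BlowupAlg u v) (OverlapAlg u v))) z, ?_⟩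
    rw [← Scheme.Hom.comp_apply, ← Scheme.Hom.comp_apply, overlap_comp_chart₁]

/-- The overlap of the charts is closed in their product, since its ring is generated by the
images of the rings of the charts. -/
lemma isClosedImmersion_overlap {P : Scheme.{u}} [IsAffine P]
    (a : P ⟶ Spec (CommRingCat.of (BlowupAlg u v))) (b : P ⟶ Spec (CommRingCat.of (BlowupAlg v u)))
    (m : Spec (CommRingCat.of (OverlapAlg u v)) ⟶ P)
    (ha : m ≫ a = Spec.map (CommRingCat.ofHom (algebraMap _ _)))
    (hb : m ≫ b = Spec.map (CommRingCat.ofHom (toOverlap u v))) : IsClosedImmersion m := by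
  refine IsClosedImmersion.of_surjective_of_isAffine m fun z ↦ ?_
  obtain ⟨z, rfl⟩ := (ConcreteCategory.bijective_of_isIso
    (Scheme.ΓSpecIso (CommRingCat.of (OverlapAlg u v))).inv).2 z
  obtain ⟨n, x, hx⟩ := IsLocalization.Away.surj (BlowupAlg.ratio u v) z
  have hz : z = algebraMap _ _ x * toOverlap u v (BlowupAlg.ratio v u) ^ n := by
    rw [← hx, mul_assoc, ← mul_pow, algebraMap_ratio_mul_toOverlap_ratio, one_pow, mul_one]
  have h1 (x) : m.appTop (a.appTop ((Scheme.ΓSpecIso _).inv x)) =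
      (Scheme.ΓSpecIso (CommRingCat.of (OverlapAlg u v))).inv (algebraMap _ _ x) := by
    rw [← CommRingCat.comp_apply, ← Scheme.Hom.comp_appTop, ha]
    exact congr($(Scheme.ΓSpecIso_inv_naturality
      (CommRingCat.ofHom (algebraMap (BlowupAlg u v) (OverlapAlg u v)))) x).symm
  have h2 (x) : m.appTop (b.appTop ((Scheme.ΓSpecIso _).inv x)) =
      (Scheme.ΓSpecIso (CommRingCat.of (OverlapAlg u v))).inv (toOverlap u v x) := by
    rw [← CommRingCat.comp_apply, ← Scheme.Hom.comp_appTop, hb]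
    exact congr($(Scheme.ΓSpecIso_inv_naturality
      (CommRingCat.ofHom (toOverlap u v))) x).symm
  refine ⟨a.appTop ((Scheme.ΓSpecIso _).inv x) *
    b.appTop ((Scheme.ΓSpecIso _).inv (BlowupAlg.ratio v u)) ^ n, ?_⟩
  rw [map_mul, map_pow, h1, h2, ← map_pow, ← map_mul, ← hz]

/-- The fiber product of a chart with itself over the whole is closed in the product over the base:
it is the diagonal. -/
lemma isClosedImmersion_of_mono {X Y Z : Scheme.{u}} (f : X ⟶ Y) (p : Y ⟶ Z) [Mono f]
    [IsSeparated (f ≫ p)] (m : pullback f f ⟶ pullback (f ≫ p) (f ≫ p))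
    (h₁ : m ≫ pullback.fst _ _ = pullback.fst _ _)
    (h₂ : m ≫ pullback.snd _ _ = pullback.snd _ _) : IsClosedImmersion m := by
  have : m = pullback.fst f f ≫ pullback.diagonal (f ≫ p) := by
    apply pullback.hom_ext
    · rw [h₁]; simp
    · rw [h₂]; simp [← cancel_mono f, pullback.condition]
  rw [this]
  infer_instance

instance : IsSeparated (chart₁ u v ≫ toSpec u v) := by rw [chart₁_toSpec]; infer_instance
instance : IsSeparated (chart₂ u v ≫ toSpec u v) := by rw [chart₂_toSpec]; infer_instance

/-- The criterion on the diagonal is checked on the products of two charts. For different charts, it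
says that the functions on the overlap are generated by those on the charts. -/
instance isSeparated : IsSeparated (toSpec u v) := by
  refine ⟨IsZariskiLocalAtTarget.of_openCover (Scheme.Pullback.openCoverOfLeftRight
    (cover u v) (cover u v) _ _) ?_⟩
  intro ⟨i, j⟩
  refine (MorphismProperty.cancel_left_of_respectsIso (P := @IsClosedImmersion)
    (f := (pullbackDiagonalMapIdIso ((cover u v).f i) ((cover u v).f j) (toSpec u v)).inv) _).mp ?_
  have h₁ := pullbackDiagonalMapIdIso_inv_snd_fst ((cover u v).f i) ((cover u v).f j) (toSpec u v)
  have h₂ := pullbackDiagonalMapIdIso_inv_snd_snd ((cover u v).f i) ((cover u v).f j) (toSpec u v)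
  rw [← Category.assoc] at h₁ h₂
  have key (a : pullback (chart₁ u v) (chart₂ u v) ⟶
      pullback (chart₁ u v ≫ toSpec u v) (chart₂ u v ≫ toSpec u v))
      (h₁ : a ≫ pullback.fst _ _ = pullback.fst _ _)
      (h₂ : a ≫ pullback.snd _ _ = pullback.snd _ _) : IsClosedImmersion a := by
    rw [← MorphismProperty.cancel_left_of_respectsIso (P := @IsClosedImmersion)
      (isPullback_charts u v).isoPullback.hom]
    have : IsAffine (pullback (chart₁ u v ≫ toSpec u v) (chart₂ u v ≫ toSpec u v)) := by
      infer_instance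
    refine isClosedImmersion_overlap u v (pullback.fst _ _) (pullback.snd _ _) _ ?_ ?_
    · rw [Category.assoc, h₁, IsPullback.isoPullback_hom_fst]
    · rw [Category.assoc, h₂, IsPullback.isoPullback_hom_snd]
  have key' (a : pullback (chart₂ u v) (chart₁ u v) ⟶
      pullback (chart₂ u v ≫ toSpec u v) (chart₁ u v ≫ toSpec u v))
      (h₁ : a ≫ pullback.fst _ _ = pullback.fst _ _)
      (h₂ : a ≫ pullback.snd _ _ = pullback.snd _ _) : IsClosedImmersion a := by
    rw [← MorphismProperty.cancel_left_of_respectsIso (P := @IsClosedImmersion)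
      (isPullback_charts u v).flip.isoPullback.hom]
    have : IsAffine (pullback (chart₂ u v ≫ toSpec u v) (chart₁ u v ≫ toSpec u v)) := by
      infer_instance
    refine isClosedImmersion_overlap u v (pullback.snd _ _) (pullback.fst _ _) _ ?_ ?_
    · rw [Category.assoc, h₂, IsPullback.isoPullback_hom_snd]
    · rw [Category.assoc, h₁, IsPullback.isoPullback_hom_fst]
  match i, j with
  | true, true => exact isClosedImmersion_of_mono (chart₁ u v) (toSpec u v) _ h₁ h₂
  | false, false => exact isClosedImmersion_of_mono (chart₂ u v) (toSpec u v) _ h₁ h₂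
  | true, false => exact key _ h₁ h₂
  | false, true => exact key' _ h₁ h₂

instance : LocallyOfFiniteType (toSpec u v) := by
  have : IsZariskiLocalAtSource @LocallyOfFiniteType.{u} :=
    HasRingHomProperty.instIsZariskiLocalAtSource
  refine IsZariskiLocalAtSource.of_openCover (cover u v) fun b ↦ ?_
  have h (u v : B) : LocallyOfFiniteType (Spec.map (CommRingCat.ofHom (BlowupAlg.incl u v))) := by
    rw [HasRingHomProperty.Spec_iff (P := @LocallyOfFiniteType)]
    exact RingHom.finiteType_algebraMap.mpr inferInstance
  match b with
  | true => exact (chart₁_toSpec u v).symm ▸ h u v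
  | false => exact (chart₂_toSpec u v).symm ▸ h v u

instance : QuasiCompact (toSpec u v) := by
  refine (@HasAffineProperty.iff_of_isAffine _ (fun X _ _ _ ↦ CompactSpace X)
    instHasAffinePropertyQuasiCompactCompactSpaceCarrierCarrierCommRingCat _ _ _ _).mpr ?_
  have h : (Set.range (chart₁ u v)) ∪ (Set.range (chart₂ u v)) = Set.univ :=
    Set.eq_univ_of_forall fun z ↦ cases u v z
  exact ⟨h ▸ (isCompact_range (chart₁ u v).continuous).union
    (isCompact_range (chart₂ u v).continuous)⟩

/-- The valuative criterion for a generic point in one of the charts, `v/u ↦ κ (ratio u v)`: either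
`v/u` or `u/v` extends to the valuation ring. -/
lemma hasLift_of_chart {X : Scheme.{u}} (p : X ⟶ Spec (CommRingCat.of B))
    (c₁ : Spec (CommRingCat.of (BlowupAlg u v)) ⟶ X)
    (c₂ : Spec (CommRingCat.of (BlowupAlg v u)) ⟶ X)
    (h₁ : c₁ ≫ p = Spec.map (CommRingCat.ofHom (BlowupAlg.incl u v)))
    (h₂ : c₂ ≫ p = Spec.map (CommRingCat.ofHom (BlowupAlg.incl v u)))
    (h₁₂ : Spec.map (CommRingCat.ofHom (algebraMap (BlowupAlg u v) (OverlapAlg u v))) ≫ c₁ =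
      Spec.map (CommRingCat.ofHom (toOverlap u v)) ≫ c₂)
    (S : ValuativeCommSq p) (κ : BlowupAlg u v →+* S.K)
    (hκ : S.i₁ = Spec.map (CommRingCat.ofHom κ) ≫ c₁) : S.commSq.HasLift := by
  obtain ⟨β, hβ⟩ : ∃ β : B →+* S.R, S.i₂ = Spec.map (CommRingCat.ofHom β) :=
    ⟨(Spec.preimage S.i₂).hom, (Spec.map_preimage _).symm⟩
  have hβκ : (algebraMap S.R S.K).comp β = κ.comp (BlowupAlg.incl u v) := by
    have h := S.commSq.w
    rw [hκ, hβ, Category.assoc, h₁, ← Spec.map_comp, ← Spec.map_comp] at h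
    have := Spec.map_injective h
    exact congr(($this).hom).symm
  have hβκ' (b : B) : algebraMap S.R S.K (β b) = κ (BlowupAlg.incl u v b) := congr($hβκ b)
  have hinj := IsFractionRing.injective S.R S.K
  by_cases hint : IsLocalization.IsInteger S.R (κ (BlowupAlg.ratio u v))
  · obtain ⟨r, hr⟩ := hint
    have hr' : β u * r = β v := hinj (by
      rw [map_mul, hβκ', hβκ', hr, ← map_mul, BlowupAlg.mul_ratio])
    refine ⟨⟨⟨Spec.map (CommRingCat.ofHom (BlowupAlg.desc β r hr')) ≫ c₁, ?_, ?_⟩⟩⟩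
    · rw [hκ, ← Spec.map_comp_assoc, ← CommRingCat.ofHom_comp]
      congr 3
      refine BlowupAlg.hom_ext ?_ ?_
      · rw [RingHom.comp_assoc, BlowupAlg.desc_comp_incl, hβκ]
      · rw [RingHom.comp_apply, BlowupAlg.desc_ratio, hr]
    · rw [Category.assoc, h₁, hβ, ← Spec.map_comp, ← CommRingCat.ofHom_comp,
        BlowupAlg.desc_comp_incl]
  · have h0 : κ (BlowupAlg.ratio u v) ≠ 0 := fun h ↦ hint ⟨0, by rw [map_zero, h]⟩
    obtain ⟨r, hr⟩ := (ValuationRing.isInteger_or_isInteger S.R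
      (κ (BlowupAlg.ratio u v))).resolve_left hint
    have hr' : β v * r = β u := hinj (by
      rw [map_mul, hβκ', hβκ', hr, ← BlowupAlg.mul_ratio, map_mul, mul_assoc, mul_inv_cancel₀ h0,
        mul_one])
    let κ' : OverlapAlg u v →+* S.K := IsLocalization.Away.lift (g := κ) (BlowupAlg.ratio u v)
      (Ne.isUnit h0)
    have hκ' : κ'.comp (algebraMap _ _) = κ := IsLocalization.Away.lift_comp _ _
    have hκ'' : κ'.comp (toOverlap u v) =
        (algebraMap S.R S.K).comp (BlowupAlg.desc β r hr') := by
      refine BlowupAlg.hom_ext ?_ ?_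
      · rw [RingHom.comp_assoc, RingHom.comp_assoc, BlowupAlg.desc_comp_incl, hβκ, ← hκ']
        ext b
        simp only [RingHom.comp_apply, toOverlap_incl]
      · rw [RingHom.comp_apply, RingHom.comp_apply, BlowupAlg.desc_ratio, hr]
        have := congr(κ' $(algebraMap_ratio_mul_toOverlap_ratio u v))
        rw [map_mul, map_one, ← RingHom.comp_apply, hκ'] at this
        exact eq_inv_of_mul_eq_one_right this
    refine ⟨⟨⟨Spec.map (CommRingCat.ofHom (BlowupAlg.desc β r hr')) ≫ c₂, ?_, ?_⟩⟩⟩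
    · rw [hκ, ← Spec.map_comp_assoc, ← CommRingCat.ofHom_comp, ← hκ'', CommRingCat.ofHom_comp,
        Spec.map_comp_assoc, ← h₁₂, ← Spec.map_comp_assoc, ← CommRingCat.ofHom_comp, hκ']
    · rw [Category.assoc, h₂, hβ, ← Spec.map_comp, ← CommRingCat.ofHom_comp,
        BlowupAlg.desc_comp_incl]

lemma exists_factor_of_field {K : Type u} [Field K] {R : Type u} [CommRing R] {X : Scheme.{u}}
    (i : Spec (CommRingCat.of K) ⟶ X) (c : Spec (CommRingCat.of R) ⟶ X) [IsOpenImmersion c]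
    (x : Spec (CommRingCat.of K)) (h : i x ∈ Set.range c) :
    ∃ κ : R →+* K, i = Spec.map (CommRingCat.ofHom κ) ≫ c := by
  have hr : Set.range i ⊆ Set.range c := by
    rintro _ ⟨y, rfl⟩
    have : Subsingleton (Spec (CommRingCat.of K)) :=
      inferInstanceAs (Subsingleton (PrimeSpectrum K))
    rwa [Subsingleton.elim y x]
  refine ⟨(Spec.preimage (IsOpenImmersion.lift c i hr)).hom, ?_⟩
  rw [CommRingCat.ofHom_hom, Spec.map_preimage, IsOpenImmersion.lift_fac]

instance : UniversallyClosed (toSpec u v) := by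
  refine UniversallyClosed.of_valuativeCriterion _ fun S ↦ ?_
  obtain ⟨x⟩ : Nonempty (Spec (CommRingCat.of S.K)) :=
    inferInstanceAs (Nonempty (PrimeSpectrum S.K))
  obtain ⟨y, hy⟩ | ⟨y, hy⟩ := cases u v (S.i₁ x)
  · obtain ⟨κ, hκ⟩ := exists_factor_of_field S.i₁ (chart₁ u v) x ⟨y, hy⟩
    exact hasLift_of_chart u v _ _ _ (chart₁_toSpec u v) (chart₂_toSpec u v)
      (overlap_comp_chart₁ u v) S κ hκ
  · obtain ⟨κ, hκ⟩ := exists_factor_of_field S.i₁ (chart₂ u v) x ⟨y, hy⟩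
    exact hasLift_of_chart v u _ _ _ (chart₂_toSpec u v) (chart₁_toSpec u v)
      (overlap_comp_chart₂ u v) S κ hκ

instance isProper : IsProper (toSpec u v) where

/-- Away from `u = 0`, the ring `B[v/u]` agrees with `B`. -/
lemma isIso_morphismRestrict_of_chart {X : Scheme.{u}} (p : X ⟶ Spec (CommRingCat.of B))
    (c : Spec (CommRingCat.of (BlowupAlg u v)) ⟶ X) [IsOpenImmersion c]
    (h : c ≫ p = Spec.map (CommRingCat.ofHom (BlowupAlg.incl u v)))
    (hc : ∀ z, u ∉ (p z).asIdeal → ∃ x, c x = z) :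
    IsIso (p ∣_ (PrimeSpectrum.basicOpen u : Opens (PrimeSpectrum B))) := by
  let ι := algebraMap (BlowupAlg u v) (Localization.Away (BlowupAlg.incl u v u))
  let κ := algebraMap B (Localization.Away u)
  have hu : IsUnit (ι (BlowupAlg.incl u v u)) := IsLocalization.Away.algebraMap_isUnit _
  let α : Localization.Away u →+* Localization.Away (BlowupAlg.incl u v u) :=
    IsLocalization.Away.lift (g := ι.comp (BlowupAlg.incl u v)) u hu
  have hα : α.comp κ = ι.comp (BlowupAlg.incl u v) := IsLocalization.Away.lift_comp _ _
  let β₀ : BlowupAlg u v →+* Localization.Away u :=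
    BlowupAlg.desc κ (IsLocalization.Away.invSelf u * κ v) (by
      rw [← mul_assoc, IsLocalization.Away.mul_invSelf, one_mul])
  have hβ₀ : β₀.comp (BlowupAlg.incl u v) = κ := BlowupAlg.desc_comp_incl _ _ _
  let β : Localization.Away (BlowupAlg.incl u v u) →+* Localization.Away u :=
    IsLocalization.Away.lift (g := β₀) (BlowupAlg.incl u v u) (by
      rw [← RingHom.comp_apply, hβ₀]
      exact IsLocalization.Away.algebraMap_isUnit _)
  have hβ : β.comp ι = β₀ := IsLocalization.Away.lift_comp _ _
  have hβα : β.comp α = RingHom.id _ := by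
    refine IsLocalization.ringHom_ext (Submonoid.powers u) ?_
    change (β.comp α).comp κ = _
    rw [RingHom.comp_assoc, hα, ← RingHom.comp_assoc, hβ, hβ₀, RingHom.id_comp]
  have hαβ : α.comp β = RingHom.id _ := by
    refine IsLocalization.ringHom_ext (Submonoid.powers (BlowupAlg.incl u v u)) ?_
    change (α.comp β).comp ι = ι
    rw [RingHom.comp_assoc, hβ]
    refine BlowupAlg.hom_ext ?_ ?_
    · rw [RingHom.comp_assoc, hβ₀, hα]
    · refine hu.mul_left_cancel ?_
      have h1 : ι (BlowupAlg.incl u v u) = α (κ u) := congr($hα u).symm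
      rw [← map_mul, BlowupAlg.mul_ratio, h1, RingHom.comp_apply, ← map_mul, BlowupAlg.desc_ratio,
        ← mul_assoc, IsLocalization.Away.mul_invSelf, one_mul]
      exact congr($hα v)
  let e : Localization.Away u ≃+* Localization.Away (BlowupAlg.incl u v u) :=
    RingEquiv.ofRingHom α β hαβ hβα
  have hiso : IsIso (Spec.map (CommRingCat.ofHom α)) :=
    inferInstanceAs (IsIso (Spec.map e.toCommRingCatIso.hom))
  have hpre : p ⁻¹ᵁ (Spec.map (CommRingCat.ofHom κ)).opensRange =
      (Spec.map (CommRingCat.ofHom ι) ≫ c).opensRange := by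
    have hr1 : Set.range (Spec.map (CommRingCat.ofHom κ)) =
        (PrimeSpectrum.basicOpen u : Set (PrimeSpectrum B)) :=
      PrimeSpectrum.localization_away_comap_range _ _
    have hr2 : Set.range (Spec.map (CommRingCat.ofHom ι)) =
        (PrimeSpectrum.basicOpen (BlowupAlg.incl u v u) : Set (PrimeSpectrum (BlowupAlg u v))) :=
      PrimeSpectrum.localization_away_comap_range _ _
    ext z
    change p z ∈ Set.range (Spec.map (CommRingCat.ofHom κ)) ↔
      z ∈ Set.range (Spec.map (CommRingCat.ofHom ι) ≫ c)
    rw [hr1]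
    have hr3 : Set.range (Spec.map (CommRingCat.ofHom ι) ≫ c) =
        c '' (PrimeSpectrum.basicOpen (BlowupAlg.incl u v u) :
          Set (PrimeSpectrum (BlowupAlg u v))) := by
      rw [← hr2, ← Set.range_comp]
      exact congrArg Set.range (funext fun z ↦ Scheme.Hom.comp_apply _ _ _)
    rw [hr3]
    have hp (x) : p (c x) = Spec.map (CommRingCat.ofHom (BlowupAlg.incl u v)) x := by
      rw [← Scheme.Hom.comp_apply, h]
    constructor
    · intro hz
      obtain ⟨x, rfl⟩ := hc z hz
      rw [hp] at hz
      exact ⟨x, hz, rfl⟩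
    · rintro ⟨x, hx, rfl⟩
      rw [hp]
      exact hx
  refine isIso_morphismRestrict_of_isPullback (P := Spec (.of _)) (S := Spec (.of _))
    (IsOpenImmersion.isPullback (Spec.map (CommRingCat.ofHom α))
    (Spec.map (CommRingCat.ofHom ι) ≫ c) (Spec.map (CommRingCat.ofHom κ)) p ?_ hpre).flip hiso _ ?_
  · rw [Category.assoc, h, ← Spec.map_comp, ← Spec.map_comp, ← CommRingCat.ofHom_comp,
      ← CommRingCat.ofHom_comp, hα]
  · exact TopologicalSpace.Opens.ext (PrimeSpectrum.localization_away_comap_range _ _)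

/-- The blow-up in `(u, v)` is an isomorphism off `u = v = 0`. -/
lemma isIso_toSpec_morphismRestrict : IsIso (toSpec u v ∣_
    ((PrimeSpectrum.basicOpen u : Opens (PrimeSpectrum B)) ⊔ PrimeSpectrum.basicOpen v :
      Opens (PrimeSpectrum B))) := by
  have h1 : IsIso (toSpec u v ∣_ (PrimeSpectrum.basicOpen u : Opens (PrimeSpectrum B))) := by
    refine isIso_morphismRestrict_of_chart u v (toSpec u v) (chart₁ u v) (chart₁_toSpec u v) ?_
    intro z hz
    obtain ⟨x, rfl⟩ | ⟨y, rfl⟩ := cases u v z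
    · exact ⟨x, rfl⟩
    · refine mem_range_chart₁ u v y fun h ↦ hz ?_
      rw [← Scheme.Hom.comp_apply, chart₂_toSpec]
      change BlowupAlg.incl v u u ∈ y.asIdeal
      rw [← BlowupAlg.mul_ratio v u]
      exact Ideal.mul_mem_left _ _ h
  have h2 : IsIso (toSpec u v ∣_ (PrimeSpectrum.basicOpen v : Opens (PrimeSpectrum B))) := by
    refine isIso_morphismRestrict_of_chart v u (toSpec u v) (chart₂ u v) (chart₂_toSpec u v) ?_
    intro z hz
    obtain ⟨x, rfl⟩ | ⟨y, rfl⟩ := cases u v z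
    · refine mem_range_chart₂ u v x fun h ↦ hz ?_
      rw [← Scheme.Hom.comp_apply, chart₁_toSpec]
      change BlowupAlg.incl u v v ∈ x.asIdeal
      rw [← BlowupAlg.mul_ratio u v]
      exact Ideal.mul_mem_left _ _ h
    · exact ⟨y, rfl⟩
  exact isIso_morphismRestrict_sup _

end AffineBlowup
end AffineBlowup

/-! ### Effective Cartier divisors and morphisms to a modification -/

section Cartier

variable {X Y : Scheme.{u}}

/-- Small affine charts on which an effective Cartier divisor is principal. -/
lemma IsEffectiveCartier.exists_chart {D : Y.IdealSheafData} (hD : IsEffectiveCartier D) (y : Y)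
    (O : Y.Opens) (hy : y ∈ O) :
    ∃ (B : Type u) (_ : CommRing B) (j : Spec (CommRingCat.of B) ⟶ Y)
      (_ : IsOpenImmersion j) (a : B), y ∈ j.opensRange ∧ j.opensRange ≤ O ∧
        a ∈ nonZeroDivisors B ∧ D.comap j = idealSheaf (Ideal.span {a}) := by
  obtain ⟨U, hU, hUa⟩ := hD y
  let i : Spec (CommRingCat.of Γ(Y, U.1)) ⟶ Y := U.2.fromSpec
  have hiO : IsOpenImmersion i := U.2.isOpenImmersion_fromSpec
  have hi : i.opensRange = U.1 := U.2.opensRange_fromSpec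
  have hi' : (⟨i.opensRange, isAffineOpen_opensRange i⟩ : Y.affineOpens) = U := Subtype.ext hi
  obtain ⟨e, he⟩ := exists_ringEquiv_ideal_opensRange i
  obtain ⟨K, hK⟩ := idealSheaf_surjective (D.comap i)
  have h1 : ∃ a ∈ nonZeroDivisors Γ(Y, (⟨i.opensRange, isAffineOpen_opensRange i⟩ :
      Y.affineOpens).1), D.ideal ⟨i.opensRange, isAffineOpen_opensRange i⟩ = Ideal.span {a} := by
    rw [hi']
    exact hUa
  obtain ⟨a, ha, hDa⟩ := h1
  have hKa : K = Ideal.span {e a} := by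
    have h2 := (he D K).mp hK.symm
    rw [hDa] at h2
    have h3 := congr(Ideal.map (e : _ →+* Γ(Y, U.1)) $h2)
    refine (Ideal.map_comap_of_surjective (e : Γ(Y, i.opensRange) →+* Γ(Y, U.1))
      e.surjective K).symm.trans (h3.symm.trans ?_)
    rw [Ideal.map_span, Set.image_singleton]
    rfl
  have hea : e a ∈ nonZeroDivisors Γ(Y, U.1) := by
    rw [mem_nonZeroDivisors_iff_right] at ha ⊢
    intro x hx
    have h0 : e.symm x * a = 0 := by
      rw [← e.symm_apply_apply a, ← map_mul, hx, map_zero]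
    exact (map_eq_zero_iff e.symm e.symm.injective).mp (ha _ h0)
  obtain ⟨x, rfl⟩ : y ∈ i.opensRange := hi.ge hU
  obtain ⟨_, ⟨_, ⟨f, rfl⟩, rfl⟩, hxf, hfO⟩ :=
    PrimeSpectrum.isBasis_basic_opens.exists_subset_of_mem_open
      (show x ∈ ((i ⁻¹ᵁ O : Opens _) : Set _) from hy) (i ⁻¹ᵁ O).isOpen
  have hr : Set.range (Spec.map (CommRingCat.ofHom
      (algebraMap Γ(Y, U.1) (Localization.Away f)))) =
      (PrimeSpectrum.basicOpen f : Set (PrimeSpectrum _)) :=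
    PrimeSpectrum.localization_away_comap_range _ _
  refine ⟨Localization.Away f, inferInstance,
    Spec.map (CommRingCat.ofHom (algebraMap Γ(Y, U.1) (Localization.Away f))) ≫ i, inferInstance,
    algebraMap _ _ (e a), ?_, ?_, ?_, ?_⟩
  · obtain ⟨z, hz⟩ := hr.ge hxf
    exact ⟨z, by rw [Scheme.Hom.comp_apply, hz]⟩
  · rintro _ ⟨z, rfl⟩
    rw [Scheme.Hom.comp_apply]
    exact hfO (hr.le ⟨z, rfl⟩)
  · exact IsLocalization.map_nonZeroDivisors_le (.powers f) _ ⟨_, hea, rfl⟩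
  · rw [comap_comp, ← hK, hKa, comap_idealSheaf, Ideal.map_span, Set.image_singleton]

lemma IsEffectiveCartier.comap_of_isOpenImmersion {D : Y.IdealSheafData}
    (hD : IsEffectiveCartier D) (j : X ⟶ Y) [IsOpenImmersion j] :
    IsEffectiveCartier (D.comap j) := by
  refine isEffectiveCartier_of_charts fun x ↦ ?_
  obtain ⟨B, _, i, _, a, hy, hle, ha, hDa⟩ := hD.exists_chart (j x) j.opensRange ⟨x, rfl⟩
  have hle' : Set.range i ⊆ Set.range j := hle
  have : IsOpenImmersion (IsOpenImmersion.lift j i hle' ≫ j) := by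
    rw [IsOpenImmersion.lift_fac]; infer_instance
  refine ⟨B, inferInstance, IsOpenImmersion.lift j i hle', IsOpenImmersion.of_comp _ j, a,
    ?_, ha, ?_⟩
  · obtain ⟨z, hz⟩ := hy
    refine ⟨z, j.isOpenEmbedding.injective ?_⟩
    rw [← Scheme.Hom.comp_apply, IsOpenImmersion.lift_fac, hz]
  · rw [← comap_comp, IsOpenImmersion.lift_fac, hDa]

lemma mem_support_comap (Z : Y.IdealSheafData) (g : X ⟶ Y) (x : X) :
    x ∈ (Z.comap g).support ↔ g x ∈ Z.support := by
  rw [support_comap]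
  rfl

lemma comap_eq_top_iff (Z : Y.IdealSheafData) (g : X ⟶ Y) :
    Z.comap g = ⊤ ↔ ∀ x, g x ∉ Z.support := by
  rw [← support_eq_bot_iff]
  constructor
  · intro h x hx
    rw [← mem_support_comap, h] at hx
    exact hx
  · intro h
    ext x
    exact ⟨fun hx ↦ (h x ((mem_support_comap Z g x).mp hx)).elim, fun hx ↦ hx.elim⟩

/-- Morphisms to a modification of `Y` which is an isomorphism over `V` are determined by their
composite with the modification, if they map to the part over `V`. -/
lemma hom_ext_of_isIso_morphismRestrict {T Y' : Scheme.{u}} (π : Y' ⟶ Y) (V : Y.Opens)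
    [IsIso (π ∣_ V)] (a b : T ⟶ Y') (hab : a ≫ π = b ≫ π) (ha : ∀ t, π (a t) ∈ V) : a = b := by
  have hb (t) : π (b t) ∈ V := by
    rw [← Scheme.Hom.comp_apply, ← hab, Scheme.Hom.comp_apply]
    exact ha t
  have hra : Set.range a ⊆ Set.range (π ⁻¹ᵁ V).ι := by
    rw [Scheme.Opens.range_ι]
    rintro _ ⟨t, rfl⟩
    exact ha t
  have hrb : Set.range b ⊆ Set.range (π ⁻¹ᵁ V).ι := by
    rw [Scheme.Opens.range_ι]
    rintro _ ⟨t, rfl⟩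
    exact hb t
  rw [← IsOpenImmersion.lift_fac (π ⁻¹ᵁ V).ι a hra, ← IsOpenImmersion.lift_fac (π ⁻¹ᵁ V).ι b hrb]
  congr 1
  rw [← cancel_mono (π ∣_ V), ← cancel_mono V.ι, Category.assoc, Category.assoc,
    morphismRestrict_ι, IsOpenImmersion.lift_fac_assoc, IsOpenImmersion.lift_fac_assoc, hab]

lemma exists_lift_of_isIso_morphismRestrict {T Y' : Scheme.{u}} (π : Y' ⟶ Y) (V : Y.Opens)
    [IsIso (π ∣_ V)] (g : T ⟶ Y) (hg : ∀ t, g t ∈ V) : ∃ h : T ⟶ Y', h ≫ π = g := by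
  have hr : Set.range g ⊆ Set.range V.ι := by
    rw [Scheme.Opens.range_ι]
    rintro _ ⟨t, rfl⟩
    exact hg t
  refine ⟨IsOpenImmersion.lift V.ι g hr ≫ inv (π ∣_ V) ≫ (π ⁻¹ᵁ V).ι, ?_⟩
  rw [Category.assoc, Category.assoc, ← morphismRestrict_ι, IsIso.inv_hom_id_assoc,
    IsOpenImmersion.lift_fac]

/-- Two morphisms to a separated `Y`-scheme that agree off an effective Cartier divisor agree. -/
lemma hom_ext_of_cartier {T Y' : Scheme.{u}} (π : Y' ⟶ Y) [IsSeparated π] (a b : T ⟶ Y')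
    (hab : a ≫ π = b ≫ π) {D : T.IdealSheafData} (hD : IsEffectiveCartier D)
    (h : Scheme.Opens.ι D.support.compl ≫ a = Scheme.Opens.ι D.support.compl ≫ b) : a = b := by
  let Y'' : Over Y := Over.mk π
  let T' : Over Y := Over.mk (a ≫ π)
  let a' : T' ⟶ Y'' := Over.homMk a rfl
  let b' : T' ⟶ Y'' := Over.homMk b hab.symm
  have hs : IsSeparated Y''.hom := ‹_›
  have h1 : IsClosedImmersion (equalizer.ι a' b').left := isClosedImmersion_equalizer_ι_left a' b'
  let U' : Over Y := Over.mk (Scheme.Opens.ι D.support.compl ≫ a ≫ π)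
  let i : U' ⟶ T' := Over.homMk (Scheme.Opens.ι D.support.compl) rfl
  have hi : i ≫ a' = i ≫ b' := by
    ext1
    exact h
  have h2 : (equalizer.lift i hi).left ≫ (equalizer.ι a' b').left =
      Scheme.Opens.ι D.support.compl := by
    rw [← Over.comp_left, equalizer.lift_ι]
    rfl
  have h3 : (equalizer.ι a' b').left.ker = ⊥ := by
    rw [← le_bot_iff, ← ker_compl_support_eq_bot hD, ← h2]
    exact Scheme.Hom.le_ker_comp _ _
  have h4 : IsIso (equalizer.ι a' b').left := IsClosedImmersion.isIso_iff_ker_eq_bot.mpr h3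
  have h5 : (equalizer.ι a' b').left ≫ a = (equalizer.ι a' b').left ≫ b :=
    congr(($(equalizer.condition a' b')).left)
  exact (cancel_epi _).mp h5

/-- Uniqueness in the universal property of a blow-up. -/
lemma hom_ext_of_isEffectiveCartier {T Y' : Scheme.{u}} (π : Y' ⟶ Y) [IsSeparated π]
    (Z : Y.IdealSheafData) [IsIso (π ∣_ Z.support.compl)] (a b : T ⟶ Y') (hab : a ≫ π = b ≫ π)
    (hD : IsEffectiveCartier (Z.comap (a ≫ π))) : a = b := by
  refine hom_ext_of_cartier π a b hab hD
    (hom_ext_of_isIso_morphismRestrict π Z.support.compl _ _ (by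
      simp only [Category.assoc, hab]) ?_)
  rintro ⟨t, ht⟩ h
  refine ht ((mem_support_comap _ _ _).mpr ?_)
  exact h

lemma exists_glueMorphisms {T Y' : Scheme.{u}} {S : T → Scheme.{u}} (i : ∀ t, S t ⟶ T)
    [hi : ∀ t, IsOpenImmersion (i t)] (hti : ∀ t, t ∈ Set.range (i t)) (l : ∀ t, S t ⟶ Y')
    (hglue : ∀ s t, pullback.fst (i s) (i t) ≫ l s = pullback.snd (i s) (i t) ≫ l t) :
    ∃ h : T ⟶ Y', ∀ t, i t ≫ h = l t :=
  let 𝒰 : T.OpenCover := Scheme.Cover.mkOfCovers T S i (fun t ↦ ⟨t, hti t⟩) hi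
  ⟨𝒰.glueMorphisms l hglue, Scheme.Cover.ι_glueMorphisms 𝒰 l hglue⟩

lemma hom_ext_of_cover {T Y' : Scheme.{u}} {S : T → Scheme.{u}} (i : ∀ t, S t ⟶ T)
    [hi : ∀ t, IsOpenImmersion (i t)] (hti : ∀ t, t ∈ Set.range (i t)) {a b : T ⟶ Y'}
    (h : ∀ t, i t ≫ a = i t ≫ b) : a = b :=
  let 𝒰 : T.OpenCover := Scheme.Cover.mkOfCovers T S i (fun t ↦ ⟨t, hti t⟩) hi
  Scheme.Cover.hom_ext 𝒰 _ _ h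

/-- The universal property of a blow-up can be checked locally, near the center. -/
lemma isBlowup_of_local {Y' : Scheme.{u}} (π : Y' ⟶ Y) [IsSeparated π]
    (Z : Y.IdealSheafData) [IsIso (π ∣_ Z.support.compl)] (hZ : IsEffectiveCartier (Z.comap π))
    (O : Y.Opens) (hO : ∀ y ∈ Z.support, y ∈ O)
    (h : ∀ (B : Type u) [CommRing B] (g : Spec (CommRingCat.of B) ⟶ Y) (a : B)
      (x : Spec (CommRingCat.of B)), a ∈ nonZeroDivisors B →
      Z.comap g = idealSheaf (Ideal.span {a}) → (∀ x, g x ∈ O) →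
      ∃ (S : Scheme.{u}) (i : S ⟶ Spec (CommRingCat.of B)) (_ : IsOpenImmersion i) (l : S ⟶ Y'),
        x ∈ Set.range i ∧ l ≫ π = i ≫ g) :
    IsBlowup π Z := by
  refine ⟨hZ, fun {T} g hg ↦ ?_⟩
  have key (t : T) : ∃ (S : Scheme.{u}) (i : S ⟶ T) (_ : IsOpenImmersion i) (l : S ⟶ Y'),
      t ∈ Set.range i ∧ l ≫ π = i ≫ g := by
    by_cases ht : g t ∈ Z.support
    · obtain ⟨B, _, j, _, a, ⟨x, rfl⟩, hj, ha, hDa⟩ := hg.exists_chart t (g ⁻¹ᵁ O) (hO _ ht)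
      rw [← comap_comp] at hDa
      obtain ⟨S, i, _, l, ⟨z, rfl⟩, hl⟩ := h B (j ≫ g) a x ha hDa (fun x ↦ by
        rw [Scheme.Hom.comp_apply]
        exact hj ⟨x, rfl⟩)
      exact ⟨S, i ≫ j, inferInstance, l, ⟨z, Scheme.Hom.comp_apply _ _ _⟩,
        by rw [hl, Category.assoc]⟩
    · obtain ⟨l, hl⟩ := exists_lift_of_isIso_morphismRestrict π Z.support.compl
        ((g ⁻¹ᵁ Z.support.compl).ι ≫ g) (by
          rintro ⟨t, ht⟩
          exact ht)
      refine ⟨_, (g ⁻¹ᵁ Z.support.compl).ι, inferInstance, l, ?_, hl⟩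
      rw [Scheme.Opens.range_ι]
      exact ht
  choose S i hi l hti hl using key
  have hglue (s t : T) : pullback.fst (i s) (i t) ≫ l s = pullback.snd (i s) (i t) ≫ l t := by
    have h1 : (pullback.fst (i s) (i t) ≫ l s) ≫ π = (pullback.fst (i s) (i t) ≫ i s) ≫ g := by
      rw [Category.assoc, Category.assoc, hl]
    refine hom_ext_of_isEffectiveCartier π Z _ _ ?_ ?_
    · rw [h1, pullback.condition, Category.assoc, Category.assoc, hl]
    · rw [h1, comap_comp]
      exact hg.comap_of_isOpenImmersion _
  obtain ⟨h, hh⟩ := exists_glueMorphisms i hti l hglue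
  refine ⟨h, ?_, fun l' hl' ↦ ?_⟩
  · refine hom_ext_of_cover i hti fun t ↦ ?_
    rw [← Category.assoc, hh, hl]
  · refine hom_ext_of_isEffectiveCartier π Z _ _ ?_ ?_
    · refine hom_ext_of_cover i hti fun t ↦ ?_
      rw [hl', ← Category.assoc, hh, hl]
    · rwa [hl']

end Cartier

/-! ### Blow-ups in a regular pair -/

section Blowup

variable {Y : Scheme.{u}} {B : Type u} [CommRing B] {u v : B}

lemma map_incl_span (u v : B) : (Ideal.span {u, v}).map (BlowupAlg.incl u v) =
    Ideal.span {BlowupAlg.incl u v u} := by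
  rw [Ideal.map_span, Set.image_pair, ← BlowupAlg.mul_ratio]
  refine le_antisymm (Ideal.span_le.mpr ?_) (Ideal.span_mono (by simp))
  rintro _ (rfl | rfl)
  · exact Ideal.mem_span_singleton_self _
  · exact Ideal.mul_mem_right _ _ (Ideal.mem_span_singleton_self _)

/-- Lifting to the chart `B[v/u]` where the ideal `(u, v)` is generated by `u`. -/
lemma exists_lift_blowupAlg {C : Type u} [CommRing C] (φ : B →+* C) {a p q : C} (hp : φ u = a * p)
    (hq : φ v = a * q) (x : Spec (CommRingCat.of C)) (hx : p ∉ x.asIdeal) :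
    ∃ (S : Scheme.{u}) (i : S ⟶ Spec (CommRingCat.of C)) (_ : IsOpenImmersion i)
      (l : S ⟶ Spec (CommRingCat.of (BlowupAlg u v))), x ∈ Set.range i ∧
        l ≫ Spec.map (CommRingCat.ofHom (BlowupAlg.incl u v)) =
          i ≫ Spec.map (CommRingCat.ofHom φ) := by
  let κ := algebraMap C (Localization.Away p)
  have hr : Set.range (Spec.map (CommRingCat.ofHom κ)) =
      (PrimeSpectrum.basicOpen p : Set (PrimeSpectrum _)) :=
    PrimeSpectrum.localization_away_comap_range _ _
  refine ⟨_, Spec.map (CommRingCat.ofHom κ), inferInstance,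
    Spec.map (CommRingCat.ofHom (BlowupAlg.desc (κ.comp φ)
      (IsLocalization.Away.invSelf p * κ q) ?_)), hr.ge hx, ?_⟩
  · rw [RingHom.comp_apply, RingHom.comp_apply, hp, hq, map_mul, map_mul, mul_assoc,
      ← mul_assoc (κ p), IsLocalization.Away.mul_invSelf, one_mul]
  · rw [← Spec.map_comp, ← Spec.map_comp, ← CommRingCat.ofHom_comp, ← CommRingCat.ofHom_comp,
      BlowupAlg.desc_comp_incl]

/-- The blow-up of a scheme along a closed subscheme that lies in an affine chart and is defined
there by a regular pair `(u, v)`. It is covered by `Spec B[v/u]` and `Spec B[u/v]` over this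
chart. -/
theorem exists_blowup (j : Spec (CommRingCat.of B) ⟶ Y) [IsOpenImmersion j] (h : RegPair u v)
    (Z : Y.IdealSheafData) (hZ : Z.comap j = idealSheaf (Ideal.span {u, v}))
    (hZj : ∀ y ∈ Z.support, y ∈ j.opensRange) :
    ∃ (Y' : Scheme.{u}) (π : Y' ⟶ Y) (k₁ : Spec (CommRingCat.of (BlowupAlg u v)) ⟶ Y')
      (k₂ : Spec (CommRingCat.of (BlowupAlg v u)) ⟶ Y'),
      IsOpenImmersion k₁ ∧ IsOpenImmersion k₂ ∧
      k₁ ≫ π = Spec.map (CommRingCat.ofHom (BlowupAlg.incl u v)) ≫ j ∧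
      k₂ ≫ π = Spec.map (CommRingCat.ofHom (BlowupAlg.incl v u)) ≫ j ∧
      IsProper π ∧ IsBlowup π Z ∧ IsIso (π ∣_ Z.support.compl) ∧
      (∀ y, π y ∈ j.opensRange → y ∈ Set.range k₁ ∨ y ∈ Set.range k₂) ∧
      (∀ x, BlowupAlg.ratio u v ∉ x.asIdeal → k₁ x ∈ Set.range k₂) ∧
      ∀ x, BlowupAlg.ratio v u ∉ x.asIdeal → k₂ x ∈ Set.range k₁ := by
  have hV : j ⁻¹ᵁ Z.support.compl =
      ((PrimeSpectrum.basicOpen u : Opens (PrimeSpectrum B)) ⊔ PrimeSpectrum.basicOpen v :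
        Opens (PrimeSpectrum B)) := by
    ext x
    have h1 : j x ∈ Z.support ↔ u ∈ x.asIdeal ∧ v ∈ x.asIdeal := by
      rw [← mem_support_comap, hZ, mem_support_idealSheaf, Ideal.span_le, Set.pair_subset_iff]
      rfl
    change ¬ j x ∈ Z.support ↔ u ∉ x.asIdeal ∨ v ∉ x.asIdeal
    rw [h1, not_and_or]
  obtain ⟨Y', π, k, hk, hpb, hiso, hcov⟩ := exists_glue j (AffineBlowup.toSpec u v)
    Z.support.compl (by rw [hV]; exact AffineBlowup.isIso_toSpec_morphismRestrict u v)
  have hk₁ : (AffineBlowup.chart₁ u v ≫ k) ≫ π =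
      Spec.map (CommRingCat.ofHom (BlowupAlg.incl u v)) ≫ j := by
    rw [Category.assoc, hpb.w, reassoc_of% (AffineBlowup.chart₁_toSpec u v)]
  have hk₂ : (AffineBlowup.chart₂ u v ≫ k) ≫ π =
      Spec.map (CommRingCat.ofHom (BlowupAlg.incl v u)) ≫ j := by
    rw [Category.assoc, hpb.w, reassoc_of% (AffineBlowup.chart₂_toSpec u v)]
  have hcov' (y : Y') (hy : π y ∈ j.opensRange) :
      (∃ x, (AffineBlowup.chart₁ u v ≫ k) x = y) ∨ ∃ x, (AffineBlowup.chart₂ u v ≫ k) x = y := by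
    obtain ⟨b, hb⟩ := hy
    obtain ⟨z, rfl, -⟩ := Scheme.exists_preimage_of_isPullback hpb y b hb.symm
    obtain ⟨x, rfl⟩ | ⟨x, rfl⟩ := AffineBlowup.cases u v z
    · exact .inl ⟨x, Scheme.Hom.comp_apply _ _ _⟩
    · exact .inr ⟨x, Scheme.Hom.comp_apply _ _ _⟩
  have hproper : IsProper π := by
    refine IsZariskiLocalAtTarget.of_iSup_eq_top
      (fun b : Bool ↦ cond b Z.support.compl j.opensRange) ?_ ?_
    · refine top_le_iff.mp fun y _ ↦ Opens.mem_iSup.mpr ?_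
      by_cases hy : y ∈ Z.support
      · exact ⟨false, hZj y hy⟩
      · exact ⟨true, hy⟩
    · rintro (_ | _)
      · obtain ⟨x, hx⟩ := exists_isPullback_morphismRestrict hpb
        exact MorphismProperty.of_isPullback hx (AffineBlowup.isProper u v)
      · exact inferInstanceAs (IsProper (π ∣_ Z.support.compl))
  have hcartier : IsEffectiveCartier (Z.comap π) := by
    refine isEffectiveCartier_of_charts fun y ↦ ?_
    by_cases hy : π y ∈ Z.support
    · obtain hy | hy := hcov' y (hZj _ hy)
      · refine ⟨BlowupAlg u v, inferInstance, AffineBlowup.chart₁ u v ≫ k, inferInstance,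
          BlowupAlg.incl u v u, hy, ?_, ?_⟩
        · exact mem_nonZeroDivisors_iff_right.mpr fun b hb ↦
            (BlowupAlg.regPair h).left b (by rwa [mul_comm])
        · rw [← comap_comp, hk₁, comap_comp, hZ, comap_idealSheaf, map_incl_span]
      · refine ⟨BlowupAlg v u, inferInstance, AffineBlowup.chart₂ u v ≫ k, inferInstance,
          BlowupAlg.incl v u v, hy, ?_, ?_⟩
        · exact mem_nonZeroDivisors_iff_right.mpr fun b hb ↦
            (BlowupAlg.regPair h.symm).left b (by rwa [mul_comm])
        · rw [← comap_comp, hk₂, comap_comp, hZ, comap_idealSheaf, Set.pair_comm, map_incl_span]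
    · obtain ⟨_, ⟨U, hU, rfl⟩, hyU, hUV⟩ := Y'.isBasis_affineOpens.exists_subset_of_mem_open
        (show y ∈ ((π ⁻¹ᵁ Z.support.compl : Opens _) : Set _) from hy)
        (π ⁻¹ᵁ Z.support.compl).isOpen
      have : IsOpenImmersion (hU.fromSpec) := hU.isOpenImmersion_fromSpec
      refine ⟨Γ(Y', U), inferInstance, hU.fromSpec, this, 1, ?_, one_mem _, ?_⟩
      · rw [hU.opensRange_fromSpec]
        exact hyU
      · rw [Ideal.span_singleton_one, idealSheaf_top, ← comap_comp, comap_eq_top_iff]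
        intro x
        rw [Scheme.Hom.comp_apply]
        exact hUV (hU.opensRange_fromSpec.le ⟨x, rfl⟩)
  refine ⟨Y', π, AffineBlowup.chart₁ u v ≫ k, AffineBlowup.chart₂ u v ≫ k,
    inferInstanceAs (IsOpenImmersion (AffineBlowup.chart₁ u v ≫ k)),
    inferInstanceAs (IsOpenImmersion (AffineBlowup.chart₂ u v ≫ k)), hk₁, hk₂, hproper,
    isBlowup_of_local π Z hcartier j.opensRange hZj ?_, hiso,
    hcov', fun x hx ↦ ?_, fun x hx ↦ ?_⟩
  rotate_left
  · obtain ⟨y, hy⟩ := AffineBlowup.mem_range_chart₂ u v x hx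
    exact ⟨y, by rw [Scheme.Hom.comp_apply, hy, Scheme.Hom.comp_apply]⟩
  · obtain ⟨y, hy⟩ := AffineBlowup.mem_range_chart₁ u v x hx
    exact ⟨y, by rw [Scheme.Hom.comp_apply, hy, Scheme.Hom.comp_apply]⟩
  intro C _ g a x ha hga hg
  obtain ⟨φ, rfl⟩ : ∃ φ : B →+* C, g = Spec.map (CommRingCat.ofHom φ) ≫ j := by
    have hr : Set.range g ⊆ Set.range j := by
      rintro _ ⟨x, rfl⟩
      exact hg x
    refine ⟨(Spec.preimage (IsOpenImmersion.lift j g hr)).hom, ?_⟩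
    rw [CommRingCat.ofHom_hom, Spec.map_preimage, IsOpenImmersion.lift_fac]
  rw [comap_comp, hZ, comap_idealSheaf, Ideal.map_span, Set.image_pair] at hga
  have hga := idealSheaf_injective hga
  obtain ⟨p, hp⟩ := Ideal.mem_span_singleton.mp
    (hga.le (Ideal.subset_span (Set.mem_insert (φ u) {φ v})))
  obtain ⟨q, hq⟩ := Ideal.mem_span_singleton.mp
    (hga.le (Ideal.subset_span (Set.mem_insert_of_mem (φ u) rfl)))
  obtain ⟨r, s, hrs⟩ := Ideal.mem_span_pair.mp (hga.ge (Ideal.mem_span_singleton_self a))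
  -- since `a = r φ(u) + s φ(v)`, one of the quotients `p = φ(u)/a` and `q = φ(v)/a` is invertible
  have hpq : r * p + s * q = 1 := by
    have h1 : (r * p + s * q - 1) * a = 0 := by
      rw [hp, hq] at hrs
      linear_combination hrs
    exact sub_eq_zero.mp ((mem_nonZeroDivisors_iff_right.mp ha) _ h1)
  by_cases hx : p ∈ x.asIdeal
  · have hx' : q ∉ x.asIdeal := fun hx' ↦ x.2.ne_top ((Ideal.eq_top_iff_one _).mpr
      (hpq ▸ Ideal.add_mem _ (Ideal.mul_mem_left _ _ hx) (Ideal.mul_mem_left _ _ hx')))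
    obtain ⟨S, i, hi, l, hxi, hl⟩ := exists_lift_blowupAlg φ hq hp x hx'
    exact ⟨S, i, hi, l ≫ AffineBlowup.chart₂ u v ≫ k, hxi, by
      rw [Category.assoc, hk₂, ← Category.assoc, hl, Category.assoc]⟩
  · obtain ⟨S, i, hi, l, hxi, hl⟩ := exists_lift_blowupAlg φ hp hq x hx
    exact ⟨S, i, hi, l ≫ AffineBlowup.chart₁ u v ≫ k, hxi, by
      rw [Category.assoc, hk₁, ← Category.assoc, hl, Category.assoc]⟩

end Blowup

/-! ### Closures of closed subschemes of open subschemes -/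

section Closure

variable {Y Y' : Scheme.{u}} {B : Type u} [CommRing B]

/-- The scheme-theoretic closure in `Y` of the restriction of a closed subscheme to an open
subscheme. -/
def closureOf (V : Y.Opens) (I : Y.IdealSheafData) : Y.IdealSheafData :=
  (I.comap (Scheme.Opens.ι V)).map (Scheme.Opens.ι V)

/-- The closure can be computed in a chart in which `V` is the locus where `w` does not vanish:
it removes factors of powers of `w` from an equation. -/
lemma closureOf_comap (V : Y.Opens) [QuasiCompact (Scheme.Opens.ι V)] (I : Y.IdealSheafData)
    (k : Spec (CommRingCat.of B) ⟶ Y) [IsOpenImmersion k] (w g : B) {e : B} {m : ℕ}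
    (he : e ∣ w ^ m) (hV : ∀ x, k x ∈ V ↔ w ∉ x.asIdeal)
    (hI : I.comap k = idealSheaf (Ideal.span {e * g})) (hg : ∀ b, g ∣ w * b → g ∣ b) :
    (closureOf V I).comap k = idealSheaf (Ideal.span {g}) := by
  let κ := algebraMap B (Localization.Away w)
  let f' := Spec.map (CommRingCat.ofHom κ)
  have hr : Set.range f' = (PrimeSpectrum.basicOpen w : Set (PrimeSpectrum B)) :=
    PrimeSpectrum.localization_away_comap_range _ _
  have hf'V : Set.range (f' ≫ k) ⊆ Set.range V.ι := by
    rw [Scheme.Opens.range_ι]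
    rintro _ ⟨x, rfl⟩
    rw [Scheme.Hom.comp_apply]
    exact (hV _).mpr (hr.le ⟨x, rfl⟩)
  let g' := IsOpenImmersion.lift V.ι (f' ≫ k) hf'V
  have hg' : g' ≫ V.ι = f' ≫ k := IsOpenImmersion.lift_fac _ _ _
  have hp : IsPullback g' f' V.ι k := by
    refine IsOpenImmersion.isPullback _ _ _ _ hg'.symm ?_
    rw [Scheme.Opens.opensRange_ι]
    ext x
    exact (hV x).trans (Set.ext_iff.mp hr x).symm
  rw [closureOf, comap_map_of_isPullback hp.flip, ← comap_comp, hg', comap_comp, hI,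
    comap_idealSheaf, map_idealSheaf]
  congr 1
  have hw : IsUnit (κ w) := IsLocalization.Away.algebraMap_isUnit _
  have hm : (Ideal.span {e * g}).map κ = Ideal.span {κ g} := by
    rw [Ideal.map_span, Set.image_singleton, map_mul, Ideal.span_singleton_mul_left_unit]
    exact isUnit_of_dvd_unit (map_dvd κ he) (by rw [map_pow]; exact hw.pow m)
  rw [hm]
  refine le_antisymm (fun b hb ↦ ?_) ?_
  · obtain ⟨c, hc⟩ := Ideal.mem_span_singleton.mp (Ideal.mem_comap.mp hb)
    obtain ⟨n, c', hc'⟩ := IsLocalization.Away.surj w c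
    have h1 : κ (w ^ n * b) = κ (g * c') := by
      rw [map_mul, map_mul, hc, ← hc', map_pow]
      ring
    obtain ⟨⟨_, l, rfl⟩, hl⟩ := (IsLocalization.eq_iff_exists (.powers w) _).mp h1
    have h2 : g ∣ w ^ (l + n) * b := ⟨w ^ l * c', by
      rw [pow_add, mul_assoc]
      exact hl.trans (by ring)⟩
    have h3 (i : ℕ) (h : g ∣ w ^ i * b) : g ∣ b := by
      induction i with
      | zero => simpa using h
      | succ i ih => exact ih (hg _ (by rwa [← mul_assoc, ← pow_succ']))
    exact Ideal.mem_span_singleton.mpr (h3 _ h2)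
  · rw [Ideal.span_singleton_le_iff_mem, Ideal.mem_comap]
    exact Ideal.mem_span_singleton_self _

/-- The complement of an effective Cartier divisor is quasi-compact over the ambient scheme. -/
lemma quasiCompact_compl_of_cartier {D : Y.IdealSheafData} (hD : IsEffectiveCartier D) :
    QuasiCompact (Scheme.Opens.ι D.support.compl) := by
  choose U hU a ha hDa using hD
  refine (@HasAffineProperty.iff_of_iSup_eq_top _ (fun X _ _ _ ↦ CompactSpace X)
    instHasAffinePropertyQuasiCompactCompactSpaceCarrierCarrierCommRingCat _ _ _ _ U
    (top_le_iff.mp fun y _ ↦ Opens.mem_iSup.mpr ⟨y, hU y⟩)).mpr fun y ↦ ?_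
  refine isCompact_iff_compactSpace.mp ?_
  rw [(Scheme.Opens.ι D.support.compl).isOpenEmbedding.isInducing.isCompact_iff]
  have h : Scheme.Opens.ι D.support.compl '' ((Scheme.Opens.ι D.support.compl ⁻¹ᵁ (U y).1 :
      Opens _) : Set _) = (Y.basicOpen (a y) : Set Y) := by
    ext z
    have key (hz : z ∈ (U y).1) : z ∈ D.support ↔ z ∉ Y.basicOpen (a y) := by
      rw [mem_support_iff_of_mem (U := U y) hz, hDa, Scheme.zeroLocus_span,
        Scheme.zeroLocus_singleton]
      rfl
    constructor
    · rintro ⟨⟨z, hz⟩, hzU, rfl⟩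
      by_contra h
      exact hz ((key hzU).mpr h)
    · intro hz
      have hzU := Y.basicOpen_le _ hz
      exact ⟨⟨z, fun h ↦ (key hzU).mp h hz⟩, hzU, rfl⟩
  rw [h]
  exact ((U y).2.basicOpen (a y)).isCompact

/-- Off the boundary, a closed subscheme and its closure agree. -/
lemma mem_support_closureOf (V : Y.Opens) [QuasiCompact (Scheme.Opens.ι V)] (I : Y.IdealSheafData)
    {y : Y} (hy : y ∈ V) (hI : y ∈ I.support) : y ∈ (closureOf V I).support := by
  have hp : IsPullback (𝟙 V.toScheme) (𝟙 V.toScheme) V.ι V.ι := IsKernelPair.id_of_mono _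
  have h : (closureOf V I).comap V.ι = I.comap V.ι := by
    rw [closureOf, comap_map_of_isPullback hp, comap_id, map_id]
  have h1 : (⟨y, hy⟩ : V) ∈ (I.comap V.ι).support := (mem_support_comap _ _ _).mpr hI
  rw [← h] at h1
  exact (mem_support_comap _ _ _).mp h1

/-- A chart in the locus where a modification is an isomorphism is also a chart of the
modification. -/
lemma exists_isOpenImmersion_lift (π : Y' ⟶ Y) (V : Y.Opens) [IsIso (π ∣_ V)] {S : Scheme.{u}}
    (j : S ⟶ Y) [IsOpenImmersion j] (hj : j.opensRange ≤ V) :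
    ∃ (j' : S ⟶ Y') (_ : IsOpenImmersion j'), j' ≫ π = j ∧ j'.opensRange = π ⁻¹ᵁ j.opensRange := by
  have hr : Set.range j ⊆ Set.range V.ι := by
    rw [Scheme.Opens.range_ι]
    exact hj
  let l := IsOpenImmersion.lift V.ι j hr
  have hl : l ≫ V.ι = j := IsOpenImmersion.lift_fac _ _ _
  have : IsOpenImmersion (l ≫ V.ι) := by rw [hl]; infer_instance
  have : IsOpenImmersion l := IsOpenImmersion.of_comp _ V.ι
  have hfac : (l ≫ inv (π ∣_ V) ≫ (π ⁻¹ᵁ V).ι) ≫ π = j := by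
    rw [Category.assoc, Category.assoc, ← morphismRestrict_ι, IsIso.inv_hom_id_assoc, hl]
  refine ⟨l ≫ inv (π ∣_ V) ≫ (π ⁻¹ᵁ V).ι, inferInstance, hfac, le_antisymm ?_ ?_⟩
  · rintro _ ⟨x, rfl⟩
    refine ⟨x, ?_⟩
    rw [← Scheme.Hom.comp_apply, hfac]
  · rintro y ⟨x, hx⟩
    refine ⟨x, ?_⟩
    have hy : π y ∈ V := hj ⟨x, hx⟩
    have h1 : (π ∣_ V) ((l ≫ inv (π ∣_ V)) x) = (π ∣_ V) ⟨y, hy⟩ := by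
      rw [← Scheme.Hom.comp_apply, Category.assoc, IsIso.inv_hom_id, Category.comp_id]
      refine V.ι.isOpenEmbedding.injective ?_
      rw [← Scheme.Hom.comp_apply, hl, hx]
      exact congr($(morphismRestrict_ι π V) ⟨y, hy⟩).symm
    have h2 := (π ∣_ V).homeomorph.injective h1
    rw [← Category.assoc, Scheme.Hom.comp_apply, h2]
    rfl

end Closure

/-! ### Toric modifications of the germ -/

section InsertAt

variable {α : Type*}

/-- The sequence `f` with `x` inserted between `f c` and `f (c + 1)`. -/
def insertAt (c : ℕ) (x : α) (f : ℕ → α) (i : ℕ) : α :=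
  if i ≤ c then f i else if i = c + 1 then x else f (i - 1)

lemma insertAt_of_le {c i : ℕ} (x : α) (f : ℕ → α) (h : i ≤ c) : insertAt c x f i = f i :=
  if_pos h

lemma insertAt_self (c : ℕ) (x : α) (f : ℕ → α) : insertAt c x f (c + 1) = x := by
  simp [insertAt]

lemma insertAt_of_lt {c i : ℕ} (x : α) (f : ℕ → α) (h : c < i) :
    insertAt c x f (i + 1) = f i := by
  rw [insertAt, if_neg (by lia), if_neg (by lia), Nat.add_sub_cancel]

/-- Every index is that of the inserted element, or comes from one below or above it. -/
lemma insertAt_index (c i : ℕ) : i ≤ c ∨ i = c + 1 ∨ ∃ k, c < k ∧ i = k + 1 := by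
  obtain h | h | h := lt_trichotomy i (c + 1)
  · exact .inl (by lia)
  · exact .inr (.inl h)
  · exact .inr (.inr ⟨i - 1, by lia, by lia⟩)

end InsertAt

section Model

variable {W : Type u} [CommRing W] {Y : Scheme.{u}}

/-- The open subscheme `O` of `f : Y ⟶ Spec W[[x, y]]` is the toric chart of the cone spanned by
`p` and `q`. Its coordinate axes are the divisors `P` and `Q`, and the divisors in `R` do not meet
it. -/
def HasToricChart (f : Y ⟶ germ W) (O : Y.Opens) (p q : ℕ × ℕ) (P Q : Y.IdealSheafData)
    (R : Set Y.IdealSheafData) : Prop :=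
  ∃ (B : Type u) (_ : CommRing B) (φ : MvPowerSeries (Fin 2) W →+* B)
    (j : Spec (CommRingCat.of B) ⟶ Y) (_ : IsOpenImmersion j) (u v : B), j.opensRange = O ∧
      j ≫ f = Spec.map (CommRingCat.ofHom φ) ∧ IsMonomialChart φ u v p q ∧
      P.comap j = idealSheaf (Ideal.span {u}) ∧ Q.comap j = idealSheaf (Ideal.span {v}) ∧
      ∀ I ∈ R, I.comap j = ⊤

lemma HasToricChart.mono {f : Y ⟶ germ W} {O : Y.Opens} {p q : ℕ × ℕ} {P Q : Y.IdealSheafData}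
    {R R' : Set Y.IdealSheafData} (h : HasToricChart f O p q P Q R) (hR : R' ⊆ R) :
    HasToricChart f O p q P Q R' := by
  obtain ⟨B, _, φ, j, _, u, v, h1, h2, h3, h4, h5, h6⟩ := h
  exact ⟨B, inferInstance, φ, j, inferInstance, u, v, h1, h2, h3, h4, h5, fun I hI ↦ h6 I (hR hI)⟩

/-- `f : Y ⟶ Spec W[[x, y]]` is the toric modification of the plane which subdivides the quadrant
by the rays `r 0 = (1, 0), r 1, …, r n, r (n + 1) = (0, 1)`, in counterclockwise order. The divisor
of `r i` is `D i`, and `O c` is the affine toric chart of the cone spanned by `r c` and `r (c + 1)`.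
-/
structure IsModel (f : Y ⟶ germ W) (n : ℕ) (r : ℕ → ℕ × ℕ) (D : ℕ → Y.IdealSheafData)
    (O : ℕ → Y.Opens) : Prop where
  proper : IsProper f
  iterated : IsIteratedBlowup f
  iso : IsIso (f ∣_ (origin W).ker.support.compl)
  ray_zero : r 0 = (1, 0)
  ray_last : r (n + 1) = (0, 1)
  det : ∀ i ≤ n, (r i).1 * (r (i + 1)).2 = (r i).2 * (r (i + 1)).1 + 1
  pos : ∀ i, 1 ≤ i → i ≤ n → (r i).1 ≠ 0 ∧ (r i).2 ≠ 0
  chart : ∀ c ≤ n, HasToricChart f (O c) (r c) (r (c + 1)) (D c) (D (c + 1))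
    {I | ∃ i, i ≠ c ∧ i ≠ c + 1 ∧ D i = I}
  cover : ∀ y, ∃ c ≤ n, y ∈ O c
  mem_chart : ∀ c ≤ n, ∀ y, (∀ i, i ≠ c → i ≠ c + 1 → y ∉ (D i).support) → y ∈ O c

lemma mem_support_origin (x : germ W) : x ∈ (origin W).ker.support ↔
    MvPowerSeries.X 0 ∈ x.asIdeal ∧ MvPowerSeries.X 1 ∈ x.asIdeal := by
  rw [ker_specMap_eq, mem_support_idealSheaf]
  constructor
  · intro h
    exact ⟨h (by simp [RingHom.mem_ker]), h (by simp [RingHom.mem_ker])⟩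
  · rintro ⟨h0, h1⟩ a ha
    obtain ⟨a₀, a₁, h⟩ := exists_eq_C_add_X_mul a
    rw [h, RingHom.mem_ker.mp ha, map_zero, zero_add]
    exact Ideal.add_mem _ (Ideal.mul_mem_right _ _ h0) (Ideal.mul_mem_right _ _ h1)

variable (W) in
/-- The trivial modification. -/
lemma exists_isModel : ∃ (D : ℕ → (germ W).IdealSheafData) (O : ℕ → (germ W).Opens),
    IsModel (𝟙 (germ W)) 0 (fun i ↦ if i = 0 then (1, 0) else (0, 1)) D O := by
  refine ⟨fun i ↦ if i = 0 then idealSheaf (Ideal.span {MvPowerSeries.X 0}) else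
    if i = 1 then idealSheaf (Ideal.span {MvPowerSeries.X 1}) else ⊤, fun _ ↦ ⊤, ?_⟩
  refine ⟨inferInstance, .iso _ inferInstance, inferInstance, rfl, rfl, ?_, ?_, ?_,
    fun y ↦ ⟨0, le_rfl, trivial⟩, fun _ _ _ _ ↦ trivial⟩
  · rintro i hi
    obtain rfl : i = 0 := by lia
    simp
  · intro i h1 h2
    lia
  · rintro c hc
    obtain rfl : c = 0 := by lia
    refine ⟨_, inferInstance, RingHom.id _, 𝟙 _, inferInstance, MvPowerSeries.X 0,
      MvPowerSeries.X 1, ?_, ?_, .id, ?_, ?_, ?_⟩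
    · exact Scheme.Hom.opensRange_of_isIso _
    · exact (Spec.map_id _).symm
    · exact comap_id _
    · exact comap_id _
    · rintro _ ⟨i, h0, h1, rfl⟩
      simp only [h0, if_false]
      rw [if_neg (by simpa using h1)]
      exact comap_top _

/-- The origin of a toric chart, as a section over `W`. -/
lemma exists_section_of_isMonomialChart {f : Y ⟶ germ W} [IsSeparated f]
    {p q : ℕ × ℕ} {B : Type u} [CommRing B] {φ : MvPowerSeries (Fin 2) W →+* B}
    {j : Spec (CommRingCat.of B) ⟶ Y} [IsOpenImmersion j] {u v : B}
    (hj : j ≫ f = Spec.map (CommRingCat.ofHom φ)) (h : IsMonomialChart φ u v p q)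
    (h₁ : p.1 + q.1 ≠ 0) (h₂ : p.2 + q.2 ≠ 0) :
    ∃ s : base W ⟶ Y, s ≫ f = origin W ∧ s.ker.comap j = idealSheaf (Ideal.span {u, v}) ∧
      (∀ y ∈ s.ker.support, y ∈ j.opensRange) ∧
      f ⁻¹ᵁ (origin W).ker.support.compl ≤ s.ker.support.compl := by
  obtain ⟨σ, hσφ, -, -, hσ, hσker⟩ := h.exists_origin h₁ h₂
  let s : base W ⟶ Y := Spec.map (CommRingCat.ofHom σ) ≫ j
  have hs : s ≫ f = origin W := by
    rw [Category.assoc, hj, ← Spec.map_comp, ← CommRingCat.ofHom_comp, hσφ]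
  have : IsClosedImmersion (origin W) := IsClosedImmersion.spec_of_surjective _
    fun w ↦ ⟨MvPowerSeries.C w, MvPowerSeries.constantCoeff_C w⟩
  have : IsClosedImmersion (s ≫ f) := by rw [hs]; infer_instance
  have hsc : IsClosedImmersion s := IsClosedImmersion.of_comp s f
  have hsj (x) : s x ∈ j.opensRange := ⟨Spec.map (CommRingCat.ofHom σ) x,
    (Scheme.Hom.comp_apply _ _ _).symm⟩
  have hZs (y) : y ∈ s.ker.support ↔ ∃ x, s x = y := by
    rw [← SetLike.mem_coe, Scheme.Hom.support_ker, s.isClosedEmbedding.isClosed_range.closure_eq]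
    rfl
  refine ⟨s, hs, ?_, ?_, ?_⟩
  · have hp : IsPullback (Spec.map (CommRingCat.ofHom σ)) (𝟙 (base W)) j s := by
      refine IsOpenImmersion.isPullback _ _ _ _ (Category.id_comp _) ?_
      rw [Scheme.Hom.opensRange_of_isIso (𝟙 (base W))]
      exact top_le_iff.mp fun x _ ↦ hsj x
    rw [comap_ker_of_isPullback hp, ker_specMap_eq, hσker]
  · intro y hy
    obtain ⟨x, rfl⟩ := (hZs y).mp hy
    exact hsj x
  · intro y hy h
    obtain ⟨x, rfl⟩ := (hZs y).mp h
    refine hy ?_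
    change f (s x) ∈ (origin W).ker.support
    rw [← Scheme.Hom.comp_apply, hs, ← SetLike.mem_coe, Scheme.Hom.support_ker]
    exact subset_closure ⟨x, rfl⟩

/-- The geometric content of the blow-up `π` of the origin of the `c`-th chart: `E` is the
exceptional divisor, `S i` is the strict transform of `D i`, and `O₁`, `O₂` are the new charts, of
the cones spanned by the new ray and `r (c + 1)`, and by `r c` and the new ray. -/
structure IsChartBlowup {Y' : Scheme.{u}} (π : Y' ⟶ Y) (f : Y ⟶ germ W) (n : ℕ) (r : ℕ → ℕ × ℕ)
    (D : ℕ → Y.IdealSheafData) (O : ℕ → Y.Opens) (c : ℕ) (E : Y'.IdealSheafData)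
    (S : ℕ → Y'.IdealSheafData) (O₁ O₂ : Y'.Opens) : Prop where
  proper : IsProper (π ≫ f)
  iterated : IsIteratedBlowup (π ≫ f)
  iso : IsIso ((π ≫ f) ∣_ (origin W).ker.support.compl)
  chart₁ : HasToricChart (π ≫ f) O₁ (r c + r (c + 1)) (r (c + 1)) E (S (c + 1))
    {I | ∃ i, i ≠ c + 1 ∧ S i = I}
  chart₂ : HasToricChart (π ≫ f) O₂ (r c) (r c + r (c + 1)) (S c) E {I | ∃ i, i ≠ c ∧ S i = I}
  chart_of_ne : ∀ i ≤ n, i ≠ c → HasToricChart (π ≫ f) (π ⁻¹ᵁ O i) (r i) (r (i + 1)) (S i)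
    (S (i + 1)) (insert E {I | ∃ k, k ≠ i ∧ k ≠ i + 1 ∧ S k = I})
  cover : ∀ y, π y ∈ O c → y ∈ O₁ ∨ y ∈ O₂
  mem_support : ∀ i y, y ∉ E.support → π y ∈ (D i).support → y ∈ (S i).support
  mem_chart₁ : ∀ y, (∀ i, i ≠ c + 1 → y ∉ (S i).support) → y ∈ O₁
  mem_chart₂ : ∀ y, (∀ i, i ≠ c → y ∉ (S i).support) → y ∈ O₂

/-- A strict transform in a chart of the blow-up. -/
lemma closureOf_comap_of_isBlowupChart {Y' : Scheme.{u}} {B : Type u} [CommRing B] {u v : B}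
    (h : RegPair u v) (π : Y' ⟶ Y) (j : Spec (CommRingCat.of B) ⟶ Y)
    (k : Spec (CommRingCat.of (BlowupAlg u v)) ⟶ Y') [IsOpenImmersion k]
    (hk : k ≫ π = Spec.map (CommRingCat.ofHom (BlowupAlg.incl u v)) ≫ j) (V : Y'.Opens)
    [QuasiCompact (Scheme.Opens.ι V)] (hV : ∀ x, k x ∈ V ↔ BlowupAlg.incl u v u ∉ x.asIdeal)
    (I : Y.IdealSheafData) :
    (I.comap j = idealSheaf (Ideal.span {v}) → (closureOf V (I.comap π)).comap k =
      idealSheaf (Ideal.span {BlowupAlg.ratio u v})) ∧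
    (I.comap j = idealSheaf (Ideal.span {u}) → (closureOf V (I.comap π)).comap k = ⊤) ∧
    (I.comap j = ⊤ → (closureOf V (I.comap π)).comap k = ⊤) := by
  have hI (b : B) (h : I.comap j = idealSheaf (Ideal.span {b})) :
      (I.comap π).comap k = idealSheaf (Ideal.span {BlowupAlg.incl u v b}) := by
    rw [← comap_comp, hk, comap_comp, h, comap_idealSheaf, Ideal.map_span, Set.image_singleton]
  have htop (m) (h : (I.comap π).comap k =
      idealSheaf (Ideal.span {BlowupAlg.incl u v u ^ m * 1})) :
      (closureOf V (I.comap π)).comap k = ⊤ := by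
    rw [closureOf_comap V _ k _ 1 (dvd_refl (BlowupAlg.incl u v u ^ m)) hV h
      fun b _ ↦ one_dvd b, Ideal.span_singleton_one, idealSheaf_top]
  refine ⟨fun h' ↦ ?_, fun h' ↦ ?_, fun h' ↦ ?_⟩
  · refine closureOf_comap V _ k _ _ (pow_one _).symm.dvd hV ?_ (BlowupAlg.regPair h).left_mod
    rw [hI _ h', BlowupAlg.mul_ratio]
  · exact htop 1 (by rw [hI _ h', pow_one, mul_one])
  · refine htop 0 ?_
    rw [hI 1 (by rw [h', Ideal.span_singleton_one, idealSheaf_top]), map_one, pow_zero, mul_one]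

/-- The blow-up of the origin of a toric chart. Strict transforms are computed as closures of
the preimages of the `D i` off the exceptional divisor. -/
lemma IsModel.exists_isChartBlowup {f : Y ⟶ germ W} {n : ℕ} {r : ℕ → ℕ × ℕ}
    {D : ℕ → Y.IdealSheafData} {O : ℕ → Y.Opens} (hm : IsModel f n r D O) (c : ℕ) (hc : c ≤ n) :
    ∃ (Y' : Scheme.{u}) (π : Y' ⟶ Y) (E : Y'.IdealSheafData) (S : ℕ → Y'.IdealSheafData)
      (O₁ O₂ : Y'.Opens), IsChartBlowup π f n r D O c E S O₁ O₂ := by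
  have := hm.proper
  have := hm.iso
  obtain ⟨B, _, φ, j, _, u, v, hO, hj, hmon, hleft, hright, hother⟩ := hm.chart c hc
  have hdet := hm.det c hc
  have hr1 : (r c).1 ≠ 0 := fun h ↦ by
    rw [h, zero_mul] at hdet
    omega
  have hr2 : (r (c + 1)).2 ≠ 0 := fun h ↦ by
    rw [h, mul_zero] at hdet
    omega
  obtain ⟨s, hs, hZ, hZj, hZf⟩ := exists_section_of_isMonomialChart hj hmon (by omega) (by omega)
  have hZx (x) : j x ∈ s.ker.support ↔ u ∈ x.asIdeal ∧ v ∈ x.asIdeal := by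
    rw [← mem_support_comap, hZ, mem_support_idealSheaf, Ideal.span_le, Set.pair_subset_iff]
    rfl
  -- only the `c`-th chart meets the center
  have hZO {i} (hi : i ≤ n) (hic : i ≠ c) (y) (hy : y ∈ s.ker.support) : y ∉ O i := by
    intro hyO
    obtain ⟨x, rfl⟩ := hZj y hy
    obtain ⟨B', _, φ', j', _, u', v', hO', -, -, -, -, hj'⟩ := hm.chart i hi
    rw [← hO'] at hyO
    obtain ⟨x', hx'⟩ := hyO
    have h1 (k) (h : j x ∈ (D k).support) (h1 : k ≠ i) (h2 : k ≠ i + 1) : False := by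
      have := hj' _ ⟨k, h1, h2, rfl⟩
      rw [comap_eq_top_iff] at this
      exact this x' (hx' ▸ h)
    have h2 := (hZx x).mp hy
    by_cases hci : c = i + 1
    · refine h1 (c + 1) ?_ (by omega) (by omega)
      rw [← mem_support_comap, hright, mem_support_idealSheaf, Ideal.span_singleton_le_iff_mem]
      exact h2.2
    · refine h1 c ?_ hic.symm hci
      rw [← mem_support_comap, hleft, mem_support_idealSheaf, Ideal.span_singleton_le_iff_mem]
      exact h2.1
  obtain ⟨Y', π, k₁, k₂, _, _, hk₁, hk₂, _, hbl, hiso, hcov, hov₁, hov₂⟩ :=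
    exists_blowup j hmon.regPair s.ker hZ hZj
  have hEk₁ : (s.ker.comap π).comap k₁ = idealSheaf (Ideal.span {BlowupAlg.incl u v u}) := by
    rw [← comap_comp, hk₁, comap_comp, hZ, comap_idealSheaf, map_incl_span]
  have hEk₂ : (s.ker.comap π).comap k₂ = idealSheaf (Ideal.span {BlowupAlg.incl v u v}) := by
    rw [← comap_comp, hk₂, comap_comp, hZ, comap_idealSheaf, Set.pair_comm, map_incl_span]
  have hqc := quasiCompact_compl_of_cartier hbl.cartier
  have hEπ (y) : y ∈ (s.ker.comap π).support ↔ π y ∈ s.ker.support := mem_support_comap _ _ _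
  generalize hE : s.ker.comap π = E at *
  have hVk₁ (x) : k₁ x ∈ E.support.compl ↔ BlowupAlg.incl u v u ∉ x.asIdeal := by
    rw [← Ideal.span_singleton_le_iff_mem (I := x.asIdeal), ← mem_support_idealSheaf,
      ← hEk₁, mem_support_comap]
    rfl
  have hVk₂ (x) : k₂ x ∈ E.support.compl ↔ BlowupAlg.incl v u v ∉ x.asIdeal := by
    rw [← Ideal.span_singleton_le_iff_mem (I := x.asIdeal), ← mem_support_idealSheaf,
      ← hEk₂, mem_support_comap]
    rfl
  have hS₁ (i) := closureOf_comap_of_isBlowupChart hmon.regPair π j k₁ hk₁ _ hVk₁ (D i)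
  have hS₂ (i) := closureOf_comap_of_isBlowupChart hmon.regPair.symm π j k₂ hk₂ _ hVk₂ (D i)
  have hSV (i) (y : Y') (hy : y ∉ E.support) (h : π y ∈ (D i).support) :
      y ∈ (closureOf E.support.compl ((D i).comap π)).support :=
    mem_support_closureOf _ _ hy ((mem_support_comap _ _ _).mpr h)
  have hold (i) (hi : i ≤ n) (hic : i ≠ c) : HasToricChart (π ≫ f) (π ⁻¹ᵁ O i) (r i) (r (i + 1))
      (closureOf E.support.compl ((D i).comap π)) (closureOf E.support.compl ((D (i + 1)).comap π))
      (insert E {I | ∃ k, k ≠ i ∧ k ≠ i + 1 ∧ closureOf E.support.compl ((D k).comap π) = I}) := by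
    obtain ⟨B', _, φ', j', _, u', v', hO', hj', hmon', hleft', hright', hother'⟩ := hm.chart i hi
    have hle : j'.opensRange ≤ s.ker.support.compl := by
      rw [hO']
      exact fun y hy h ↦ hZO hi hic y h hy
    obtain ⟨l, hl, hlπ, hlr⟩ := exists_isOpenImmersion_lift π s.ker.support.compl j' hle
    have hlx (x) : l x ∉ E.support := by
      rw [hEπ, ← Scheme.Hom.comp_apply, hlπ]
      exact hle ⟨x, rfl⟩
    have hlS (I : Y.IdealSheafData) (g : B') (hg : I.comap j' = idealSheaf (Ideal.span {g})) :
        (closureOf E.support.compl (I.comap π)).comap l = idealSheaf (Ideal.span {g}) := by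
      refine closureOf_comap _ _ l 1 g (dvd_refl (1 ^ 0)) (fun x ↦ ?_) ?_
        (fun b ↦ by rw [one_mul]; exact id)
      · exact iff_of_true (hlx x) ((Ideal.ne_top_iff_one _).mp x.2.ne_top)
      · rw [← comap_comp, hlπ, hg, pow_zero, one_mul]
    refine ⟨B', inferInstance, φ', l, hl, u', v', hO' ▸ hlr, ?_, hmon', hlS _ _ hleft',
        hlS _ _ hright', ?_⟩
    · rw [← Category.assoc, hlπ, hj']
    · rintro _ (rfl | ⟨k, h1, h2, rfl⟩)
      · rw [comap_eq_top_iff]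
        exact hlx
      · rw [hlS (D k) 1 (by rw [hother' _ ⟨k, h1, h2, rfl⟩, Ideal.span_singleton_one,
          idealSheaf_top]), Ideal.span_singleton_one, idealSheaf_top]
  -- a point off the divisors without transform on the two new charts maps to the `c`-th chart
  have hmem (y : Y') (h : ∀ i, i ≠ c → i ≠ c + 1 →
      y ∉ (closureOf E.support.compl ((D i).comap π)).support) : π y ∈ j.opensRange := by
    rw [hO]
    refine hm.mem_chart c hc _ fun i h1 h2 hi ↦ h i h1 h2 (hSV i y (fun hy ↦ ?_) hi)
    obtain ⟨x, hx⟩ := hZj _ ((hEπ y).mp hy)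
    have := hother _ ⟨i, h1, h2, rfl⟩
    rw [comap_eq_top_iff] at this
    exact this x (hx ▸ hi)
  refine ⟨Y', π, E, fun i ↦ closureOf E.support.compl ((D i).comap π), k₁.opensRange,
    k₂.opensRange, inferInstance, .step π f s hs hm.iterated hbl, ?_, ?_, ?_, hold, ?_, hSV, ?_, ?_⟩
  · have h := @isIso_morphismRestrict_of_le _ _ π _ _ hZf hiso
    rw [morphismRestrict_comp]
    exact @IsIso.comp_isIso _ _ _ _ _ _ _ h _
  · refine ⟨_, inferInstance, (BlowupAlg.incl u v).comp φ, k₁, inferInstance, _, _, rfl, ?_,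
      hmon.blowup, hEk₁, (hS₁ _).1 hright, ?_⟩
    · rw [← Category.assoc, hk₁, Category.assoc, hj, ← Spec.map_comp, CommRingCat.ofHom_comp]
    · rintro _ ⟨i, hi, rfl⟩
      by_cases hic : i = c
      · exact (hS₁ i).2.1 (hic ▸ hleft)
      · exact (hS₁ i).2.2 (hother _ ⟨i, hic, hi, rfl⟩)
  · refine ⟨_, inferInstance, (BlowupAlg.incl v u).comp φ, k₂, inferInstance, _, _, rfl, ?_,
      add_comm (r (c + 1)) (r c) ▸ hmon.symm.blowup.symm, (hS₂ _).1 hleft, hEk₂, ?_⟩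
    · rw [← Category.assoc, hk₂, Category.assoc, hj, ← Spec.map_comp, CommRingCat.ofHom_comp]
    · rintro _ ⟨i, hi, rfl⟩
      by_cases hic : i = c + 1
      · exact (hS₂ i).2.1 (hic ▸ hright)
      · exact (hS₂ i).2.2 (hother _ ⟨i, hi, hic, rfl⟩)
  · intro y hy
    exact hcov y (hO ▸ hy)
  · intro y hy
    obtain h | ⟨x, rfl⟩ := hcov y (hmem y fun i _ h2 ↦ hy i h2)
    · exact h
    · refine hov₂ x fun hx ↦ hy c (by omega) ?_
      rw [← mem_support_comap, (hS₂ c).1 hleft, mem_support_idealSheaf,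
        Ideal.span_singleton_le_iff_mem]
      exact hx
  · intro y hy
    obtain ⟨x, rfl⟩ | h := hcov y (hmem y fun i h1 _ ↦ hy i h1)
    · refine hov₁ x fun hx ↦ hy (c + 1) (by omega) ?_
      rw [← mem_support_comap, (hS₁ (c + 1)).1 hright, mem_support_idealSheaf,
        Ideal.span_singleton_le_iff_mem]
      exact hx
    · exact h

/-- Blowing up the origin of a chart subdivides its cone. -/
theorem IsModel.blowup {f : Y ⟶ germ W} {n : ℕ} {r : ℕ → ℕ × ℕ} {D : ℕ → Y.IdealSheafData}
    {O : ℕ → Y.Opens} (hm : IsModel f n r D O) (c : ℕ) (hc : c ≤ n) :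
    ∃ (Y' : Scheme.{u}) (f' : Y' ⟶ germ W) (D' : ℕ → Y'.IdealSheafData) (O' : ℕ → Y'.Opens),
      IsModel f' (n + 1) (insertAt c (r c + r (c + 1)) r) D' O' := by
  obtain ⟨Y', π, E, S, O₁, O₂, hb⟩ := hm.exists_isChartBlowup c hc
  have hdet := hm.det c hc
  obtain ⟨D', hD'⟩ : ∃ D', D' = insertAt c E S := ⟨_, rfl⟩
  obtain ⟨O', hO'⟩ : ∃ O', O' = insertAt c O₁ (Function.update (fun i ↦ π ⁻¹ᵁ O i) c O₂) :=
    ⟨_, rfl⟩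
  have hDc {i} (h : i ≤ c) : D' i = S i := hD' ▸ insertAt_of_le _ _ h
  have hDc' {i} (h : c < i) : D' (i + 1) = S i := hD' ▸ insertAt_of_lt _ _ h
  have hDE : D' (c + 1) = E := hD' ▸ insertAt_self _ _ _
  have hO₁ : O' (c + 1) = O₁ := hO' ▸ insertAt_self _ _ _
  have hO₂ : O' c = O₂ := hO' ▸ (insertAt_of_le _ _ le_rfl).trans (Function.update_self _ _ _)
  have hOc {i} (h : i < c) : O' i = π ⁻¹ᵁ O i :=
    hO' ▸ (insertAt_of_le _ _ h.le).trans (Function.update_of_ne h.ne _ _)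
  have hOc' {i} (h : c < i) : O' (i + 1) = π ⁻¹ᵁ O i :=
    hO' ▸ (insertAt_of_lt _ _ h).trans (Function.update_of_ne h.ne' _ _)
  refine ⟨Y', π ≫ f, D', O', hb.proper, hb.iterated, hb.iso, ?_, ?_, ?_, ?_, ?_, ?_, ?_⟩
  · rw [insertAt_of_le _ _ (Nat.zero_le c), hm.ray_zero]
  · rw [insertAt_of_lt _ _ (by omega), hm.ray_last]
  · intro i hi
    obtain h | rfl | ⟨i, h, rfl⟩ := insertAt_index c i
    · rw [insertAt_of_le _ _ h]
      obtain h | rfl := h.lt_or_eq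
      · rw [insertAt_of_le _ _ h]
        exact hm.det i (by omega)
      · rw [insertAt_self, Prod.snd_add, Prod.fst_add]
        linear_combination hdet
    · rw [insertAt_self, insertAt_of_lt _ _ (by omega), Prod.snd_add, Prod.fst_add]
      linear_combination hdet
    · rw [insertAt_of_lt _ _ h, insertAt_of_lt _ _ (by omega)]
      exact hm.det i (by omega)
  · intro i h1 h2
    obtain h | rfl | ⟨i, h, rfl⟩ := insertAt_index c i
    · rw [insertAt_of_le _ _ h]
      exact hm.pos i h1 (by omega)
    · rw [insertAt_self, Prod.fst_add, Prod.snd_add]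
      constructor
      · intro h
        rw [(Nat.add_eq_zero_iff.mp h).1, zero_mul] at hdet
        omega
      · intro h
        rw [(Nat.add_eq_zero_iff.mp h).2, mul_zero] at hdet
        omega
    · rw [insertAt_of_lt _ _ h]
      exact hm.pos i (by omega) (by omega)
  · intro k hk
    obtain h | rfl | ⟨i, h, rfl⟩ := insertAt_index c k
    · obtain h | rfl := h.lt_or_eq
      · rw [insertAt_of_le _ _ h.le, insertAt_of_le _ _ (show k + 1 ≤ c from h), hOc h, hDc h.le,
          hDc h]
        refine (hb.chart_of_ne k (by omega) h.ne).mono ?_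
        rintro _ ⟨i, h1, h2, rfl⟩
        obtain hi | rfl | ⟨i, hi, rfl⟩ := insertAt_index c i
        · exact .inr ⟨i, h1, h2, (hDc hi).symm⟩
        · exact .inl hDE
        · exact .inr ⟨i, by omega, by omega, (hDc' hi).symm⟩
      · rw [insertAt_of_le _ _ le_rfl, insertAt_self, hO₂, hDc le_rfl, hDE]
        refine hb.chart₂.mono ?_
        rintro _ ⟨i, h1, h2, rfl⟩
        obtain hi | rfl | ⟨i, hi, rfl⟩ := insertAt_index k i
        · exact ⟨i, h1, (hDc hi).symm⟩
        · exact absurd rfl h2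
        · exact ⟨i, by omega, (hDc' hi).symm⟩
    · rw [insertAt_self, insertAt_of_lt _ _ (by omega), hO₁, hDE, hDc' (by omega)]
      refine hb.chart₁.mono ?_
      rintro _ ⟨i, h1, h2, rfl⟩
      obtain hi | rfl | ⟨i, hi, rfl⟩ := insertAt_index c i
      · exact ⟨i, by omega, (hDc hi).symm⟩
      · exact absurd rfl h1
      · exact ⟨i, by omega, (hDc' hi).symm⟩
    · rw [insertAt_of_lt _ _ h, insertAt_of_lt _ _ (by omega), hOc' h, hDc' h, hDc' (by omega)]
      refine (hb.chart_of_ne i (by omega) h.ne').mono ?_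
      rintro _ ⟨k, h1, h2, rfl⟩
      obtain hk | rfl | ⟨k, hk, rfl⟩ := insertAt_index c k
      · exact .inr ⟨k, by omega, by omega, (hDc hk).symm⟩
      · exact .inl hDE
      · exact .inr ⟨k, by omega, by omega, (hDc' hk).symm⟩
  · intro y
    obtain ⟨i, hi, hy⟩ := hm.cover (π y)
    obtain h | rfl | h := lt_trichotomy i c
    · exact ⟨i, by omega, by rwa [hOc h]⟩
    · obtain h | h := hb.cover y hy
      · exact ⟨i + 1, by omega, by rwa [hO₁]⟩
      · exact ⟨i, by omega, by rwa [hO₂]⟩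
    · exact ⟨i + 1, by omega, by rwa [hOc' h]⟩
  · intro k hk y hy
    have hS (i) (hi : i ≤ c) (h1 : i ≠ k) (h2 : i ≠ k + 1) : y ∉ (S i).support :=
      hDc hi ▸ hy i h1 h2
    have hS' (i) (hi : c < i) (h1 : i + 1 ≠ k) (h2 : i ≠ k) : y ∉ (S i).support :=
      hDc' hi ▸ hy (i + 1) h1 (by omega)
    obtain h | rfl | ⟨i, h, rfl⟩ := insertAt_index c k
    · obtain h | rfl := h.lt_or_eq
      · rw [hOc h]
        refine hm.mem_chart k (by omega) _ fun i h1 h2 hi ↦ ?_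
        have hi' := hb.mem_support i y (hDE ▸ hy (c + 1) (by omega) (by omega)) hi
        by_cases hic : i ≤ c
        · exact hS i hic h1 h2 hi'
        · exact hS' i (by omega) (by omega) h1 hi'
      · rw [hO₂]
        refine hb.mem_chart₂ y fun i hi ↦ ?_
        by_cases hik : i ≤ k
        · exact hS i hik hi (by omega)
        · exact hS' i (by omega) (by omega) hi
    · rw [hO₁]
      refine hb.mem_chart₁ y fun i hi ↦ ?_
      by_cases hik : i ≤ c
      · exact hS i hik (by omega) (by omega)
      · exact hS' i (by omega) (by omega) (by omega)
    · rw [hOc' h]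
      refine hm.mem_chart i (by omega) _ fun k h1 h2 hk ↦ ?_
      have hk' := hb.mem_support k y (hDE ▸ hy (c + 1) (by omega) (by omega)) hk
      by_cases hkc : k ≤ c
      · exact hS k hkc (by omega) (by omega) hk'
      · exact hS' k (by omega) (by omega) (by omega) hk'

end Model

/-! ### Toric modifications with a prescribed ray -/

section Rays

variable {W : Type u} [CommRing W] {Y : Scheme.{u}} {f : Y ⟶ germ W} {n : ℕ} {r : ℕ → ℕ × ℕ}
  {D : ℕ → Y.IdealSheafData} {O : ℕ → Y.Opens}

/-- The rays of a toric modification are ordered counterclockwise. -/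
lemma IsModel.det_pos (hm : IsModel f n r D O) {i j : ℕ} (hij : i < j) (hj : j ≤ n + 1) :
    (r i).2 * (r j).1 < (r i).1 * (r j).2 := by
  induction j, (show i + 1 ≤ j from hij) using Nat.le_induction with
  | base => rw [hm.det i (by omega)]; exact Nat.lt_succ_self _
  | succ j hij' ih =>
    have h1 := ih (by omega) (by omega)
    have h2 := hm.det j (by omega)
    have h3 : (r j).1 ≠ 0 := (hm.pos j (by omega) (by omega)).1
    have h4 : 0 < (r i).1 := Nat.pos_of_ne_zero fun h ↦ by simp [h] at h1
    refine Nat.lt_of_mul_lt_mul_left (a := (r j).1) ?_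
    calc (r j).1 * ((r i).2 * (r (j + 1)).1) = (r i).2 * (r j).1 * (r (j + 1)).1 := by ring
      _ ≤ (r i).1 * (r j).2 * (r (j + 1)).1 := Nat.mul_le_mul_right _ h1.le
      _ < (r i).1 * ((r j).2 * (r (j + 1)).1 + 1) := by
        rw [mul_add, mul_one, mul_assoc]; exact Nat.lt_add_of_pos_right h4
      _ = (r j).1 * ((r i).1 * (r (j + 1)).2) := by rw [← h2]; ring

/-- Every primitive ray in the interior of the quadrant occurs in a toric modification, all
of whose exceptional rays are bounded by it. The subdivision follows the subtractive Euclidean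
algorithm for the coordinates of the ray. -/
theorem exists_isModel_ray (W : Type u) [CommRing W] (w : ℕ × ℕ) (hw : Nat.Coprime w.1 w.2)
    (hw₁ : 0 < w.1) (hw₂ : 0 < w.2) :
    ∃ (Y : Scheme.{u}) (f : Y ⟶ germ W) (n : ℕ) (r : ℕ → ℕ × ℕ) (D : ℕ → Y.IdealSheafData)
      (O : ℕ → Y.Opens) (k : ℕ), IsModel f n r D O ∧ 1 ≤ k ∧ k ≤ n ∧ r k = w ∧
        ∀ i, 1 ≤ i → i ≤ n → r i ≤ w := by
  have key (s : ℕ) : ∀ (Y : Scheme.{u}) (f : Y ⟶ germ W) (n : ℕ) (r : ℕ → ℕ × ℕ)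
      (D : ℕ → Y.IdealSheafData) (O : ℕ → Y.Opens) (c a b : ℕ), IsModel f n r D O → c ≤ n →
      (∀ i, 1 ≤ i → i ≤ n → r i ≤ w) → a + b ≤ s → 0 < a → 0 < b →
      w = a • r c + b • r (c + 1) → 
      ∃ (Y : Scheme.{u}) (f : Y ⟶ germ W) (n : ℕ) (r : ℕ → ℕ × ℕ) (D : ℕ → Y.IdealSheafData)
        (O : ℕ → Y.Opens) (k : ℕ), IsModel f n r D O ∧ 1 ≤ k ∧ k ≤ n ∧ r k = w ∧
          ∀ i, 1 ≤ i → i ≤ n → r i ≤ w := by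
    induction s with
    | zero => intros; omega
    | succ s ih =>
      intro Y f n r D O c a b hm hc hle hs ha hb hwab
      obtain ⟨Y', f', D', O', hm'⟩ := hm.blowup c hc
      have hnew : r c + r (c + 1) ≤ w := by
        rw [hwab]
        exact add_le_add (le_smul_of_one_le_left zero_le ha)
          (le_smul_of_one_le_left zero_le hb)
      have hle' (i) (h1 : 1 ≤ i) (h2 : i ≤ n + 1) : insertAt c (r c + r (c + 1)) r i ≤ w := by
        obtain h | rfl | ⟨i, h, rfl⟩ := insertAt_index c i
        · rw [insertAt_of_le _ _ h]
          exact hle i h1 (by omega)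
        · rwa [insertAt_self]
        · rw [insertAt_of_lt _ _ h]
          exact hle i (by omega) (by omega)
      obtain hab | rfl | hab := lt_trichotomy a b
      · refine ih Y' f' (n + 1) _ D' O' (c + 1) a (b - a) hm' (by omega) hle' (by omega) ha
          (by omega) ?_
        rw [insertAt_self, insertAt_of_lt _ _ (by omega), hwab]
        obtain ⟨e, rfl⟩ := Nat.exists_eq_add_of_lt hab
        rw [show a + e + 1 - a = e + 1 by omega]
        module
      · -- `w` is a multiple of the new ray, and equal to it because it is primitive
        have ha1 : a = 1 := by
          rw [← Nat.dvd_one, ← hw, hwab]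
          exact Nat.dvd_gcd ⟨(r c).1 + (r (c + 1)).1, by simp; ring⟩
            ⟨(r c).2 + (r (c + 1)).2, by simp; ring⟩
        refine ⟨Y', f', n + 1, _, D', O', c + 1, hm', by omega, by omega, ?_, hle'⟩
        rw [insertAt_self, hwab, ha1, one_smul, one_smul]
      · refine ih Y' f' (n + 1) _ D' O' c (a - b) b hm' (by omega) hle' (by omega) (by omega) hb ?_
        rw [insertAt_self, insertAt_of_le _ _ le_rfl, hwab]
        obtain ⟨e, rfl⟩ := Nat.exists_eq_add_of_lt hab
        rw [show b + e + 1 - b = e + 1 by omega]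
        module
  obtain ⟨D, O, hm⟩ := exists_isModel W
  refine key (w.1 + w.2) _ _ _ _ D O 0 w.1 w.2 hm le_rfl (fun i h1 h2 ↦ by omega) le_rfl hw₁ hw₂ ?_
  ext <;> simp

end Rays

/-! ### Local coordinates over the base -/

section Coordinates

variable {W : Type u} [CommRing W] {Y : Scheme.{u}} {f : Y ⟶ germ W} {ι : Type*}

/-- Ideal sheaves coming from an affine scheme are multiplied by multiplying the ideals. -/
lemma comap_idealSheaf_prod {A : Type u} [CommRing A] (g : Y ⟶ Spec (CommRingCat.of A))
    (s : Finset ι) (I : ι → Ideal A) :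
    (idealSheaf (∏ i ∈ s, I i)).comap g = ∏ i ∈ s, (idealSheaf (I i)).comap g := by
  have (U : Y.affineOpens) : IsOpenImmersion (IsAffineOpen.fromSpec U.2) :=
    IsAffineOpen.isOpenImmersion_fromSpec U.2
  refine @ext_of_charts _ _ (fun U : Y.affineOpens ↦ (Γ(Y, U.1) : Type u)) _
    (fun U ↦ IsAffineOpen.fromSpec U.2) this (fun y ↦ ?_) _ _ fun U ↦ ?_
  · obtain ⟨U, hU, hy, -⟩ := exists_isAffineOpen_mem_and_subset (x := y) (U := ⊤) trivial
    refine ⟨⟨U, hU⟩, ?_⟩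
    exact (IsAffineOpen.opensRange_fromSpec hU).ge hy
  · obtain ⟨φ, hφ⟩ : ∃ φ : A →+* Γ(Y, U.1), IsAffineOpen.fromSpec U.2 ≫ g =
        Spec.map (CommRingCat.ofHom φ) :=
      ⟨(Spec.preimage (IsAffineOpen.fromSpec U.2 ≫ g)).hom, by simp⟩
    rw [comap_prod_of_isOpenImmersion]
    simp only [← comap_comp, hφ]
    refine (comap_idealSheaf φ _).trans ?_
    rw [← Ideal.mapHom_apply, map_prod, idealSheaf_prod]
    exact Finset.prod_congr rfl fun i _ ↦ (comap_idealSheaf φ _).symm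

/-- Near `y`, the closed subschemes `I i` are the coordinate axes, or empty, for a system of local
coordinates over `W`, and each coordinate axis occurs at most once: `S i` is the set of
the coordinates which vanish on `I i`. -/
def HasCoordinates (f : Y ⟶ germ W) (I : ι → Y.IdealSheafData) (y : Y) : Prop :=
  ∃ (U : Y.Opens) (V : Scheme.{u}) (j : U.toScheme ⟶ V) (q t : V ⟶ plane W)
    (S : ι → Finset (Fin 2)),
    y ∈ U ∧ IsPullback j (U.ι ≫ f) q (germToPlane W) ∧
    Etale t ∧ t ≫ planeStr W = q ≫ planeStr W ∧
    (∀ i, (I i).comap U.ι =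
      (idealSheaf (Ideal.span {∏ a ∈ S i, (MvPolynomial.X a : MvPolynomial (Fin 2) W)})).comap
        (j ≫ t)) ∧ (∀ i, (S i).card ≤ 1) ∧ Pairwise fun i i' ↦ Disjoint (S i) (S i')

lemma HasCoordinates.comp {ι' : Type*} {I : ι → Y.IdealSheafData} {y : Y}
    (h : HasCoordinates f I y) (e : ι' → ι) (he : Function.Injective e) :
    HasCoordinates f (I ∘ e) y := by
  obtain ⟨U, V, j, q, t, S, h1, h2, h3, h4, h5, h6, h7⟩ := h
  exact ⟨U, V, j, q, t, S ∘ e, h1, h2, h3, h4, fun i ↦ h5 _, fun i ↦ h6 _,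
    fun i i' h ↦ h7 (he.ne h)⟩

lemma isRelNCD_of_hasCoordinates [Fintype ι] {I : ι → Y.IdealSheafData}
    (h : ∀ y, HasCoordinates f I y) : IsRelNCD f (∏ i, I i) := by
  classical
  intro y
  obtain ⟨U, V, j, q, t, S, h1, h2, h3, h4, h5, h6, h7⟩ := h y
  refine ⟨U, V, j, q, t, Finset.univ.biUnion S, h1, h2, h3, h4, ?_⟩
  rw [comap_prod_of_isOpenImmersion, Finset.prod_biUnion fun i _ i' _ h ↦ h7 h,
    ← Ideal.prod_span_singleton, comap_idealSheaf_prod]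
  exact Finset.prod_congr rfl fun i _ ↦ h5 i

lemma smooth_planeStr : Smooth (planeStr W) := by
  refine (HasRingHomProperty.Spec_iff (P := @Smooth)).mpr ?_
  rw [CommRingCat.hom_ofHom, RingHom.smooth_algebraMap]
  exact ⟨inferInstance, inferInstance⟩

lemma isSmoothOver_of_hasCoordinates {I : ι → Y.IdealSheafData}
    (h : ∀ y, HasCoordinates f I y) : IsSmoothOver f := by
  intro y
  obtain ⟨U, V, j, q, t, S, h1, h2, h3, h4, -⟩ := h y
  have := smooth_planeStr (W := W)
  exact ⟨U, V, j, q, h1, h2, h4 ▸ inferInstance⟩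

/-- Smoothness over `W` may be checked on charts instead of open subschemes. -/
lemma isSmoothOver_of_isPullback (h : ∀ y, ∃ (U V : Scheme.{u}) (i : U ⟶ Y) (_ : IsOpenImmersion i)
    (j : U ⟶ V) (q : V ⟶ plane W), y ∈ i.opensRange ∧ IsPullback j (i ≫ f) q (germToPlane W) ∧
      Smooth (q ≫ planeStr W)) : IsSmoothOver f := by
  intro y
  obtain ⟨U, V, i, _, j, q, h1, h2, h3⟩ := h y
  refine ⟨i.opensRange, V, i.isoOpensRange.inv ≫ j, q, h1, ?_, h3⟩
  refine IsPullback.of_iso h2 i.isoOpensRange (.refl _) (.refl _) (.refl _) ?_ ?_ ?_ ?_ <;> simp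

/-- The axis on which the coordinate `a` vanishes. -/
def axis (W : Type u) [CommRing W] (a : Fin 2) : MvPolynomial (Fin 2) W →+* Polynomial W :=
  MvPolynomial.eval₂Hom Polynomial.C fun i ↦ if i = a then 0 else Polynomial.X

lemma axis_surjective (a : Fin 2) : Function.Surjective (axis W a) := by
  intro p
  refine ⟨p.eval₂ MvPolynomial.C (MvPolynomial.X (1 - a)), ?_⟩
  rw [Polynomial.hom_eval₂]
  have h1 : (axis W a).comp MvPolynomial.C = Polynomial.C := by ext; simp [axis]
  have h2 : axis W a (MvPolynomial.X (1 - a)) = Polynomial.X := by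
    fin_cases a <;> simp [axis]
  rw [h1, h2, Polynomial.eval₂_C_X]

lemma ker_axis (a : Fin 2) : RingHom.ker (axis W a) = Ideal.span {MvPolynomial.X a} := by
  refine le_antisymm (fun p hp ↦ ?_) ?_
  · have h : ((Ideal.Quotient.mk (Ideal.span {(MvPolynomial.X a : MvPolynomial (Fin 2) W)})).comp
        (Polynomial.eval₂RingHom MvPolynomial.C (MvPolynomial.X (1 - a)))).comp (axis W a) =
        Ideal.Quotient.mk _ := by
      refine MvPolynomial.ringHom_ext (by simp [axis]) fun i ↦ ?_
      obtain rfl | h := eq_or_ne i a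
      · simp [axis]
      · obtain rfl : i = 1 - a := by revert h; clear * -; revert i a; decide
        simp [axis, h]
    rw [← Ideal.Quotient.eq_zero_iff_mem, ← h, RingHom.comp_apply, RingHom.mem_ker.mp hp, map_zero]
  · rw [Ideal.span_singleton_le_iff_mem, RingHom.mem_ker]
    simp [axis]

lemma smooth_axis (a : Fin 2) :
    Smooth (Spec.map (CommRingCat.ofHom (axis W a)) ≫ planeStr W) := by
  rw [← Spec.map_comp, ← CommRingCat.ofHom_comp]
  refine (HasRingHomProperty.Spec_iff (P := @Smooth)).mpr ?_
  have h : (axis W a).comp (algebraMap W (MvPolynomial (Fin 2) W)) =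
      algebraMap W (Polynomial W) := by ext; simp [axis, MvPolynomial.algebraMap_eq]
  rw [CommRingCat.hom_ofHom, h, RingHom.smooth_algebraMap]
  have : Algebra.FinitePresentation W (Polynomial W) := inferInstance
  exact ⟨inferInstance, inferInstance⟩

/-- In local coordinates `t : V ⟶ 𝔸²_W`, a component is the base change of the preimage in `V` of
a coordinate axis, which is étale over this axis and hence smooth over `W`. -/
lemma isSmoothOver_subschemeι_of_hasCoordinates {I : ι → Y.IdealSheafData}
    (h : ∀ y, HasCoordinates f I y) (i : ι) : IsSmoothOver ((I i).subschemeι ≫ f) := by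
  refine isSmoothOver_of_isPullback fun z ↦ ?_
  obtain ⟨U, V, j, q, t, S, h1, h2, h3, h4, h5, h6, -⟩ := h ((I i).subschemeι z)
  have hz : (I i).subschemeι z ∈ (I i).support := by
    rw [← SetLike.mem_coe, ← range_subschemeι]
    exact ⟨z, rfl⟩
  obtain ⟨a, ha⟩ : ∃ a, S i = {a} := by
    refine Finset.card_eq_one.mp (le_antisymm (h6 i) (Finset.card_pos.mpr ?_))
    by_contra h0
    have h5' := h5 i
    rw [Finset.not_nonempty_iff_eq_empty.mp h0] at h5'
    simp only [Finset.prod_empty, Ideal.span_singleton_one, idealSheaf_top, comap_top] at h5'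
    exact (comap_eq_top_iff (I i) U.ι).mp h5' ⟨_, h1⟩ hz
  have h5' := h5 i
  rw [ha, Finset.prod_singleton, ← ker_axis, ← ker_specMap_eq] at h5'
  have := IsClosedImmersion.spec_of_surjective (CommRingCat.ofHom (axis W a)) (axis_surjective a)
  let L := Spec.map (CommRingCat.ofHom (axis W a))
  have hL : Smooth (L ≫ planeStr W) := smooth_axis a
  let i₁ := pullback.fst j (pullback.fst t L)
  have hi₁ : i₁.ker = (I i).comap U.ι := by
    rw [ker_fst_of_isClosedImmersion, ker_fst_of_isClosedImmersion, ← comap_comp, ← h5']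
  have hle : (I i).subschemeι.ker ≤ (i₁ ≫ U.ι).ker := by
    rw [ker_subschemeι, ← map_ker, le_map_iff_comap_le, hi₁]
  let i₂ := IsClosedImmersion.lift (I i).subschemeι (i₁ ≫ U.ι) hle
  have hi₂ : i₂ ≫ (I i).subschemeι = i₁ ≫ U.ι := IsClosedImmersion.lift_fac _ _ _
  have hp : IsPullback i₁ i₂ U.ι (I i).subschemeι :=
    isPullback_of_isClosedImmersion _ _ _ _ hi₂.symm (by rw [ker_subschemeι, hi₁])
  have : IsOpenImmersion i₂ := MorphismProperty.of_isPullback hp inferInstance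
  refine ⟨_, pullback t L, i₂, this, pullback.snd _ _, pullback.fst t L ≫ q, ?_, ?_, ?_⟩
  · obtain ⟨x, -, hx⟩ := Scheme.exists_preimage_of_isPullback hp ⟨_, h1⟩ z rfl
    exact ⟨x, hx⟩
  · rw [reassoc_of% hi₂]
    exact (IsPullback.of_hasPullback j (pullback.fst t L)).flip.paste_vert h2
  · rw [Category.assoc, ← h4, pullback.condition_assoc]
    infer_instance

end Coordinates

/-! ### Toric charts as base changes of the affine plane -/

section Algebra

/-- The universal property of a standard étale algebra, for ring homomorphisms. -/
lemma exists_ringHom_of_standardEtalePair {R S : Type*} [CommRing R] [CommRing S]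
    (P : StandardEtalePair R) (g : R →+* S) (x : S) (h : P.f.eval₂ g x = 0)
    (h' : IsUnit (P.g.eval₂ g x)) :
    ∃ ψ : P.Ring →+* S, ψ.comp (algebraMap R P.Ring) = g ∧ ψ P.X = x := by
  algebraize [g]
  have hx : P.HasMap x := ⟨h, h'⟩
  exact ⟨(P.lift x hx : P.Ring →+* S), RingHom.ext fun r ↦ (P.lift x hx).commutes r,
    P.lift_X x hx⟩

lemma ringHom_ext_of_standardEtalePair {R S : Type*} [CommRing R] [CommRing S]
    (P : StandardEtalePair R) {ψ ψ' : P.Ring →+* S}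
    (h : ψ.comp (algebraMap R P.Ring) = ψ'.comp (algebraMap R P.Ring)) (hX : ψ P.X = ψ' P.X) :
    ψ = ψ' := by
  algebraize [ψ.comp (algebraMap R P.Ring)]
  let a : P.Ring →ₐ[R] S := { ψ with commutes' := fun r ↦ rfl }
  let b : P.Ring →ₐ[R] S := { ψ' with commutes' := fun r ↦ (DFunLike.congr_fun h r).symm }
  have hab : a = b := P.hom_ext hX
  exact RingHom.ext fun z ↦ DFunLike.congr_fun hab z

end Algebra

section ToricCoordinates

variable {W : Type u} [CommRing W] {B : Type u} [CommRing B] {φ : MvPowerSeries (Fin 2) W →+* B}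
  {u v : B} {p q : ℕ × ℕ}

/-- The homomorphism from the polynomial ring to a `W[[x, y]]`-algebra which maps the variables to
`u` and `v`. -/
def toricCoord (φ : MvPowerSeries (Fin 2) W →+* B) (u v : B) : MvPolynomial (Fin 2) W →+* B :=
  MvPolynomial.eval₂Hom (φ.comp MvPowerSeries.C) ![u, v]

@[simp]
lemma toricCoord_C (w : W) : toricCoord φ u v (MvPolynomial.C w) = φ (MvPowerSeries.C w) := by
  simp [toricCoord]

@[simp]
lemma toricCoord_X_zero : toricCoord φ u v (MvPolynomial.X 0) = u := by
  simp [toricCoord]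

@[simp]
lemma toricCoord_X_one : toricCoord φ u v (MvPolynomial.X 1) = v := by
  simp [toricCoord]

variable (W) in
/-- The monomial transformation `x = u ^ p₁ * v ^ q₁`, `y = u ^ p₂ * v ^ q₂` of the polynomial ring.
-/
def toricMap (p q : ℕ × ℕ) : MvPolynomial (Fin 2) W →+* MvPolynomial (Fin 2) W :=
  MvPolynomial.eval₂Hom MvPolynomial.C
    ![MvPolynomial.X 0 ^ p.1 * MvPolynomial.X 1 ^ q.1,
      MvPolynomial.X 0 ^ p.2 * MvPolynomial.X 1 ^ q.2]

/-- A toric chart is the base change of a monomial transformation of the affine plane. -/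
lemma IsMonomialChart.isPullback (h : IsMonomialChart φ u v p q) :
    IsPullback (Spec.map (CommRingCat.ofHom (toricCoord φ u v)))
      (Spec.map (CommRingCat.ofHom φ)) (Spec.map (CommRingCat.ofHom (toricMap W p q)))
      (germToPlane W) := by
  have hw : (toricCoord φ u v).comp (toricMap W p q) =
      φ.comp (MvPolynomial.coeToMvPowerSeries.ringHom (σ := Fin 2) (R := W)) := by
    refine MvPolynomial.ringHom_ext (fun w ↦ ?_) fun i ↦ ?_
    · simp [toricMap]
    · fin_cases i
      · simp [toricMap, h.map_X_zero]
      · simp [toricMap, h.map_X_one]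
  refine isPullback_SpecMap_of_isPushout _ _ _ _ (IsPushout.flip ?_)
  have hs (s : PushoutCocone (CommRingCat.ofHom (MvPolynomial.coeToMvPowerSeries.ringHom
      (σ := Fin 2) (R := W))) (CommRingCat.ofHom (toricMap W p q))) :
      s.inl.hom.comp (MvPolynomial.coeToMvPowerSeries.ringHom (σ := Fin 2) (R := W)) =
        s.inr.hom.comp (toricMap W p q) := by
    exact congr_arg CommRingCat.Hom.hom s.condition
  have hs₀ (s : PushoutCocone (CommRingCat.ofHom (MvPolynomial.coeToMvPowerSeries.ringHom
      (σ := Fin 2) (R := W))) (CommRingCat.ofHom (toricMap W p q))) :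
      s.inl.hom (MvPowerSeries.X 0) =
        s.inr.hom (MvPolynomial.X 0) ^ p.1 * s.inr.hom (MvPolynomial.X 1) ^ q.1 := by
    simpa [toricMap] using DFunLike.congr_fun (hs s) (MvPolynomial.X 0)
  have hs₁ (s : PushoutCocone (CommRingCat.ofHom (MvPolynomial.coeToMvPowerSeries.ringHom
      (σ := Fin 2) (R := W))) (CommRingCat.ofHom (toricMap W p q))) :
      s.inl.hom (MvPowerSeries.X 1) =
        s.inr.hom (MvPolynomial.X 0) ^ p.2 * s.inr.hom (MvPolynomial.X 1) ^ q.2 := by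
    simpa [toricMap] using DFunLike.congr_fun (hs s) (MvPolynomial.X 1)
  have hcomp (s : PushoutCocone (CommRingCat.ofHom (MvPolynomial.coeToMvPowerSeries.ringHom
      (σ := Fin 2) (R := W))) (CommRingCat.ofHom (toricMap W p q))) (θ : B →+* s.pt)
      (h : θ.comp φ = s.inl.hom ∧ θ u = s.inr.hom (MvPolynomial.X 0) ∧
        θ v = s.inr.hom (MvPolynomial.X 1)) : θ.comp (toricCoord φ u v) = s.inr.hom := by
    refine MvPolynomial.ringHom_ext (fun w ↦ ?_) fun i ↦ ?_
    · have := DFunLike.congr_fun (hs s) (MvPolynomial.C w)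
      rw [← h.1] at this
      simpa [toricMap] using this
    · fin_cases i
      · simpa using h.2.1
      · simpa using h.2.2
  refine IsPushout.of_isColimit' ⟨by rw [← CommRingCat.ofHom_comp, ← CommRingCat.ofHom_comp, hw]⟩
    (PushoutCocone.IsColimit.mk _ (fun s ↦ ?_) (fun s ↦ ?_) (fun s ↦ ?_) (fun s m h1 h2 ↦ ?_))
  · exact CommRingCat.ofHom (h.existsUnique s.inl.hom (s.inr.hom (MvPolynomial.X 0))
      (s.inr.hom (MvPolynomial.X 1)) (hs₀ s) (hs₁ s)).choose
  · ext1
    exact (h.existsUnique _ _ _ (hs₀ s) (hs₁ s)).choose_spec.1.1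
  · ext1
    exact hcomp s _ (h.existsUnique _ _ _ (hs₀ s) (hs₁ s)).choose_spec.1
  · ext1
    refine (h.existsUnique _ _ _ (hs₀ s) (hs₁ s)).unique ⟨?_, ?_, ?_⟩
      (h.existsUnique _ _ _ (hs₀ s) (hs₁ s)).choose_spec.1
    · rw [← h1]; rfl
    · rw [← h2]; simp
    · rw [← h2]; simp

variable (W) in
/-- The map `(u, v) ↦ (u, 1 + v ^ d)` of the plane. -/
def powMap (d : ℕ) : MvPolynomial (Fin 2) W →+* MvPolynomial (Fin 2) W :=
  MvPolynomial.eval₂Hom MvPolynomial.C ![MvPolynomial.X 0, 1 + MvPolynomial.X 1 ^ d]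

@[simp]
lemma powMap_C (d : ℕ) (w : W) : powMap W d (MvPolynomial.C w) = MvPolynomial.C w := by
  simp [powMap]

@[simp]
lemma powMap_X_zero (d : ℕ) : powMap W d (MvPolynomial.X 0) = MvPolynomial.X 0 := by
  simp [powMap]

@[simp]
lemma powMap_X_one (d : ℕ) : powMap W d (MvPolynomial.X 1) = 1 + MvPolynomial.X 1 ^ d := by
  simp [powMap]

/-- The extension defined by `T ^ d + 1 = b`, in which `T` is inverted, is standard étale if `d` is
invertible. -/
def powPair {R : Type*} [CommRing R] {d : ℕ} (hd₀ : d ≠ 0) (hd : IsUnit (d : R)) (b : R) :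
    StandardEtalePair R where
  f := Polynomial.X ^ d + Polynomial.C (1 - b)
  monic_f := Polynomial.monic_X_pow_add_C _ hd₀
  g := Polynomial.X
  cond := by
    obtain ⟨e, he⟩ := hd.exists_left_inv
    refine ⟨Polynomial.C e, 0, d - 1, ?_⟩
    rw [Polynomial.derivative_add, Polynomial.derivative_C, Polynomial.derivative_X_pow]
    have : Polynomial.C e * Polynomial.C (d : R) = 1 := by
      rw [← map_mul, he, map_one]
    linear_combination Polynomial.X ^ (d - 1) * this

/-- The map `(u, v) ↦ (u, 1 + v ^ d)` of the plane is étale where `v` is invertible. -/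
lemma etale_powMap {d : ℕ} (hd₀ : d ≠ 0) (hd : IsUnit (d : W)) {S : Type u} [CommRing S]
    [Algebra (MvPolynomial (Fin 2) W) S]
    [IsLocalization.Away (MvPolynomial.X 1 : MvPolynomial (Fin 2) W) S] :
    ((algebraMap (MvPolynomial (Fin 2) W) S).comp (powMap W d)).Etale := by
  -- over the target, the source is given by the equation `T ^ d + 1 = v` with `T` invertible
  have hd' : IsUnit (d : MvPolynomial (Fin 2) W) := by
    simpa using hd.map (MvPolynomial.C (σ := Fin 2) (R := W))
  obtain ⟨P, hP⟩ : ∃ P : StandardEtalePair (MvPolynomial (Fin 2) W),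
    P = powPair hd₀ hd' (MvPolynomial.X 1) := ⟨_, rfl⟩
  have hf : P.f = Polynomial.X ^ d + Polynomial.C (1 - MvPolynomial.X 1) := by rw [hP]; rfl
  have hg : P.g = Polynomial.X := by rw [hP]; rfl
  clear hP
  obtain ⟨ψ, hψ, hψX⟩ := exists_ringHom_of_standardEtalePair P
    ((algebraMap (MvPolynomial (Fin 2) W) S).comp (powMap W d))
    (algebraMap (MvPolynomial (Fin 2) W) S (MvPolynomial.X 1)) (by simp [hf]) (by
      rw [hg, Polynomial.eval₂_X]
      exact IsLocalization.Away.algebraMap_isUnit (MvPolynomial.X 1 : MvPolynomial (Fin 2) W))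
  obtain ⟨β, hβC, hβ₀, hβ₁⟩ : ∃ β : MvPolynomial (Fin 2) W →+* P.Ring,
      (∀ w, β (MvPolynomial.C w) = algebraMap (MvPolynomial (Fin 2) W) P.Ring (MvPolynomial.C w)) ∧
      β (MvPolynomial.X 0) = algebraMap (MvPolynomial (Fin 2) W) P.Ring (MvPolynomial.X 0) ∧
      β (MvPolynomial.X 1) = P.X :=
    ⟨MvPolynomial.eval₂Hom ((algebraMap (MvPolynomial (Fin 2) W) P.Ring).comp MvPolynomial.C)
      ![algebraMap (MvPolynomial (Fin 2) W) P.Ring (MvPolynomial.X 0), P.X],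
      fun w ↦ MvPolynomial.eval₂Hom_C _ _ _, by rw [MvPolynomial.eval₂Hom_X']; rfl,
      by rw [MvPolynomial.eval₂Hom_X']; rfl⟩
  have hX : 1 + P.X ^ d = algebraMap (MvPolynomial (Fin 2) W) P.Ring (MvPolynomial.X 1) := by
    have := P.hasMap_X.1
    rw [hf, map_add, map_pow, Polynomial.aeval_X, Polynomial.aeval_C, map_sub, map_one] at this
    linear_combination this
  have hβθ : β.comp (powMap W d) = algebraMap _ P.Ring := by
    refine MvPolynomial.ringHom_ext (fun w ↦ ?_) (Fin.forall_fin_two.mpr ⟨?_, ?_⟩)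
    · rw [RingHom.comp_apply, powMap_C, hβC]
    · rw [RingHom.comp_apply, powMap_X_zero, hβ₀]
    · rw [RingHom.comp_apply, powMap_X_one, map_add, map_one, map_pow, hβ₁, hX]
  have hβu : IsUnit (β (MvPolynomial.X 1)) := by
    rw [hβ₁]
    simpa [hg] using P.hasMap_X.2
  obtain ⟨χ, hχ⟩ : ∃ χ : S →+* P.Ring, χ.comp (algebraMap _ S) = β :=
    ⟨_, IsLocalization.Away.lift_comp (MvPolynomial.X 1 : MvPolynomial (Fin 2) W) hβu⟩
  have hχ' (z) : χ (algebraMap (MvPolynomial (Fin 2) W) S z) = β z := DFunLike.congr_fun hχ z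
  have hψ' (z) : ψ (algebraMap _ P.Ring z) = algebraMap _ S (powMap W d z) :=
    DFunLike.congr_fun hψ z
  have h1 : χ.comp ψ = RingHom.id _ := by
    refine ringHom_ext_of_standardEtalePair P ?_ ?_
    · rw [RingHom.comp_assoc, hψ, ← RingHom.comp_assoc, hχ, hβθ]
      rfl
    · rw [RingHom.comp_apply, hψX, hχ', hβ₁]
      rfl
  have h2 : ψ.comp χ = RingHom.id _ := by
    refine IsLocalization.ringHom_ext
      (.powers (MvPolynomial.X 1 : MvPolynomial (Fin 2) W)) ?_
    refine MvPolynomial.ringHom_ext (fun w ↦ ?_) (Fin.forall_fin_two.mpr ⟨?_, ?_⟩)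
    · simp only [RingHom.comp_apply, RingHom.id_apply, hχ', hβC, hψ', powMap_C]
    · simp only [RingHom.comp_apply, RingHom.id_apply, hχ', hβ₀, hψ', powMap_X_zero]
    · simp only [RingHom.comp_apply, RingHom.id_apply, hχ', hβ₁, hψX]
  rw [← hψ]
  refine RingHom.Etale.respectsIso.1 (algebraMap _ P.Ring) (RingEquiv.ofRingHom ψ χ h2 h1) ?_
  exact RingHom.etale_algebraMap.mpr inferInstance

lemma etale_of_le_basicOpen {d : ℕ} (hd₀ : d ≠ 0) (hd : IsUnit (d : W))
    (V : (plane W).Opens) (hV : ∀ x ∈ V, MvPolynomial.X 1 ∉ x.asIdeal) :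
    Etale (V.ι ≫ Spec.map (CommRingCat.ofHom (powMap W d))) := by
  let S := Localization.Away (MvPolynomial.X 1 : MvPolynomial (Fin 2) W)
  let l : Spec (CommRingCat.of S) ⟶ plane W :=
    Spec.map (CommRingCat.ofHom (algebraMap (MvPolynomial (Fin 2) W) S))
  have hl : IsOpenImmersion l :=
    IsOpenImmersion.of_isLocalization (MvPolynomial.X 1 : MvPolynomial (Fin 2) W)
  have hr : Set.range l =
      (PrimeSpectrum.basicOpen (MvPolynomial.X 1 : MvPolynomial (Fin 2) W) :
        Set (PrimeSpectrum (MvPolynomial (Fin 2) W))) :=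
    PrimeSpectrum.localization_away_comap_range _ _
  have hVl : Set.range V.ι ⊆ Set.range l := by
    rw [Scheme.Opens.range_ι, hr]
    exact hV
  have hfac := IsOpenImmersion.lift_fac l V.ι hVl
  have : IsOpenImmersion (IsOpenImmersion.lift l V.ι hVl) := by
    have : IsOpenImmersion (IsOpenImmersion.lift l V.ι hVl ≫ l) := by rw [hfac]; infer_instance
    exact IsOpenImmersion.of_comp _ l
  have het : Etale (l ≫ Spec.map (CommRingCat.ofHom (powMap W d))) := by
    rw [← Spec.map_comp, ← CommRingCat.ofHom_comp]
    exact (HasRingHomProperty.Spec_iff (P := @Etale)).mpr (etale_powMap hd₀ hd)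
  rw [← hfac, Category.assoc]
  infer_instance

end ToricCoordinates

section Charts

variable {W : Type u} [CommRing W] {Y : Scheme.{u}} {f : Y ⟶ germ W} {ι : Type*}
  {B : Type u} [CommRing B] {φ : MvPowerSeries (Fin 2) W →+* B} {u v : B} {p q : ℕ × ℕ}

/-- Étale coordinates `t` on an open subscheme `V` of the plane of `u` and `v` are local coordinates
in a toric chart, since this chart is a base change of a map `𝔸²_W ⟶ 𝔸²_W`. -/
lemma hasCoordinates_of_isMonomialChart (h : IsMonomialChart φ u v p q)
    (j : Spec (CommRingCat.of B) ⟶ Y) [IsOpenImmersion j]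
    (hj : j ≫ f = Spec.map (CommRingCat.ofHom φ)) (I : ι → Y.IdealSheafData)
    (x : Spec (CommRingCat.of B)) (V : (plane W).Opens)
    (hx : Spec.map (CommRingCat.ofHom (toricCoord φ u v)) x ∈ V) (t : V.toScheme ⟶ plane W)
    [Etale t]
    (ht : t ≫ planeStr W = V.ι ≫ planeStr W) (a : ι → Ideal (MvPolynomial (Fin 2) W))
    (ha : ∀ i, (I i).comap j = idealSheaf ((a i).map (toricCoord φ u v)))
    (S : ι → Finset (Fin 2))
    (hS : ∀ i, (idealSheaf (a i)).comap V.ι = (idealSheaf (Ideal.span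
      {∏ b ∈ S i, (MvPolynomial.X b : MvPolynomial (Fin 2) W)})).comap t)
    (hS₁ : ∀ i, (S i).card ≤ 1) (hS₂ : Pairwise fun i i' ↦ Disjoint (S i) (S i')) :
    HasCoordinates f I (j x) := by
  let k := Spec.map (CommRingCat.ofHom (toricCoord φ u v))
  let i := (k ⁻¹ᵁ V).ι ≫ j
  have hi : i.isoOpensRange.inv ≫ i = i.opensRange.ι := by simp
  refine ⟨i.opensRange, V, i.isoOpensRange.inv ≫ k ∣_ V,
    V.ι ≫ Spec.map (CommRingCat.ofHom (toricMap W p q)), t, S, ?_, ?_, inferInstance, ?_, ?_,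
    hS₁, hS₂⟩
  · exact ⟨⟨x, hx⟩, rfl⟩
  · have h1 : IsPullback (k ∣_ V) ((k ⁻¹ᵁ V).ι ≫ j ≫ f)
        (V.ι ≫ Spec.map (CommRingCat.ofHom (toricMap W p q))) (germToPlane W) := by
      rw [hj]
      exact (isPullback_morphismRestrict k V).paste_vert h.isPullback
    refine IsPullback.of_iso h1 i.isoOpensRange (.refl _) (.refl _) (.refl _) ?_ ?_ ?_ ?_
    · simp
    · simp [i]
    · simp
    · simp
  · rw [ht, Category.assoc, ← Spec.map_comp, ← CommRingCat.ofHom_comp]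
    have h1 : (toricMap W p q).comp (algebraMap W (MvPolynomial (Fin 2) W)) = algebraMap W _ := by
      ext w
      simp [toricMap, MvPolynomial.algebraMap_eq]
    rw [h1]
  · intro l
    rw [← hi, comap_comp, comap_comp, ha, ← comap_idealSheaf, ← comap_comp _ (k ⁻¹ᵁ V).ι k,
      ← morphismRestrict_ι, comap_comp _ _ V.ι, hS, ← comap_comp, ← comap_comp, Category.assoc]

end Charts

section Model

variable {W : Type u} [CommRing W] {Y : Scheme.{u}} {f : Y ⟶ germ W} {n : ℕ} {r : ℕ → ℕ × ℕ}
  {D : ℕ → Y.IdealSheafData} {O : ℕ → Y.Opens} {κ : Type*}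

/-- The closed subscheme `C` of a toric modification is given by the polynomial `G c` in the
toric coordinates of the chart `O c`. -/
def HasEquation (f : Y ⟶ germ W) (n : ℕ) (r : ℕ → ℕ × ℕ) (O : ℕ → Y.Opens)
    (C : Y.IdealSheafData) (G : ℕ → MvPolynomial (Fin 2) W) : Prop :=
  ∀ c ≤ n, ∀ (B : Type u) [CommRing B] (φ : MvPowerSeries (Fin 2) W →+* B)
    (j : Spec (CommRingCat.of B) ⟶ Y) [IsOpenImmersion j] (u v : B), j.opensRange = O c →
      j ≫ f = Spec.map (CommRingCat.ofHom φ) → IsMonomialChart φ u v (r c) (r (c + 1)) →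
      C.comap j = idealSheaf (Ideal.span {toricCoord φ u v (G c)})

/-- The divisors of a toric modification and a curve which is transversal to one of them have
normal crossings. The curve may be given by its components. -/
lemma IsModel.hasCoordinates [Fintype κ] (hm : IsModel f n r D O) {C : κ → Y.IdealSheafData}
    {G : κ → ℕ → MvPolynomial (Fin 2) W} (hC : ∀ l, HasEquation f n r O (C l) (G l))
    {k : ℕ} (hk : k ≤ n) (hCk : ∀ l, ∀ y ∈ (C l).support, y ∈ O k) {d : ℕ} (hd₀ : d ≠ 0)
    (hd : IsUnit (d : W)) (hG : ∏ l, G l k = 1 + MvPolynomial.X 1 ^ d)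
    (hG' : Pairwise fun l l' ↦ IsCoprime (G l k) (G l' k)) (y : Y) :
    HasCoordinates f (Sum.elim C D) y := by
  classical
  have hideal (c : ℕ) (B : Type u) [CommRing B] (φ : MvPowerSeries (Fin 2) W →+* B)
      (j : Spec (CommRingCat.of B) ⟶ Y) [IsOpenImmersion j] (u v : B)
      (g : κ → MvPolynomial (Fin 2) W)
      (hCj : ∀ l, (C l).comap j = idealSheaf (Ideal.span {toricCoord φ u v (g l)}))
      (hu : (D c).comap j = idealSheaf (Ideal.span {u}))
      (hv : (D (c + 1)).comap j = idealSheaf (Ideal.span {v}))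
      (hR : ∀ I ∈ {I | ∃ i, i ≠ c ∧ i ≠ c + 1 ∧ D i = I}, I.comap j = ⊤) (i : κ ⊕ ℕ) :
      (Sum.elim C D i).comap j = idealSheaf ((Sum.elim (fun l ↦ Ideal.span {g l}) (fun i ↦
        if i = c then Ideal.span {MvPolynomial.X 0} else
        if i = c + 1 then Ideal.span {MvPolynomial.X 1} else ⊤) i).map (toricCoord φ u v)) := by
    obtain l | i := i
    · simp [hCj, Ideal.map_span]
    · simp only [Sum.elim_inr]
      split_ifs with h1 h2
      · simp [h1, hu, Ideal.map_span]
      · simp [h2, hv, Ideal.map_span]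
      · rw [hR _ ⟨i, h1, h2, rfl⟩, Ideal.map_top, idealSheaf_top]
  by_cases hy : ∃ l, y ∈ (C l).support
  · obtain ⟨l, hl⟩ := hy
    obtain ⟨B, _, φ, j, _, u, v, hjO, hjf, h, hu, hv, hR⟩ := hm.chart k hk
    have hyj : y ∈ j.opensRange := hjO ▸ hCk l y hl
    obtain ⟨x, rfl⟩ := hyj
    have hCj (l) := hC l k hk B φ j u v hjO hjf h
    have hlx : toricCoord φ u v (G l k) ∈ x.asIdeal := by
      have := (mem_support_comap _ j x).mpr hl
      rw [hCj, mem_support_idealSheaf, Ideal.span_singleton_le_iff_mem] at this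
      exact this
    let k' := Spec.map (CommRingCat.ofHom (toricCoord φ u v))
    have hvx : v ∉ x.asIdeal := by
      intro hv
      refine x.2.ne_top ((Ideal.eq_top_iff_one _).mpr ?_)
      have h1 : 1 + v ^ d ∈ x.asIdeal := by
        have := congr_arg (toricCoord φ u v) hG
        simp only [map_add, map_one, map_pow, toricCoord_X_one] at this
        rw [← this, map_prod]
        exact Ideal.mem_of_dvd _ (Finset.dvd_prod_of_mem _ (Finset.mem_univ l)) hlx
      simpa using Ideal.sub_mem _ h1 (Ideal.pow_mem_of_mem _ hv _ (Nat.pos_of_ne_zero hd₀))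
    have hl' (l') (hll' : l' ≠ l) : toricCoord φ u v (G l' k) ∉ x.asIdeal := by
      intro h
      refine x.2.ne_top ((Ideal.eq_top_iff_one _).mpr ?_)
      obtain ⟨a, b, hab⟩ := (hG' hll').map (toricCoord φ u v)
      rw [← hab]
      exact Ideal.add_mem _ (Ideal.mul_mem_left _ _ h) (Ideal.mul_mem_left _ _ hlx)
    let V : (plane W).Opens := PrimeSpectrum.basicOpen
      (MvPolynomial.X 1 * ∏ l' ∈ Finset.univ.erase l, G l' k)
    have hV (z) (hz : z ∈ V) : MvPolynomial.X 1 ∉ z.asIdeal ∧ ∀ l', l' ≠ l → G l' k ∉ z.asIdeal :=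
      ⟨fun h ↦ hz (Ideal.mul_mem_right _ _ h), fun l' hl' h ↦ hz (Ideal.mul_mem_left _ _
        (Ideal.mem_of_dvd _ (Finset.dvd_prod_of_mem _ (by simpa using hl')) h))⟩
    have htop (a : MvPolynomial (Fin 2) W) (ha : ∀ z ∈ V, a ∉ z.asIdeal) :
        (idealSheaf (Ideal.span {a})).comap V.ι = ⊤ := by
      rw [comap_eq_top_iff]
      rintro ⟨z, hz⟩ h
      refine ha z hz ?_
      rwa [mem_support_idealSheaf, Ideal.span_singleton_le_iff_mem] at h
    have : Etale (V.ι ≫ Spec.map (CommRingCat.ofHom (powMap W d))) :=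
      etale_of_le_basicOpen hd₀ hd V fun z hz ↦ (hV z hz).1
    refine hasCoordinates_of_isMonomialChart h j hjf _ x V ?_
      (V.ι ≫ Spec.map (CommRingCat.ofHom (powMap W d))) ?_
      (Sum.elim (fun l ↦ Ideal.span {G l k}) fun i ↦
        if i = k then Ideal.span {MvPolynomial.X 0} else
        if i = k + 1 then Ideal.span {MvPolynomial.X 1} else ⊤) ?_
      (Sum.elim (fun l' ↦ if l' = l then {1} else ∅) fun i ↦ if i = k then {0} else ∅) ?_ ?_ ?_
    · change toricCoord φ u v _ ∉ x.asIdeal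
      rw [map_mul, map_prod, toricCoord_X_one]
      intro h
      obtain h | h := x.2.mem_or_mem h
      · exact hvx h
      · obtain ⟨l', hl'', h⟩ := (Ideal.IsPrime.prod_mem_iff (hp := x.2)).mp h
        exact hl' l' (Finset.ne_of_mem_erase hl'') h
    · rw [Category.assoc, ← Spec.map_comp, ← CommRingCat.ofHom_comp]
      have h1 : (powMap W d).comp (algebraMap W (MvPolynomial (Fin 2) W)) = algebraMap W _ := by
        ext w
        simp [MvPolynomial.algebraMap_eq]
      rw [h1]
    · exact hideal k B φ j u v _ hCj hu hv hR
    · rintro (l' | i)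
      · simp only [Sum.elim_inl]
        split_ifs with h1
        · subst h1
          rw [Finset.prod_singleton, comap_comp, comap_idealSheaf, Ideal.map_span,
            Set.image_singleton, show powMap W d (MvPolynomial.X 1) = ∏ l, G l k by simp [hG],
            ← Ideal.prod_span_singleton, comap_idealSheaf_prod]
          have h2 (l'') (h : l'' ≠ l') := htop (G l'' k) fun z hz ↦ (hV z hz).2 l'' h
          exact (Finset.prod_eq_single l' (fun l'' _ h ↦ h2 l'' h)
            fun h ↦ absurd (Finset.mem_univ _) h).symm
        · rw [htop _ fun z hz ↦ (hV z hz).2 l' h1]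
          simp
      · simp only [Sum.elim_inr]
        split_ifs with h1 h2
        · rw [Finset.prod_singleton, comap_comp, comap_idealSheaf, Ideal.map_span,
            Set.image_singleton, show powMap W d (MvPolynomial.X 0) = MvPolynomial.X 0 by simp]
        · rw [htop _ fun z hz ↦ (hV z hz).1]
          simp
        · simp
    · (rintro (l | i) <;> simp); all_goals split_ifs <;> simp
    · (rintro (l | i) (l' | i') h <;> simp); all_goals split_ifs <;> simp <;> lia
  · push Not at hy
    obtain ⟨c, hc, hyc⟩ := hm.cover y
    obtain ⟨B, _, φ, j, _, u, v, hjO, hjf, h, hu, hv, hR⟩ := hm.chart c hc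
    rw [← hjO] at hyc
    obtain ⟨x, rfl⟩ := hyc
    have hCj (l) := hC l c hc B φ j u v hjO hjf h
    let V : (plane W).Opens := PrimeSpectrum.basicOpen (∏ l, G l c)
    refine hasCoordinates_of_isMonomialChart h j hjf _ x V ?_ V.ι rfl
      (Sum.elim (fun l ↦ Ideal.span {G l c}) fun i ↦
        if i = c then Ideal.span {MvPolynomial.X 0} else
        if i = c + 1 then Ideal.span {MvPolynomial.X 1} else ⊤) ?_
      (Sum.elim (fun l ↦ ∅) fun i ↦ if i = c then {0} else if i = c + 1 then {1} else ∅) ?_ ?_ ?_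
    · change toricCoord φ u v _ ∉ x.asIdeal
      rw [map_prod]
      intro h
      obtain ⟨l, -, h⟩ := (Ideal.IsPrime.prod_mem_iff (hp := x.2)).mp h
      refine hy l ((mem_support_comap _ j x).mp ?_)
      rwa [hCj, mem_support_idealSheaf, Ideal.span_singleton_le_iff_mem]
    · exact hideal c B φ j u v _ hCj hu hv hR
    · rintro (l | i)
      · simp only [Sum.elim_inl, Finset.prod_empty, Ideal.span_singleton_one, idealSheaf_top,
          comap_top]
        rw [comap_eq_top_iff]
        rintro ⟨z, hz⟩ h
        refine hz (Ideal.mem_of_dvd _ (Finset.dvd_prod_of_mem _ (Finset.mem_univ l)) ?_)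
        rwa [mem_support_idealSheaf, Ideal.span_singleton_le_iff_mem] at h
      · simp only [Sum.elim_inr]
        split_ifs <;> simp
    · (rintro (l | i) <;> simp); all_goals split_ifs <;> simp
    · (rintro (l | i) (l' | i') h <;> simp); all_goals split_ifs <;> simp <;> lia

end Model

/-! ### Roots of the cyclotomic polynomial -/

section Cyclotomic

variable {W : Type u} [CommRing W]

/-- The powers of a root of the `d`-th cyclotomic polynomial are all the `d`-th roots of unity.
Since `ℤ[X]/Φ_d` is a domain of characteristic zero and maps to `W`, the factorization holds in any
commutative ring. -/
lemma pow_sub_pow_eq_prod_of_isRoot_cyclotomic {d : ℕ} (hd : 0 < d) {ζ : W}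
    (hζ : (Polynomial.cyclotomic d W).IsRoot ζ) (s t : W) :
    s ^ d - t ^ d = ∏ l : Fin d, (s - ζ ^ (l : ℕ) * t) := by
  classical
  let P := Polynomial.cyclotomic d ℤ
  have hP : Prime P := (Polynomial.cyclotomic.irreducible hd).prime
  have : IsDomain (AdjoinRoot P) := AdjoinRoot.isDomain_of_prime hP
  have : NeZero (d : AdjoinRoot P) := by
    refine ⟨fun h ↦ ?_⟩
    have h1 : AdjoinRoot.mk P (Polynomial.C (d : ℤ)) = 0 := by simpa using h
    refine Polynomial.Monic.not_dvd_of_natDegree_lt (Polynomial.cyclotomic.monic d ℤ) ?_ ?_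
      (AdjoinRoot.mk_eq_zero.mp h1)
    · simpa using hd.ne'
    · rw [Polynomial.natDegree_C, Polynomial.natDegree_cyclotomic]
      exact Nat.totient_pos.mpr hd
  have hξ : IsPrimitiveRoot (AdjoinRoot.root P) d := by
    refine Polynomial.isRoot_cyclotomic_iff.mp ?_
    have := AdjoinRoot.isRoot_root P
    rwa [Polynomial.map_cyclotomic] at this
  have hξ' : IsPrimitiveRoot (MvPolynomial.C (σ := Fin 2) (AdjoinRoot.root P)) d :=
    hξ.map_of_injective (MvPolynomial.C_injective _ _)
  have h := hξ'.pow_sub_pow_eq_prod_sub_mul (MvPolynomial.X 0) (MvPolynomial.X 1) hd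
  have himg : Polynomial.nthRootsFinset d (1 : MvPolynomial (Fin 2) (AdjoinRoot P)) =
      Finset.univ.image fun l : Fin d ↦ MvPolynomial.C (AdjoinRoot.root P) ^ (l : ℕ) := by
    refine (Finset.eq_of_subset_of_card_le ?_ ?_).symm
    · intro z hz
      obtain ⟨l, -, rfl⟩ := Finset.mem_image.mp hz
      rw [Polynomial.mem_nthRootsFinset hd, ← pow_mul, mul_comm, pow_mul, hξ'.pow_eq_one, one_pow]
    · rw [hξ'.card_nthRootsFinset, Finset.card_image_of_injective, Finset.card_univ,
        Fintype.card_fin]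
      exact fun l l' h ↦ Fin.ext (hξ'.pow_inj l.2 l'.2 h)
  rw [himg, Finset.prod_image fun l _ l' _ h ↦ Fin.ext (hξ'.pow_inj l.2 l'.2 h)] at h
  have hζ' : P.eval₂ (Int.castRingHom W) ζ = 0 := by
    rw [← Polynomial.eval_map, Polynomial.map_cyclotomic]
    exact hζ
  have := congr_arg (MvPolynomial.eval₂Hom (AdjoinRoot.lift (Int.castRingHom W) ζ hζ') ![s, t]) h
  simpa [map_prod] using this

/-- The derivative of `s ^ d - c` at a root `a i` is a unit, and it is the product of
the differences of `a i` with the other roots. -/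
lemma isUnit_sub_of_prod_eq {ι : Type*} [Fintype ι] {d : ℕ} (hd₀ : d ≠ 0) (hd : IsUnit (d : W))
    (a : ι → W) (c : W) (ha : ∀ i, a i ^ d = c) (hc : IsUnit c)
    (h : ∀ s : Polynomial W, s ^ d - Polynomial.C c = ∏ i, (s - Polynomial.C (a i))) {i j : ι}
    (hij : i ≠ j) : IsUnit (a i - a j) := by
  classical
  have h1 := h Polynomial.X
  rw [← Finset.mul_prod_erase _ _ (Finset.mem_univ i)] at h1
  have h2 := congr_arg (fun p ↦ (Polynomial.derivative p).eval (a i)) h1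
  simp only [Polynomial.derivative_sub, Polynomial.derivative_X_pow, Polynomial.derivative_C,
    Polynomial.derivative_mul, Polynomial.derivative_X, Polynomial.eval_add, Polynomial.eval_mul,
    Polynomial.eval_sub, Polynomial.eval_X, Polynomial.eval_C, sub_self, zero_mul, add_zero,
    one_mul, Polynomial.eval_pow, sub_zero,
    Polynomial.eval_prod] at h2
  have h3 : IsUnit (a i) := (isUnit_pow_iff hd₀).mp (ha i ▸ hc)
  refine isUnit_of_dvd_unit (Finset.dvd_prod_of_mem (fun j ↦ a i - a j)
    (Finset.mem_erase.mpr ⟨hij.symm, Finset.mem_univ j⟩)) ?_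
  rw [← h2]
  exact hd.mul (h3.pow _)

end Cyclotomic

/-! ### Binomials in the power series ring -/

section PowerSeries

variable {W : Type u} [CommRing W]

lemma RegPair.pow_left {B : Type*} [CommRing B] {u v : B} (h : RegPair u v) (n : ℕ) {b : B}
    (hb : v ∣ u ^ n * b) : v ∣ b := by
  induction n generalizing b with
  | zero => simpa using hb
  | succ n ih => exact h.left_mod _ (ih (by rwa [← mul_assoc, ← pow_succ]))

/-- Modulo `y`, the power series `x ^ N + y ^ M` is `x ^ N`, so that an element it annihilates is
divisible by all powers of `y`. -/
lemma X_pow_add_X_pow_mem_nonZeroDivisors (N : ℕ) {M : ℕ} (hM : 0 < M) :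
    (MvPowerSeries.X 0 ^ N + MvPowerSeries.X 1 ^ M : MvPowerSeries (Fin 2) W) ∈
      nonZeroDivisors (MvPowerSeries (Fin 2) W) := by
  rw [mem_nonZeroDivisors_iff_right]
  intro b hb
  have key (i : ℕ) : MvPowerSeries.X 1 ^ i ∣ b := by
    induction i with
    | zero => simp
    | succ i ih =>
      obtain ⟨c, rfl⟩ := ih
      have h1 : (MvPowerSeries.X 0 ^ N + MvPowerSeries.X 1 ^ M) * c = 0 := by
        have (i : ℕ) (z : MvPowerSeries (Fin 2) W) (h : MvPowerSeries.X 1 ^ i * z = 0) :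
            z = 0 := by
          induction i with
          | zero => simpa using h
          | succ i ih => exact ih (regPair_X.right _ (by rw [← h]; ring))
        exact this i _ (by linear_combination hb)
      rw [pow_succ]
      refine mul_dvd_mul_left _ (regPair_X.pow_left N ⟨-(MvPowerSeries.X 1 ^ (M - 1) * c), ?_⟩)
      obtain ⟨M, rfl⟩ := Nat.exists_eq_add_of_lt hM
      rw [show 0 + M + 1 - 1 = M by lia]
      linear_combination h1
  ext e
  have := MvPowerSeries.X_pow_dvd_iff.mp (key (e 1 + 1)) e (Nat.lt_succ_self _)
  rw [this, map_zero]

/-- The monomial `x ^ i * y ^ j`, as an exponent. -/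
def expt (i j : ℕ) : Fin 2 →₀ ℕ := Finsupp.single 0 i + Finsupp.single 1 j

@[simp] lemma expt_zero (i j : ℕ) : expt i j 0 = i := by simp [expt]
@[simp] lemma expt_one (i j : ℕ) : expt i j 1 = j := by simp [expt]

lemma eq_expt (e : Fin 2 →₀ ℕ) : e = expt (e 0) (e 1) := by
  ext i
  fin_cases i <;> simp

lemma hasSubst_monomials {a b : ℕ} (ha : a ≠ 0) (hb : b ≠ 0) (α β : W) :
    MvPowerSeries.HasSubst ![(PowerSeries.C α * PowerSeries.X ^ a : PowerSeries W),
      PowerSeries.C β * PowerSeries.X ^ b] := by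
  refine MvPowerSeries.hasSubst_of_constantCoeff_zero
    (Fin.forall_fin_two.mpr ⟨?_, ?_⟩)
  · change PowerSeries.constantCoeff (PowerSeries.C α * PowerSeries.X ^ a) = 0
    simp [ha]
  · change PowerSeries.constantCoeff (PowerSeries.C β * PowerSeries.X ^ b) = 0
    simp [hb]

/-- The kernel of the parametrization `x = α * τ ^ a`, `y = β * τ ^ b` of a cusp is generated by
its equation. In the quotient `q` of `f` by the equation, the coefficient at `x ^ i * y ^ j` is a
sum over the monomials which have the same weight as `x ^ (i + b) * y ^ j`. -/
lemma dvd_of_subst_eq_zero {a b : ℕ} (ha : a ≠ 0) (hb : b ≠ 0) (hab : Nat.Coprime a b) {α β η : W}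
    (hα : IsUnit α) (hβ : IsUnit β) (h : α ^ b = η * β ^ a) (f : MvPowerSeries (Fin 2) W)
    (hf : MvPowerSeries.subst ![(PowerSeries.C α * PowerSeries.X ^ a : PowerSeries W),
      PowerSeries.C β * PowerSeries.X ^ b] f = 0) :
    MvPowerSeries.X 0 ^ b - MvPowerSeries.C η * MvPowerSeries.X 1 ^ a ∣ f := by
  let s (i j : ℕ) : W := ∑ t ∈ Finset.range (j / a + 1),
    η ^ t * MvPowerSeries.coeff (expt (i + t * b) (j - t * a)) f
  have hs (i j) : s i j = MvPowerSeries.coeff (expt i j) f +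
      if a ≤ j then η * s (i + b) (j - a) else 0 := by
    simp only [s]
    rw [Finset.sum_range_succ']
    simp only [zero_mul, add_zero, pow_zero, one_mul, tsub_zero]
    rw [add_comm]
    congr 1
    split_ifs with h1
    · rw [Nat.div_eq_sub_div (Nat.pos_of_ne_zero ha) h1, Finset.mul_sum]
      refine Finset.sum_congr rfl fun t _ ↦ ?_
      rw [pow_succ', mul_assoc, show (t + 1) * b = b + t * b by ring,
        show (t + 1) * a = a + t * a by ring, ← add_assoc, Nat.sub_add_eq]
    · rw [Nat.div_eq_of_lt (not_le.mp h1), Finset.sum_range_zero]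
  -- for `i < b` all monomials of the weight of `x ^ i * y ^ j` contribute to `s i j`, which is
  -- therefore, up to a unit, a coefficient of the image of `f`
  have hs₀ (i j) (hi : i < b) : s i j = 0 := by
    refine (((hα.pow i).mul (hβ.pow j)).mul_right_eq_zero).mp ?_
    rw [← map_zero (PowerSeries.coeff (a * i + b * j)), ← hf, PowerSeries.coeff,
      MvPowerSeries.coeff_subst (hasSubst_monomials ha hb α β)]
    have hcoeff (e : Fin 2 →₀ ℕ) : MvPowerSeries.coeff (Finsupp.single () (a * i + b * j))
        (e.prod fun l n ↦ (![(PowerSeries.C α * PowerSeries.X ^ a : PowerSeries W),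
          PowerSeries.C β * PowerSeries.X ^ b] l) ^ n) =
        if a * i + b * j = a * e 0 + b * e 1 then α ^ e 0 * β ^ e 1 else 0 := by
      rw [← PowerSeries.coeff_C_mul_X_pow, Finsupp.prod_fintype _ _ (fun _ ↦ pow_zero _),
        Fin.prod_univ_two]
      change PowerSeries.coeff (a * i + b * j) _ = _
      congr 1
      simp only [Matrix.cons_val_zero, Matrix.cons_val_one, map_mul, map_pow]
      ring
    simp only [hcoeff]
    have hinj (t₁ t₂ : ℕ) (h : expt (i + t₁ * b) (j - t₁ * a) = expt (i + t₂ * b) (j - t₂ * a)) :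
        t₁ = t₂ := by
      have := DFunLike.congr_fun h 0
      simpa [hb] using this
    rw [finsum_eq_sum_of_support_subset (s := (Finset.range (j / a + 1)).image
      fun t ↦ expt (i + t * b) (j - t * a)), Finset.sum_image fun t₁ _ t₂ _ h ↦ hinj t₁ t₂ h,
      Finset.mul_sum]
    · refine Finset.sum_congr rfl fun t ht ↦ ?_
      have ht' : t * a ≤ j :=
        (Nat.le_div_iff_mul_le (Nat.pos_of_ne_zero ha)).mp (Nat.lt_succ_iff.mp (by simpa using ht))
      obtain ⟨j', rfl⟩ := Nat.exists_eq_add_of_le ht'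
      rw [if_pos, expt_zero, expt_one, smul_eq_mul, Nat.add_sub_cancel_left]
      · have : α ^ (t * b) = η ^ t * β ^ (t * a) := by
          rw [mul_comm t b, pow_mul, h, mul_pow, ← pow_mul, mul_comm a]
        rw [pow_add, pow_add, this]
        ring
      · rw [expt_zero, expt_one, Nat.add_sub_cancel_left]
        ring
    · intro e he
      have he' : a * i + b * j = a * e 0 + b * e 1 := by
        by_contra h0
        exact he (by simp [h0])
      have hie : i ≤ e 0 := by
        by_contra h0
        obtain ⟨k, hk⟩ := Nat.exists_eq_add_of_lt (not_le.mp h0)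
        have h1 : b ∣ a * (k + 1) := by
          rw [← Nat.dvd_add_left (Dvd.intro j rfl : b ∣ b * j)]
          refine ⟨e 1, Nat.add_left_cancel (n := a * e 0) ?_⟩
          rw [← he', hk]
          ring
        have h2 := Nat.le_of_dvd k.succ_pos (hab.symm.dvd_of_dvd_mul_left h1)
        lia
      obtain ⟨k, hk⟩ := Nat.exists_eq_add_of_le hie
      have h1 : a * k + b * e 1 = b * j := by
        refine Nat.add_left_cancel (n := a * i) ?_
        rw [he', hk]
        ring
      obtain ⟨t, rfl⟩ : b ∣ k := hab.symm.dvd_of_dvd_mul_left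
        ((Nat.dvd_add_left (Dvd.intro _ rfl)).mp (h1 ▸ Dvd.intro j rfl))
      have h2 : t * a + e 1 = j := by
        refine Nat.eq_of_mul_eq_mul_left (Nat.pos_of_ne_zero hb) ?_
        rw [← h1]
        ring
      refine Finset.mem_coe.mpr (Finset.mem_image.mpr ⟨t, ?_, ?_⟩)
      · rw [Finset.mem_range, Nat.lt_succ_iff, Nat.le_div_iff_mul_le (Nat.pos_of_ne_zero ha)]
        lia
      · rw [eq_expt e, hk, ← h2, Nat.add_sub_cancel_left, mul_comm b t]
  let q : MvPowerSeries (Fin 2) W := fun e ↦ s (e 0 + b) (e 1)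
  have hq (e) : MvPowerSeries.coeff e q = s (e 0 + b) (e 1) := rfl
  refine ⟨q, ?_⟩
  ext e
  rw [sub_mul, map_sub, mul_assoc, MvPowerSeries.coeff_C_mul, MvPowerSeries.X_pow_eq,
    MvPowerSeries.X_pow_eq, MvPowerSeries.coeff_monomial_mul, MvPowerSeries.coeff_monomial_mul, hq,
    hq]
  simp only [Finsupp.single_le_iff, Finsupp.tsub_apply, Finsupp.single_eq_same, one_mul]
  have := hs (e 0) (e 1)
  rw [← eq_expt] at this
  simp only [Finsupp.single_apply, Fin.isValue, zero_ne_one, one_ne_zero, if_false, tsub_zero]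
  split_ifs with h1 h2 h2
  · rw [if_pos h2] at this
    rw [Nat.sub_add_cancel h1]
    linear_combination -this
  · rw [if_neg h2] at this
    rw [Nat.sub_add_cancel h1]
    linear_combination -this
  · rw [if_pos h2, hs₀ _ _ (not_le.mp h1)] at this
    linear_combination -this
  · rw [if_neg h2, hs₀ _ _ (not_le.mp h1)] at this
    linear_combination -this

end PowerSeries

/-! ### Curves in toric charts -/

section ToricCurves

variable {W : Type u} [CommRing W] {B : Type u} [CommRing B] {φ : MvPowerSeries (Fin 2) W →+* B}
  {u v : B} {p q : ℕ × ℕ}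

/-- If `G 0` is a unit, then `G(h)` does not vanish where `h` vanishes. -/
lemma isCoprime_eval₂ {G : Polynomial W} (hG : IsUnit (G.coeff 0)) (ι : W →+* B) {h : B}
    (hu : u ∣ h) : IsCoprime (G.eval₂ ι h) u := by
  obtain ⟨h, rfl⟩ := hu
  obtain ⟨c, hc⟩ := (hG.map ι).exists_left_inv
  refine ⟨c, -c * h * G.divX.eval₂ ι (u * h), ?_⟩
  conv_lhs => enter [1, 2]; rw [← G.divX_mul_X_add]
  rw [Polynomial.eval₂_add, Polynomial.eval₂_mul, Polynomial.eval₂_X, Polynomial.eval₂_C]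
  linear_combination hc

/-- The restriction of a function `G(u)` to the line `v = 0` is a polynomial with invertible leading
coefficient, hence a nonzerodivisor. -/
lemma IsMonomialChart.dvd_of_dvd_mul_right (h : IsMonomialChart φ u v p q) (hq₁ : q.1 ≠ 0)
    (hq₂ : q.2 ≠ 0) {G : Polynomial W} (hG : IsUnit G.leadingCoeff) {b : B}
    (hb : G.eval₂ (φ.comp MvPowerSeries.C) u ∣ v * b) :
    G.eval₂ (φ.comp MvPowerSeries.C) u ∣ b := by
  obtain ⟨σ, hσφ, hσu, hσv, hσ, hker⟩ := h.exists_line hq₁ hq₂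
  obtain ⟨a, ha⟩ := hb
  have hσG : σ (G.eval₂ (φ.comp MvPowerSeries.C) u) = G := by
    have h1 : σ.comp (φ.comp MvPowerSeries.C) = Polynomial.C := by
      rw [← RingHom.comp_assoc, hσφ]
      ext
      simp
    rw [Polynomial.hom_eval₂, hσu, h1, Polynomial.eval₂_C_X]
  have h1 : G * σ a = 0 := by
    have := congr_arg σ ha
    rw [map_mul, map_mul, hσv, zero_mul, hσG] at this
    exact this.symm
  have h2 : σ a = 0 := by
    refine (mem_nonZeroDivisors_iff.mp (Polynomial.mem_nonZeroDivisors_of_leadingCoeff ?_)).1 _ h1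
    exact hG.mem_nonZeroDivisors
  have h3 : a ∈ Ideal.span {v} := hker ▸ h2
  obtain ⟨a', rfl⟩ := Ideal.mem_span_singleton.mp h3
  refine ⟨a', sub_eq_zero.mp (h.regPair.right _ ?_)⟩
  linear_combination ha

/-- The polynomial `G(u ^ δ * v ^ δ')` in the coordinates of a toric chart. -/
def evalMonomial (G : Polynomial W) (δ δ' : ℕ) : MvPolynomial (Fin 2) W :=
  G.eval₂ MvPolynomial.C (MvPolynomial.X 0 ^ δ * MvPolynomial.X 1 ^ δ')

@[simp]
lemma toricCoord_evalMonomial (G : Polynomial W) (δ δ' : ℕ) :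
    toricCoord φ u v (evalMonomial G δ δ') = G.eval₂ (φ.comp MvPowerSeries.C) (u ^ δ * v ^ δ') := by
  rw [evalMonomial, Polynomial.hom_eval₂, map_mul, map_pow, map_pow, toricCoord_X_zero,
    toricCoord_X_one]
  congr 1
  ext
  simp

/-- The element `z` is, up to the factor `e ^ m`, given by the polynomials `G (x ^ b / y ^ a)` and
`G' (y ^ a / x ^ b)`, where `e = y ^ a` and `e = x ^ b` respectively. -/
structure IsForm (a b : ℕ) (z : MvPowerSeries (Fin 2) W) (m : ℕ) (G G' : Polynomial W) :
    Prop where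
  left {B : Type u} [CommRing B] (φ : MvPowerSeries (Fin 2) W →+* B) (e h : B)
    (hx : φ (MvPowerSeries.X 0) ^ b = e * h) (hy : φ (MvPowerSeries.X 1) ^ a = e) :
    φ z = e ^ m * G.eval₂ (φ.comp MvPowerSeries.C) h
  right {B : Type u} [CommRing B] (φ : MvPowerSeries (Fin 2) W →+* B) (e h : B)
    (hx : φ (MvPowerSeries.X 0) ^ b = e) (hy : φ (MvPowerSeries.X 1) ^ a = e * h) :
    φ z = e ^ m * G'.eval₂ (φ.comp MvPowerSeries.C) h

lemma isForm_pow_add_pow (a b d : ℕ) : IsForm a b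
    (MvPowerSeries.X 0 ^ (d * b) + MvPowerSeries.X 1 ^ (d * a) : MvPowerSeries (Fin 2) W) d
    (Polynomial.X ^ d + 1) (Polynomial.X ^ d + 1) := by
  constructor <;> intro B _ φ e h hx hy <;>
  · rw [mul_comm d b, mul_comm d a, pow_mul, pow_mul, map_add, map_pow, map_pow, map_pow, map_pow,
      hx, hy]
    simp
    ring

lemma isForm_pow_sub_pow (a b : ℕ) (η : W) : IsForm a b
    (MvPowerSeries.X 0 ^ b - MvPowerSeries.C η * MvPowerSeries.X 1 ^ a) 1
    (Polynomial.X - Polynomial.C η) (1 - Polynomial.C η * Polynomial.X) := by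
  constructor <;> intro B _ φ e h hx hy <;>
  · rw [map_sub, map_mul, map_pow, map_pow, hx, hy]
    simp [-map_mul]
    ring

/-- The order of `x ^ w₂ + y ^ w₁` along the divisor of the ray `r`. -/
def rayOrd (w r : ℕ × ℕ) : ℕ := min (r.1 * w.2) (r.2 * w.1)

/-- The order of `x ^ w₂ / y ^ w₁` or its inverse along the divisor of the ray `r`. -/
def rayOff (w r : ℕ × ℕ) : ℕ := (r.1 * w.2 - r.2 * w.1) + (r.2 * w.1 - r.1 * w.2)

lemma rayOrd_add_rayOff_of_le {w r : ℕ × ℕ} (h : r.2 * w.1 ≤ r.1 * w.2) :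
    rayOrd w r = r.2 * w.1 ∧ rayOrd w r + rayOff w r = r.1 * w.2 := by
  simp only [rayOrd, rayOff]
  lia

lemma rayOrd_add_rayOff_of_ge {w r : ℕ × ℕ} (h : r.1 * w.2 ≤ r.2 * w.1) :
    rayOrd w r = r.1 * w.2 ∧ rayOrd w r + rayOff w r = r.2 * w.1 := by
  simp only [rayOrd, rayOff]
  lia

lemma IsForm.map_of_le {w : ℕ × ℕ} {z : MvPowerSeries (Fin 2) W} {m : ℕ} {G G' : Polynomial W}
    (hz : IsForm w.1 w.2 z m G G') (h : IsMonomialChart φ u v p q) (hp : p.2 * w.1 ≤ p.1 * w.2)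
    (hq : q.2 * w.1 ≤ q.1 * w.2) :
    φ z = (u ^ rayOrd w p * v ^ rayOrd w q) ^ m *
      toricCoord φ u v (evalMonomial G (rayOff w p) (rayOff w q)) := by
  obtain ⟨hp₁, hp₂⟩ := rayOrd_add_rayOff_of_le hp
  obtain ⟨hq₁, hq₂⟩ := rayOrd_add_rayOff_of_le hq
  rw [toricCoord_evalMonomial]
  refine hz.left φ _ _ ?_ ?_
  · rw [h.map_X_zero, mul_pow, ← pow_mul, ← pow_mul, ← hp₂, ← hq₂]
    ring
  · rw [h.map_X_one, mul_pow, ← pow_mul, ← pow_mul, hp₁, hq₁]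

lemma IsForm.map_of_ge {w : ℕ × ℕ} {z : MvPowerSeries (Fin 2) W} {m : ℕ} {G G' : Polynomial W}
    (hz : IsForm w.1 w.2 z m G G') (h : IsMonomialChart φ u v p q) (hp : p.1 * w.2 ≤ p.2 * w.1)
    (hq : q.1 * w.2 ≤ q.2 * w.1) :
    φ z = (u ^ rayOrd w p * v ^ rayOrd w q) ^ m *
      toricCoord φ u v (evalMonomial G' (rayOff w p) (rayOff w q)) := by
  obtain ⟨hp₁, hp₂⟩ := rayOrd_add_rayOff_of_ge hp
  obtain ⟨hq₁, hq₂⟩ := rayOrd_add_rayOff_of_ge hq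
  rw [toricCoord_evalMonomial]
  refine hz.right φ _ _ ?_ ?_
  · rw [h.map_X_zero, mul_pow, ← pow_mul, ← pow_mul, hp₁, hq₁]
  · rw [h.map_X_one, mul_pow, ← pow_mul, ← pow_mul, ← hp₂, ← hq₂]
    ring

/-- A closed subscheme of the exceptional line `u = 0` of a chart, cut out by `G(v)`. -/
lemma IsMonomialChart.exists_quotient (h : IsMonomialChart φ u v p q) (hp₁ : p.1 ≠ 0)
    (hp₂ : p.2 ≠ 0) {R : Type u} [CommRing R] (τ : Polynomial W →+* R)
    (hτ : Function.Surjective τ) {G : Polynomial W} (hker : RingHom.ker τ = Ideal.span {G}) :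
    ∃ σ : B →+* R, σ.comp φ = (τ.comp Polynomial.C).comp MvPowerSeries.constantCoeff ∧
      Function.Surjective σ ∧
      RingHom.ker σ = Ideal.span {G.eval₂ (φ.comp MvPowerSeries.C) v} ⊔ Ideal.span {u} := by
  obtain ⟨σ, hσφ, hσv, hσu, hσ, hσker⟩ := h.symm.exists_line hp₁ hp₂
  have hσG : σ (G.eval₂ (φ.comp MvPowerSeries.C) v) = G := by
    have h1 : σ.comp (φ.comp MvPowerSeries.C) = Polynomial.C := by
      rw [← RingHom.comp_assoc, hσφ]
      ext
      simp
    rw [Polynomial.hom_eval₂, hσv, h1, Polynomial.eval₂_C_X]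
  refine ⟨τ.comp σ, by rw [RingHom.comp_assoc, hσφ, RingHom.comp_assoc], hτ.comp hσ, ?_⟩
  have hG : Ideal.span {G} = (Ideal.span {G.eval₂ (φ.comp MvPowerSeries.C) v}).map σ := by
    rw [Ideal.map_span, Set.image_singleton, hσG]
  rw [← RingHom.comap_ker, hker, hG, Ideal.comap_map_of_surjective _ hσ, ← RingHom.ker_eq_comap_bot,
    hσker]

lemma isUnit_leadingCoeff_one_sub {η : W} (hη : IsUnit η) :
    IsUnit (1 - Polynomial.C η * Polynomial.X : Polynomial W).leadingCoeff := by
  nontriviality W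
  have : (1 - Polynomial.C η * Polynomial.X : Polynomial W) =
      Polynomial.C (-η) * Polynomial.X + Polynomial.C 1 := by
    rw [map_neg, map_one]
    ring
  rw [this, Polynomial.leadingCoeff_linear (neg_ne_zero.mpr hη.ne_zero)]
  exact hη.neg

/-- If `b` lies in a toric chart, then its product with a large power of `u` comes from
a power series, up to a multiple of `1 - η * v`. This is because all large powers of `u` do,
since `p.1` and `p.2` are coprime. -/
lemma IsMonomialChart.exists_dvd_pow_mul_sub (h : IsMonomialChart φ u v p q)
    (hp : Nat.Coprime p.1 p.2) {η η' : W} (hη : η * η' = 1) (b : B) :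
    ∃ (m : ℕ) (a : MvPowerSeries (Fin 2) W), 1 - φ (MvPowerSeries.C η) * v ∣ u ^ m * b - φ a := by
  let π := Ideal.Quotient.mk (Ideal.span {1 - φ (MvPowerSeries.C η) * v})
  have hv : π (φ (MvPowerSeries.C η)) * π v = 1 := by
    have : π (1 - φ (MvPowerSeries.C η) * v) = 0 :=
      Ideal.Quotient.eq_zero_iff_mem.mpr (Ideal.mem_span_singleton_self _)
    rw [map_sub, map_mul, map_one] at this
    linear_combination -this
  have hη₁ : π (φ (MvPowerSeries.C η)) * π (φ (MvPowerSeries.C η')) = 1 := by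
    rw [← map_mul, ← map_mul, ← map_mul, hη, map_one, map_one, map_one]
  have hv' : π v = π (φ (MvPowerSeries.C η')) := by
    linear_combination π (φ (MvPowerSeries.C η')) * hv - π v * hη₁
  have hpow (m : ℕ) (hm : p.1.pred * p.2.pred ≤ m) : ∃ a, π u ^ m = π (φ a) := by
    obtain ⟨i, j, rfl⟩ := Nat.exists_add_mul_eq_of_gcd_dvd_of_mul_pred_le p.1 p.2 m (by simp [hp])
      hm
    refine ⟨(MvPowerSeries.X 0 * MvPowerSeries.C η ^ q.1) ^ i *
      (MvPowerSeries.X 1 * MvPowerSeries.C η ^ q.2) ^ j, ?_⟩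
    have h0 : π (φ (MvPowerSeries.X 0 * MvPowerSeries.C η ^ q.1)) = π u ^ p.1 := by
      rw [map_mul, h.map_X_zero, map_mul, map_mul, map_pow, map_pow, map_pow, map_pow, mul_assoc,
        ← mul_pow, mul_comm (π v), hv, one_pow, mul_one]
    have h1 : π (φ (MvPowerSeries.X 1 * MvPowerSeries.C η ^ q.2)) = π u ^ p.2 := by
      rw [map_mul, h.map_X_one, map_mul, map_mul, map_pow, map_pow, map_pow, map_pow, mul_assoc,
        ← mul_pow, mul_comm (π v), hv, one_pow, mul_one]
    rw [map_mul, map_mul, map_pow, map_pow, map_pow, map_pow, h0, h1]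
    ring
  let S : Subring B :=
    { carrier := {b | ∃ m : ℕ, ∀ m', m ≤ m' → ∃ a, π u ^ m' * π b = π (φ a)}
      zero_mem' := ⟨0, fun m _ ↦ ⟨0, by simp⟩⟩
      one_mem' := ⟨_, fun m hm ↦ by simpa using hpow m hm⟩
      neg_mem' := by
        rintro b ⟨m, hm⟩
        refine ⟨m, fun m' hm' ↦ ?_⟩
        obtain ⟨a, ha⟩ := hm m' hm'
        exact ⟨-a, by rw [map_neg, map_neg, map_neg, mul_neg, ha]⟩
      add_mem' := by
        rintro b b' ⟨m₁, h₁⟩ ⟨m₂, h₂⟩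
        refine ⟨max m₁ m₂, fun m' hm' ↦ ?_⟩
        obtain ⟨a₁, ha₁⟩ := h₁ m' (le_trans (le_max_left _ _) hm')
        obtain ⟨a₂, ha₂⟩ := h₂ m' (le_trans (le_max_right _ _) hm')
        exact ⟨a₁ + a₂, by rw [map_add, map_add, map_add, mul_add, ha₁, ha₂]⟩
      mul_mem' := by
        rintro b b' ⟨m₁, h₁⟩ ⟨m₂, h₂⟩
        refine ⟨m₁ + m₂, fun m' hm' ↦ ?_⟩
        obtain ⟨k, rfl⟩ := Nat.exists_eq_add_of_le hm'
        obtain ⟨a₁, ha₁⟩ := h₁ m₁ le_rfl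
        obtain ⟨a₂, ha₂⟩ := h₂ (m₂ + k) (by lia)
        refine ⟨a₁ * a₂, ?_⟩
        rw [map_mul, map_mul, map_mul, ← ha₁, ← ha₂, add_assoc, pow_add]
        ring }
  have hφS (a) : φ a ∈ S := by
    refine ⟨p.1.pred * p.2.pred, fun m hm ↦ ?_⟩
    obtain ⟨a', ha'⟩ := hpow m hm
    exact ⟨a' * a, by rw [map_mul, map_mul, ha']⟩
  have huS : u ∈ S := by
    refine ⟨p.1.pred * p.2.pred, fun m hm ↦ ?_⟩
    obtain ⟨a', ha'⟩ := hpow (m + 1) (hm.trans (Nat.le_succ m))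
    exact ⟨a', by rw [← ha', pow_succ]⟩
  have hvS : v ∈ S := by
    refine ⟨p.1.pred * p.2.pred, fun m hm ↦ ?_⟩
    obtain ⟨a', ha'⟩ := hpow m hm
    exact ⟨a' * MvPowerSeries.C η', by rw [map_mul, map_mul, ha', hv']⟩
  obtain ⟨θ, ⟨hθφ, hθu, hθv⟩, -⟩ := h.existsUnique (R := S) (φ.codRestrict S hφS) ⟨u, huS⟩ ⟨v, hvS⟩
    (Subtype.ext h.map_X_zero) (Subtype.ext h.map_X_one)
  have hθ : S.subtype.comp θ = RingHom.id B := by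
    refine h.hom_ext ?_ (by simp [hθu]) (by simp [hθv])
    rw [RingHom.comp_assoc, hθφ]
    rfl
  have hb : b ∈ S := by
    rw [← RingHom.id_apply b, ← hθ]
    exact (θ b).2
  obtain ⟨m, hm⟩ := hb
  obtain ⟨a, ha⟩ := hm m le_rfl
  refine ⟨m, a, Ideal.mem_span_singleton.mp (Ideal.Quotient.eq_zero_iff_mem.mp ?_)⟩
  change π _ = 0
  rw [map_sub, map_mul, map_pow, ha, sub_self]

/-- The branch `1 = η * v` of the proper transform is integral: it is parametrized by `u = τ`,
and the parametrization of its image by powers of `τ` has the expected kernel. -/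
lemma IsMonomialChart.isPrime_span [IsDomain W] (h : IsMonomialChart φ u v p q) (hp₁ : p.1 ≠ 0)
    (hp₂ : p.2 ≠ 0) (hpq : p.1 * q.2 = p.2 * q.1 + 1) {η : W} (hη : IsUnit η) :
    (Ideal.span {1 - φ (MvPowerSeries.C η) * v}).IsPrime := by
  obtain ⟨η', hηη'⟩ := hη.exists_right_inv
  have hη' : IsUnit η' := .of_mul_eq_one_right _ hηη'
  have hcop : Nat.Coprime p.1 p.2 := by
    have h1 : Nat.gcd p.1 p.2 ∣ p.2 * q.1 + 1 := hpq ▸ Dvd.dvd.mul_right (Nat.gcd_dvd_left _ _) _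
    exact Nat.dvd_one.mp ((Nat.dvd_add_right
      (Dvd.dvd.mul_right (Nat.gcd_dvd_right _ _) _)).mp h1)
  let g := 1 - φ (MvPowerSeries.C η) * v
  have hs := hasSubst_monomials hp₁ hp₂ (η' ^ q.1) (η' ^ q.2)
  let ψ : MvPowerSeries (Fin 2) W →+* PowerSeries W := (MvPowerSeries.substAlgHom hs).toRingHom
  have hψ (a) : ψ a = MvPowerSeries.subst _ a := MvPowerSeries.substAlgHom_apply hs a
  obtain ⟨θ, ⟨hθφ, hθu, hθv⟩, -⟩ := h.existsUnique ψ PowerSeries.X (PowerSeries.C η')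
    (by rw [hψ, MvPowerSeries.subst_X hs]; simp [mul_comm])
    (by rw [hψ, MvPowerSeries.subst_X hs]; simp [mul_comm])
  have hψC (w : W) : ψ (MvPowerSeries.C w) = PowerSeries.C w := by
    rw [hψ, MvPowerSeries.subst_C]
    rfl
  have hθφ' (a) : θ (φ a) = ψ a := DFunLike.congr_fun hθφ a
  have hker : Ideal.span {g} = RingHom.ker θ := by
    refine le_antisymm ?_ fun b hb ↦ Ideal.mem_span_singleton.mpr ?_
    · rw [Ideal.span_singleton_le_iff_mem, RingHom.mem_ker]
      simp only [g]
      rw [map_sub, map_mul, map_one, hθφ', hψC, hθv, ← map_mul, hηη', map_one, sub_self]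
    · obtain ⟨m, a, ha⟩ := h.exists_dvd_pow_mul_sub hcop hηη' b
      have hz := isForm_pow_sub_pow p.1 p.2 η
      have hz' := hz.map_of_ge h (mul_comm _ _).le (by lia)
      have hpp : rayOff p p = 0 := by simp [rayOff, mul_comm]
      have hpq' : rayOff p q = 1 := by simp only [rayOff]; lia
      have hgz : g ∣ φ (MvPowerSeries.X 0 ^ p.2 - MvPowerSeries.C η * MvPowerSeries.X 1 ^ p.1) := by
        rw [hz', hpp, hpq']
        refine Dvd.intro_left _ (congr_arg _ ?_)
        simp [g]
      have ha₀ : ψ a = 0 := by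
        have h1 : θ g = 0 := by
          simp only [g]
          rw [map_sub, map_mul, map_one, hθφ', hψC, hθv, ← map_mul, hηη', map_one, sub_self]
        obtain ⟨c, hc⟩ := ha
        have h2 := congr_arg θ hc
        rw [map_sub, map_mul, RingHom.mem_ker.mp hb, mul_zero, zero_sub, hθφ', map_mul, h1,
          zero_mul, neg_eq_zero] at h2
        exact h2
      have h3 : g ∣ φ a := by
        refine hgz.trans (map_dvd φ (dvd_of_subst_eq_zero hp₁ hp₂ hcop (hη'.pow _) (hη'.pow _) ?_ a
          (by rw [← hψ, ha₀])))
        rw [← pow_mul, ← pow_mul, mul_comm q.1, mul_comm q.2, hpq, pow_succ]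
        linear_combination (-η' ^ (p.2 * q.1)) * hηη'
      have h4 : g ∣ u ^ m * b := by simpa using dvd_add ha h3
      have hg : g = (1 - Polynomial.C η * Polynomial.X).eval₂ (φ.comp MvPowerSeries.C) v := by
        simp [g]
      have hlc := isUnit_leadingCoeff_one_sub hη
      have hdvd (b : B) : g ∣ u * b → g ∣ b := by
        rw [hg]
        exact h.symm.dvd_of_dvd_mul_right hp₁ hp₂ hlc
      clear ha
      induction m with
      | zero => simpa using h4
      | succ m ih => exact ih (hdvd _ (by rwa [← mul_assoc, ← pow_succ']))
  change (Ideal.span {g}).IsPrime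
  rw [hker]
  exact RingHom.ker_isPrime θ

end ToricCurves

/-! ### Curves in toric modifications -/

section Curves

variable {W : Type u} [CommRing W] {Y : Scheme.{u}} {f : Y ⟶ germ W} {n : ℕ} {r : ℕ → ℕ × ℕ}
  {D : ℕ → Y.IdealSheafData} {O : ℕ → Y.Opens} {k : ℕ}

lemma IsModel.det_le (hm : IsModel f n r D O) {i : ℕ} (hik : i ≤ k) (hk : k ≤ n) :
    (r i).2 * (r k).1 ≤ (r i).1 * (r k).2 := by
  obtain rfl | h := hik.eq_or_lt
  · rw [mul_comm]
  · exact (hm.det_pos h (by lia)).le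

lemma IsModel.det_ge (hm : IsModel f n r D O) {i : ℕ} (hik : k ≤ i) (hi : i ≤ n + 1) :
    (r i).1 * (r k).2 ≤ (r i).2 * (r k).1 := by
  obtain rfl | h := hik.eq_or_lt
  · rw [mul_comm]
  · have := hm.det_pos h hi
    rw [mul_comm (r i).1, mul_comm (r i).2]
    exact this.le

lemma IsModel.rayOff_ne_zero (hm : IsModel f n r D O) (hk : k ≤ n) {i : ℕ} (hi : i ≤ n + 1)
    (hik : i ≠ k) : rayOff (r k) (r i) ≠ 0 := by
  simp only [rayOff]
  obtain h | h := hik.lt_or_gt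
  · have := hm.det_pos h (by lia)
    lia
  · have := hm.det_pos h hi
    rw [mul_comm (r k).1, mul_comm (r k).2] at this
    lia

lemma rayOff_self (w : ℕ × ℕ) : rayOff w w = 0 := by simp [rayOff, mul_comm]

lemma IsModel.rayOff_succ (hm : IsModel f n r D O) (hk : k ≤ n) :
    rayOff (r k) (r (k + 1)) = 1 := by
  have := hm.det k hk
  simp only [rayOff]
  rw [mul_comm (r (k + 1)).2, mul_comm (r (k + 1)).1, this]
  lia

lemma IsModel.rayOff_pred (hm : IsModel f n r D O) {c : ℕ} (hc : c ≤ n) :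
    rayOff (r (c + 1)) (r c) = 1 := by
  have := hm.det c hc
  simp only [rayOff]
  rw [this]
  lia

/-- Both the constant and the leading coefficient of the polynomial are invertible. -/
structure HasUnitEnds (G : Polynomial W) : Prop where
  coeff_zero : IsUnit (G.coeff 0)
  leadingCoeff : IsUnit G.leadingCoeff

/-- The equation of the proper transform of a curve in the chart `O c`, in terms of the polynomials
of `IsForm`. -/
def chartEquation (r : ℕ → ℕ × ℕ) (k : ℕ) (G G' : Polynomial W) (c : ℕ) :
    MvPolynomial (Fin 2) W :=
  evalMonomial (if c < k then G else G') (rayOff (r k) (r c)) (rayOff (r k) (r (c + 1)))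

section

variable {B : Type u} [CommRing B] {φ : MvPowerSeries (Fin 2) W →+* B} {u v : B}
  {z : MvPowerSeries (Fin 2) W} {m : ℕ} {G G' : Polynomial W} {c : ℕ}

/-- The pullback of a curve in a chart of the modification: a monomial times the equation of the
proper transform. -/
lemma IsModel.map_form (hm : IsModel f n r D O) (hk : k ≤ n)
    (hz : IsForm (r k).1 (r k).2 z m G G') (hc : c ≤ n)
    (h : IsMonomialChart φ u v (r c) (r (c + 1))) :
    φ z = (u ^ rayOrd (r k) (r c) * v ^ rayOrd (r k) (r (c + 1))) ^ m *
      toricCoord φ u v (chartEquation r k G G' c) := by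
  by_cases hck : c < k
  · rw [chartEquation, if_pos hck]
    exact hz.map_of_le h (hm.det_le hck.le hk) (hm.det_le hck hk)
  · rw [chartEquation, if_neg hck]
    exact hz.map_of_ge h (hm.det_ge (not_lt.mp hck) (by lia)) (hm.det_ge (by lia) (by lia))

lemma IsModel.isCoprime_left (hm : IsModel f n r D O) (hk : k ≤ n) (hG : HasUnitEnds G)
    (hG' : HasUnitEnds G') (hc : c ≤ n) (hck : c ≠ k) :
    IsCoprime (toricCoord φ u v (chartEquation r k G G' c)) u := by
  rw [chartEquation, toricCoord_evalMonomial]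
  refine isCoprime_eval₂ (by split_ifs; exacts [hG.coeff_zero, hG'.coeff_zero]) _ ?_
  exact dvd_mul_of_dvd_left (dvd_pow_self _ (hm.rayOff_ne_zero hk (by lia) hck)) _

lemma IsModel.isCoprime_right (hm : IsModel f n r D O) (hk : k ≤ n) (hG : HasUnitEnds G)
    (hG' : HasUnitEnds G') (hc : c ≤ n) (hck : c + 1 ≠ k) :
    IsCoprime (toricCoord φ u v (chartEquation r k G G' c)) v := by
  rw [chartEquation, toricCoord_evalMonomial]
  refine isCoprime_eval₂ (by split_ifs; exacts [hG.coeff_zero, hG'.coeff_zero]) _ ?_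
  exact dvd_mul_of_dvd_right (dvd_pow_self _ (hm.rayOff_ne_zero hk (by lia) hck)) _

lemma IsModel.toricCoord_chartEquation_self (hm : IsModel f n r D O) (hk : k ≤ n) :
    toricCoord φ u v (chartEquation r k G G' k) = G'.eval₂ (φ.comp MvPowerSeries.C) v := by
  rw [chartEquation, toricCoord_evalMonomial, if_neg (lt_irrefl k), rayOff_self,
    hm.rayOff_succ hk, pow_zero, one_mul, pow_one]

/-- The coordinates of the charts are nonzerodivisors modulo the equation of the curve. -/
lemma IsModel.dvd_of_dvd_mul (hm : IsModel f n r D O) (hk₁ : 1 ≤ k) (hk : k ≤ n)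
    (hG : HasUnitEnds G) (hG' : HasUnitEnds G') (hc : c ≤ n)
    (h : IsMonomialChart φ u v (r c) (r (c + 1))) (b : B) :
    (toricCoord φ u v (chartEquation r k G G' c) ∣ u * b →
      toricCoord φ u v (chartEquation r k G G' c) ∣ b) ∧
    (toricCoord φ u v (chartEquation r k G G' c) ∣ v * b →
      toricCoord φ u v (chartEquation r k G G' c) ∣ b) := by
  constructor
  · obtain rfl | hck := eq_or_ne c k
    · rw [hm.toricCoord_chartEquation_self hk]
      exact h.symm.dvd_of_dvd_mul_right (hm.pos c hk₁ hk).1 (hm.pos c hk₁ hk).2 hG'.leadingCoeff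
    · exact (hm.isCoprime_left hk hG hG' hc hck).dvd_of_dvd_mul_left
  · obtain rfl | hck := eq_or_ne (c + 1) k
    · rw [chartEquation, toricCoord_evalMonomial, if_pos (Nat.lt_succ_self c), rayOff_self,
        hm.rayOff_pred hc, pow_zero, mul_one, pow_one]
      exact h.dvd_of_dvd_mul_right (hm.pos _ hk₁ hk).1 (hm.pos _ hk₁ hk).2 hG.leadingCoeff
    · exact (hm.isCoprime_right hk hG hG' hc hck).dvd_of_dvd_mul_left

end

lemma mul_pow_dvd_mul_pow {B : Type*} [CommRing B] (u v : B) {a b s t : ℕ} (hs : a ≠ 0 → s ≠ 0)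
    (ht : b ≠ 0 → t ≠ 0) : u ^ a * v ^ b ∣ (u ^ s * v ^ t) ^ (a + b) := by
  rw [mul_pow, ← pow_mul, ← pow_mul]
  refine mul_dvd_mul (pow_dvd_pow _ ?_) (pow_dvd_pow _ ?_)
  · obtain rfl | ha := eq_or_ne a 0
    · exact Nat.zero_le _
    · exact (Nat.le_add_right a b).trans (Nat.le_mul_of_pos_left _ (Nat.pos_of_ne_zero (hs ha)))
  · obtain rfl | hb := eq_or_ne b 0
    · exact Nat.zero_le _
    · exact (Nat.le_add_left b a).trans (Nat.le_mul_of_pos_left _ (Nat.pos_of_ne_zero (ht hb)))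

/-- The complement of the origin is the union of two principal open sets, also if `W` is not
Noetherian. -/
instance quasiCompact_origin_compl (f : Y ⟶ germ W) :
    QuasiCompact (Scheme.Opens.ι (f ⁻¹ᵁ (origin W).ker.support.compl)) := by
  have h1 : QuasiCompact (Scheme.Opens.ι (origin W).ker.support.compl) := by
    refine (@HasAffineProperty.iff_of_isAffine _ (fun X _ _ _ ↦ CompactSpace X)
      instHasAffinePropertyQuasiCompactCompactSpaceCarrierCarrierCommRingCat _ _ _ _).mpr ?_
    refine isCompact_iff_compactSpace.mp ?_
    have : ((origin W).ker.support.compl : Set (germ W)) =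
        (PrimeSpectrum.basicOpen (MvPowerSeries.X 0 : MvPowerSeries (Fin 2) W) :
          Set (PrimeSpectrum (MvPowerSeries (Fin 2) W))) ∪
        (PrimeSpectrum.basicOpen (MvPowerSeries.X 1 : MvPowerSeries (Fin 2) W) :
          Set (PrimeSpectrum (MvPowerSeries (Fin 2) W))) := by
      ext x
      exact (not_congr (mem_support_origin x)).trans not_and_or
    rw [this]
    exact (PrimeSpectrum.isCompact_basicOpen _).union (PrimeSpectrum.isCompact_basicOpen _)
  exact MorphismProperty.of_isPullback (isPullback_morphismRestrict f _) h1

/-- The complement of the origin in a toric chart. -/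
lemma IsModel.mem_preimage_origin_compl (hm : IsModel f n r D O) (hn : 1 ≤ n) {B : Type u}
    [CommRing B] {φ : MvPowerSeries (Fin 2) W →+* B} {u v : B} {c : ℕ} (hc : c ≤ n)
    (h : IsMonomialChart φ u v (r c) (r (c + 1))) {j : Spec (CommRingCat.of B) ⟶ Y}
    (hj : j ≫ f = Spec.map (CommRingCat.ofHom φ)) (x : Spec (CommRingCat.of B)) :
    j x ∈ f ⁻¹ᵁ (origin W).ker.support.compl ↔
      u ^ ((r c).1 * (r c).2) * v ^ ((r (c + 1)).1 * (r (c + 1)).2) ∉ x.asIdeal := by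
  have h1 : j x ∈ f ⁻¹ᵁ (origin W).ker.support.compl ↔
      ¬ (φ (MvPowerSeries.X 0) ∈ x.asIdeal ∧ φ (MvPowerSeries.X 1) ∈ x.asIdeal) := by
    change ¬ (f (j x) ∈ (origin W).ker.support) ↔ _
    rw [← Scheme.Hom.comp_apply, hj, mem_support_origin]
    rfl
  have hp (b : B) (i : ℕ) : b ^ i ∈ x.asIdeal ↔ b ∈ x.asIdeal ∧ i ≠ 0 := by
    obtain rfl | hi := eq_or_ne i 0
    · simpa using (Ideal.ne_top_iff_one _).mp x.2.ne_top
    · simpa [hi] using ⟨x.2.mem_of_pow_mem i, fun h ↦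
        Ideal.pow_mem_of_mem _ h _ (Nat.pos_of_ne_zero hi)⟩
  have hmul (a b : B) : a * b ∈ x.asIdeal ↔ a ∈ x.asIdeal ∨ b ∈ x.asIdeal :=
    x.2.mul_mem_iff_mem_or_mem
  rw [h1, not_iff_not, h.map_X_zero, h.map_X_one]
  simp only [hmul, hp, mul_ne_zero_iff]
  obtain rfl | hc₀ := eq_or_ne c 0
  · have := hm.pos 1 le_rfl hn
    rw [hm.ray_zero]
    tauto
  · have h2 := hm.pos c (by lia) hc
    obtain rfl | hcn := hc.eq_or_lt
    · rw [hm.ray_last]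
      tauto
    · have := hm.pos (c + 1) (by lia) (by lia)
      tauto

lemma mul_ne_zero_of_rayOrd_ne_zero {w p : ℕ × ℕ} (h : rayOrd w p ≠ 0) : p.1 * p.2 ≠ 0 := by
  intro h0
  refine h ?_
  rw [rayOrd]
  obtain h0 | h0 := mul_eq_zero.mp h0 <;> simp [h0]

/-- The equations of the proper transform of a curve. -/
lemma IsModel.hasEquation (hm : IsModel f n r D O) (hk₁ : 1 ≤ k) (hk : k ≤ n)
    {z : MvPowerSeries (Fin 2) W} {m : ℕ} {G G' : Polynomial W}
    (hz : IsForm (r k).1 (r k).2 z m G G') (hG : HasUnitEnds G) (hG' : HasUnitEnds G') :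
    HasEquation f n r O (properTransform f (idealSheaf (Ideal.span {z})))
      (chartEquation r k G G') := by
  intro c hc B _ φ j _ u v hjO hjf h
  have h1 := hm.dvd_of_dvd_mul hk₁ hk hG hG' hc h
  have hpow {a : B} (ha : ∀ b, toricCoord φ u v (chartEquation r k G G' c) ∣ a * b →
      toricCoord φ u v (chartEquation r k G G' c) ∣ b) (s : ℕ) (b : B)
      (hb : toricCoord φ u v (chartEquation r k G G' c) ∣ a ^ s * b) :
      toricCoord φ u v (chartEquation r k G G' c) ∣ b := by
    induction s with
    | zero => simpa using hb
    | succ s ih => exact ih (ha _ (by rwa [← mul_assoc, ← pow_succ']))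
  refine closureOf_comap (f ⁻¹ᵁ (origin W).ker.support.compl) _ j
    (u ^ ((r c).1 * (r c).2) * v ^ ((r (c + 1)).1 * (r (c + 1)).2)) _
    (e := (u ^ rayOrd (r k) (r c) * v ^ rayOrd (r k) (r (c + 1))) ^ m)
    (m := (rayOrd (r k) (r c) + rayOrd (r k) (r (c + 1))) * m) ?_
    (hm.mem_preimage_origin_compl (hk₁.trans hk) hc h hjf) ?_ fun b hb ↦ ?_
  · rw [pow_mul]
    exact pow_dvd_pow_of_dvd (mul_pow_dvd_mul_pow _ _ mul_ne_zero_of_rayOrd_ne_zero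
      mul_ne_zero_of_rayOrd_ne_zero) m
  · rw [← comap_comp, hjf, comap_idealSheaf, Ideal.map_span, Set.image_singleton,
      hm.map_form hk hz hc h]
  · exact hpow (fun b ↦ (h1 b).2) _ _ (hpow (fun b ↦ (h1 b).1) _ _ (by rwa [← mul_assoc]))

/-- The proper transform of a curve meets only the exceptional divisor of the ray `r k`. -/
lemma IsModel.mem_of_mem_support (hm : IsModel f n r D O) (hk : k ≤ n)
    {C : Y.IdealSheafData} {G G' : Polynomial W} (hG : HasUnitEnds G) (hG' : HasUnitEnds G')
    (hC : HasEquation f n r O C (chartEquation r k G G')) {y : Y} (hy : y ∈ C.support) :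
    y ∈ O k ∧ ∀ i, i ≠ k → y ∉ (D i).support := by
  have key (i : ℕ) (hi : i ≠ k) : y ∉ (D i).support := by
    intro hyi
    obtain ⟨c, hc, hyc⟩ := hm.cover y
    obtain ⟨B, _, φ, j, _, u, v, hjO, hjf, h, hu, hv, hR⟩ := hm.chart c hc
    have hCj := hC c hc B φ j u v hjO hjf h
    rw [← hjO] at hyc
    obtain ⟨x, rfl⟩ := hyc
    rw [← mem_support_comap, hCj, mem_support_idealSheaf, Ideal.span_singleton_le_iff_mem] at hy
    have hcop (b : B) (hb : b ∈ x.asIdeal)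
        (h : IsCoprime (toricCoord φ u v (chartEquation r k G G' c)) b) : False := by
      obtain ⟨a, a', h⟩ := h
      exact x.2.ne_top ((Ideal.eq_top_iff_one _).mpr (h ▸ Ideal.add_mem _
        (Ideal.mul_mem_left _ _ hy) (Ideal.mul_mem_left _ _ hb)))
    rw [← mem_support_comap] at hyi
    by_cases hic : i = c
    · subst hic
      rw [hu, mem_support_idealSheaf, Ideal.span_singleton_le_iff_mem] at hyi
      exact hcop u hyi (hm.isCoprime_left hk hG hG' hc hi)
    · by_cases hic' : i = c + 1
      · subst hic'
        rw [hv, mem_support_idealSheaf, Ideal.span_singleton_le_iff_mem] at hyi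
        exact hcop v hyi (hm.isCoprime_right hk hG hG' hc hi)
      · exact (comap_eq_top_iff (D i) j).mp (hR _ ⟨i, hic, hic', rfl⟩) x
          ((mem_support_comap _ _ _).mp hyi)
  exact ⟨hm.mem_chart k hk y fun i hi _ ↦ key i hi, key⟩

end Curves

/-! ### Closed subschemes in charts -/

section Subschemes

variable {W : Type u} [CommRing W] {Y : Scheme.{u}} {f : Y ⟶ germ W} {B : Type u} [CommRing B]

lemma ext_of_exists_chart {I J : Y.IdealSheafData}
    (h : ∀ y : Y, ∃ (B : Type u) (_ : CommRing B) (j : Spec (CommRingCat.of B) ⟶ Y)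
      (_ : IsOpenImmersion j), y ∈ j.opensRange ∧ I.comap j = J.comap j) : I = J := by
  choose B _ j _ hy h using h
  exact ext_of_charts j (fun y ↦ ⟨y, hy y⟩) h

/-- A chart of a scheme restricts to a chart of a closed subscheme. -/
lemma exists_isPullback_subscheme (j : Spec (CommRingCat.of B) ⟶ Y) [IsOpenImmersion j]
    (D : Y.IdealSheafData) {R : Type u} [CommRing R] {τ : B →+* R} (hτ : Function.Surjective τ)
    (h : D.comap j = idealSheaf (RingHom.ker τ)) :
    ∃ (g : Spec (CommRingCat.of R) ⟶ D.subscheme) (_ : IsOpenImmersion g),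
      IsPullback (Spec.map (CommRingCat.ofHom τ)) g j D.subschemeι := by
  have : IsClosedImmersion (Spec.map (CommRingCat.ofHom τ)) :=
    IsClosedImmersion.spec_of_surjective _ hτ
  have hle : D ≤ (Spec.map (CommRingCat.ofHom τ) ≫ j).ker := by
    rw [← map_ker, le_map_iff_comap_le, h, ker_specMap_eq]
  let g : Spec (CommRingCat.of R) ⟶ D.subscheme :=
    IsClosedImmersion.lift D.subschemeι (Spec.map (CommRingCat.ofHom τ) ≫ j) (by simpa using hle)
  have hg : g ≫ D.subschemeι = Spec.map (CommRingCat.ofHom τ) ≫ j :=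
    IsClosedImmersion.lift_fac _ _ _
  have hp : IsPullback (Spec.map (CommRingCat.ofHom τ)) g j D.subschemeι :=
    isPullback_of_isClosedImmersion _ _ _ _ hg.symm (by rw [ker_subschemeι, h, ker_specMap_eq])
  exact ⟨g, MorphismProperty.of_isPullback hp inferInstance, hp⟩

lemma subschemeι_mem_support (D : Y.IdealSheafData) (z : D.subscheme) :
    D.subschemeι z ∈ D.support := by
  rw [← SetLike.mem_coe, ← range_subschemeι]
  exact ⟨z, rfl⟩

/-- A closed subscheme which lies in a chart. -/
lemma exists_iso_subscheme (j : Spec (CommRingCat.of B) ⟶ Y) [IsOpenImmersion j]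
    (D : Y.IdealSheafData) {R : Type u} [CommRing R] {τ : B →+* R} (hτ : Function.Surjective τ)
    (h : D.comap j = idealSheaf (RingHom.ker τ)) (hD : ∀ y ∈ D.support, y ∈ j.opensRange) :
    ∃ e : D.subscheme ≅ Spec (CommRingCat.of R),
      e.hom ≫ Spec.map (CommRingCat.ofHom τ) ≫ j = D.subschemeι := by
  obtain ⟨g, h1, hp⟩ := exists_isPullback_subscheme j D hτ h
  have h2 : Function.Surjective g := by
    intro z
    obtain ⟨b, hb⟩ := hD _ (subschemeι_mem_support D z)
    obtain ⟨x, -, hx⟩ := Scheme.exists_preimage_of_isPullback hp b z hb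
    exact ⟨x, hx⟩
  have : IsIso g := (isIso_iff_isOpenImmersion_and_epi_base g).mpr
    ⟨h1, (TopCat.epi_iff_surjective _).mpr h2⟩
  exact ⟨(asIso g).symm, by rw [hp.w]; simp⟩

lemma meetOnce_of_chart {φ : MvPowerSeries (Fin 2) W →+* B} (j : Spec (CommRingCat.of B) ⟶ Y)
    [IsOpenImmersion j] (hj : j ≫ f = Spec.map (CommRingCat.ofHom φ)) (D D' : Y.IdealSheafData)
    {σ : B →+* W} (hσ : Function.Surjective σ) (hσφ : σ.comp φ = MvPowerSeries.constantCoeff)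
    (h : (D ⊔ D').comap j = idealSheaf (RingHom.ker σ))
    (hD : ∀ y ∈ (D ⊔ D').support, y ∈ j.opensRange) : MeetOnce f D D' := by
  obtain ⟨e, he⟩ := exists_iso_subscheme j (D ⊔ D') hσ h hD
  have : (D ⊔ D').subschemeι ≫ f ≫ germStr W = e.hom := by
    rw [← he]
    have h1 : (σ.comp φ).comp (algebraMap W (MvPowerSeries (Fin 2) W)) = RingHom.id W := by
      rw [hσφ]
      ext w
      simp [MvPowerSeries.algebraMap_apply]
    simp only [Category.assoc]
    rw [reassoc_of% hj, ← Spec.map_comp, ← Spec.map_comp, ← CommRingCat.ofHom_comp,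
      ← CommRingCat.ofHom_comp, ← RingHom.comp_assoc, h1, CommRingCat.ofHom_id, Spec.map_id,
      Category.comp_id]
  rw [MeetOnce, this]
  infer_instance

lemma mem_support_sup {D D' : Y.IdealSheafData} {y : Y} (h : y ∈ (D ⊔ D').support) :
    y ∈ D.support ∧ y ∈ D'.support :=
  ⟨support_antitone le_sup_left h, support_antitone le_sup_right h⟩

lemma areDisjoint_of_support {D D' : Y.IdealSheafData}
    (h : ∀ y, y ∈ D.support → y ∉ D'.support) : AreDisjoint D D' := by
  rw [AreDisjoint, ← comap_id (D ⊔ D'), comap_eq_top_iff]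
  exact fun y hy ↦ h y (mem_support_sup hy).1 (mem_support_sup hy).2

/-- A scheme which is covered by two integral open subschemes which meet is integral. -/
lemma isIntegral_of_openImmersions {X U V : Scheme.{u}} [IsIntegral U] [IsIntegral V] (g : U ⟶ X)
    (g' : V ⟶ X) [IsOpenImmersion g] [IsOpenImmersion g']
    (hc : ∀ x : X, x ∈ g.opensRange ∨ x ∈ g'.opensRange)
    (hm : ∃ x : X, x ∈ g.opensRange ∧ x ∈ g'.opensRange) : IsIntegral X := by
  rw [isIntegral_iff_irreducibleSpace_and_isReduced]
  have hirr {U : Scheme.{u}} [IsIntegral U] (g : U ⟶ X) [IsOpenImmersion g] :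
      IsIrreducible (g.opensRange : Set X) := by
    have := (IrreducibleSpace.isIrreducible_univ U).image g g.continuous.continuousOn
    rwa [Set.image_univ] at this
  constructor
  · have h1 : (Set.univ : Set X) ⊆ closure g.opensRange := by
      rintro x -
      obtain hx | hx := hc x
      · exact subset_closure hx
      · refine closure_mono Set.inter_subset_right
          (subset_closure_inter_of_isPreirreducible_of_isOpen
          (hirr g').isPreirreducible g.opensRange.isOpen ?_ hx)
        obtain ⟨x, h1, h2⟩ := hm
        exact ⟨x, h2, h1⟩
    have h2 := (hirr g).closure
    rw [Set.univ_subset_iff.mp h1] at h2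
    exact (irreducibleSpace_def X).mpr h2
  · have hred {U : Scheme.{u}} [IsIntegral U] (g : U ⟶ X) [IsOpenImmersion g] (y : U) :
        _root_.IsReduced (X.presheaf.stalk (g y)) :=
      isReduced_of_injective (g.stalkMap y).hom
        ((ConcreteCategory.bijective_of_isIso (g.stalkMap y)).1)
    have (x : X) : _root_.IsReduced (X.presheaf.stalk x) := by
      obtain ⟨y, rfl⟩ | ⟨y, rfl⟩ := hc x
      · exact hred g y
      · exact hred g' y
    exact isReduced_of_isReduced_stalk X

end Subschemes

section Exceptional

variable {W : Type u} [CommRing W] {Y : Scheme.{u}} {f : Y ⟶ germ W} {n : ℕ} {r : ℕ → ℕ × ℕ}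
  {D : ℕ → Y.IdealSheafData} {O : ℕ → Y.Opens} {k : ℕ}

/-- The charts which meet the divisor of the `i`-th ray. -/
lemma IsModel.eq_or_eq_of_mem (hm : IsModel f n r D O) {i c : ℕ} (hc : c ≤ n) {y : Y}
    (hy : y ∈ O c) (hyi : y ∈ (D i).support) : i = c ∨ i = c + 1 := by
  by_contra! h
  obtain ⟨B, _, φ, j, _, u, v, hjO, -, -, -, -, hR⟩ := hm.chart c hc
  rw [← hjO] at hy
  obtain ⟨x, rfl⟩ := hy
  exact (comap_eq_top_iff (D i) j).mp (hR _ ⟨i, h.1, h.2, rfl⟩) x hyi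

lemma IsModel.areDisjoint (hm : IsModel f n r D O) {i i' : ℕ} (h : i + 1 < i') :
    AreDisjoint (D i) (D i') := by
  refine areDisjoint_of_support fun y hy hy' ↦ ?_
  obtain ⟨c, hc, hyc⟩ := hm.cover y
  have := hm.eq_or_eq_of_mem hc hyc hy
  have := hm.eq_or_eq_of_mem hc hyc hy'
  lia

lemma IsModel.meetOnce (hm : IsModel f n r D O) {i : ℕ} (hi₁ : 1 ≤ i) (hi : i + 1 ≤ n) :
    MeetOnce f (D i) (D (i + 1)) := by
  obtain ⟨B, _, φ, j, _, u, v, hjO, hjf, h, hu, hv, -⟩ := hm.chart i (by lia)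
  have h1 := hm.pos i hi₁ (by lia)
  obtain ⟨σ, hσφ, -, -, hσ, hker⟩ := h.exists_origin (by lia) (by lia)
  refine meetOnce_of_chart j hjf _ _ hσ hσφ ?_ fun y hy ↦ ?_
  · rw [comap_sup, hu, hv, ← idealSheaf_sup, hker, ← Ideal.span_union, Set.singleton_union]
  · obtain ⟨h1, h2⟩ := mem_support_sup hy
    obtain ⟨c, hc, hyc⟩ := hm.cover y
    have h3 := hm.eq_or_eq_of_mem hc hyc h1
    have h4 := hm.eq_or_eq_of_mem hc hyc h2
    obtain rfl : c = i := by lia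
    exact hjO ▸ hyc

lemma IsModel.isEffectiveCartier (hm : IsModel f n r D O) (i : ℕ) : IsEffectiveCartier (D i) := by
  refine isEffectiveCartier_of_charts fun y ↦ ?_
  obtain ⟨c, hc, hyc⟩ := hm.cover y
  obtain ⟨B, _, φ, j, _, u, v, hjO, -, h, hu, hv, hR⟩ := hm.chart c hc
  rw [← hjO] at hyc
  by_cases h1 : i = c
  · exact ⟨B, _, j, inferInstance, u, hyc,
      mem_nonZeroDivisors_iff_left.mpr h.regPair.left, h1 ▸ hu⟩
  · by_cases h2 : i = c + 1
    · exact ⟨B, _, j, inferInstance, v, hyc,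
        mem_nonZeroDivisors_iff_left.mpr h.regPair.right, h2 ▸ hv⟩
    · exact ⟨B, _, j, inferInstance, 1, hyc, one_mem _, by
        rw [hR _ ⟨i, h1, h2, rfl⟩, Ideal.span_singleton_one, idealSheaf_top]⟩

/-- The divisors of the interior rays lie over the origin. -/
lemma IsModel.comap_origin_le (hm : IsModel f n r D O) {i : ℕ} (hi₁ : 1 ≤ i) (hi : i ≤ n) :
    (origin W).ker.comap f ≤ D i := by
  rw [← sup_eq_right]
  refine ext_of_exists_chart fun y ↦ ?_
  obtain ⟨c, hc, hyc⟩ := hm.cover y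
  obtain ⟨B, _, φ, j, _, u, v, hjO, hjf, h, hu, hv, hR⟩ := hm.chart c hc
  rw [← hjO] at hyc
  refine ⟨B, _, j, inferInstance, hyc, ?_⟩
  have hpos := hm.pos i hi₁ hi
  have key (b : B) (h0 : b ∣ φ (MvPowerSeries.X 0)) (h1 : b ∣ φ (MvPowerSeries.X 1)) :
      (RingHom.ker (MvPowerSeries.constantCoeff (σ := Fin 2) (R := W))).map φ ≤ Ideal.span {b} := by
    refine Ideal.map_le_iff_le_comap.mpr fun a ha ↦ Ideal.mem_span_singleton.mpr ?_
    obtain ⟨a₀, a₁, h⟩ := exists_eq_C_add_X_mul a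
    rw [h, RingHom.mem_ker.mp ha, map_zero, zero_add, map_add, map_mul, map_mul]
    exact dvd_add (dvd_mul_of_dvd_left h0 _) (dvd_mul_of_dvd_left h1 _)
  rw [comap_sup, ← comap_comp, hjf, ker_specMap_eq, comap_idealSheaf, sup_eq_right]
  by_cases h1 : i = c
  · rw [h1, hu, idealSheaf_le_iff]
    subst h1
    refine key _ ?_ ?_
    · rw [h.map_X_zero]
      exact dvd_mul_of_dvd_left (dvd_pow_self _ hpos.1) _
    · rw [h.map_X_one]
      exact dvd_mul_of_dvd_left (dvd_pow_self _ hpos.2) _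
  · by_cases h2 : i = c + 1
    · rw [h2, hv, idealSheaf_le_iff]
      subst h2
      refine key _ ?_ ?_
      · rw [h.map_X_zero]
        exact dvd_mul_of_dvd_right (dvd_pow_self _ hpos.1) _
      · rw [h.map_X_one]
        exact dvd_mul_of_dvd_right (dvd_pow_self _ hpos.2) _
    · rw [hR _ ⟨i, h1, h2, rfl⟩]
      exact le_top

/-- The divisor of an interior ray is a projective line over `W`: it is covered by two affine lines
which meet. -/
lemma IsModel.isIntegral [IsDomain W] (hm : IsModel f n r D O) {i : ℕ} (hi₁ : 1 ≤ i)
    (hi : i ≤ n) : IsIntegral (D i).subscheme := by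
  obtain ⟨i, rfl⟩ := Nat.exists_eq_add_of_le' hi₁
  have hpos := hm.pos (i + 1) hi₁ hi
  obtain ⟨B, _, φ, j, _, u, v, hjO, hjf, h, hu, hv, hR⟩ := hm.chart (i + 1) hi
  obtain ⟨B', _, φ', j', _, u', v', hjO', hjf', h', hu', hv', hR'⟩ := hm.chart i (by lia)
  obtain ⟨σ, hσφ, hσv, hσu, hσ, hker⟩ := h.symm.exists_line hpos.1 hpos.2
  obtain ⟨σ', hσφ', hσu', hσv', hσ', hker'⟩ := h'.exists_line hpos.1 hpos.2
  obtain ⟨g, _, hg⟩ := exists_isPullback_subscheme j (D (i + 1)) hσ (by rw [hu, hker])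
  obtain ⟨g', _, hg'⟩ := exists_isPullback_subscheme j' (D (i + 1)) hσ' (by rw [hv', hker'])
  have hmem (z : (D (i + 1)).subscheme) (hz : (D (i + 1)).subschemeι z ∈ O (i + 1)) :
      z ∈ g.opensRange := by
    rw [← hjO] at hz
    obtain ⟨x, hx⟩ := hz
    obtain ⟨x, -, hx⟩ := Scheme.exists_preimage_of_isPullback hg x z hx
    exact ⟨x, hx⟩
  have hmem' (z : (D (i + 1)).subscheme) (hz : (D (i + 1)).subschemeι z ∈ O i) :
      z ∈ g'.opensRange := by
    rw [← hjO'] at hz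
    obtain ⟨x, hx⟩ := hz
    obtain ⟨x, -, hx⟩ := Scheme.exists_preimage_of_isPullback hg' x z hx
    exact ⟨x, hx⟩
  refine isIntegral_of_openImmersions g g' (fun z ↦ ?_) ?_
  · obtain ⟨c, hc, hyc⟩ := hm.cover ((D (i + 1)).subschemeι z)
    obtain h1 | h1 := hm.eq_or_eq_of_mem hc hyc (subschemeι_mem_support _ z)
    · subst h1
      exact .inl (hmem z hyc)
    · obtain rfl : i = c := by lia
      exact .inr (hmem' z hyc)
  · -- the generic point of the first line lies in the other chart
    let z₀ : Spec (CommRingCat.of (Polynomial W)) := (⊥ : PrimeSpectrum (Polynomial W))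
    refine ⟨g z₀, ⟨z₀, rfl⟩, hmem' _ ?_⟩
    refine hm.mem_chart i (by lia) _ fun l hl hl' hzl ↦ ?_
    have hO : (D (i + 1)).subschemeι (g z₀) ∈ O (i + 1) := by
      rw [← hjO, ← Scheme.Hom.comp_apply, ← hg.w]
      exact ⟨Spec.map (CommRingCat.ofHom σ) z₀, rfl⟩
    obtain h1 | h1 := hm.eq_or_eq_of_mem hi hO hzl
    · exact hl' h1
    · subst h1
      rw [← Scheme.Hom.comp_apply, ← hg.w, ← mem_support_comap, comap_comp, hv,
        comap_idealSheaf, mem_support_idealSheaf, Ideal.map_span, Set.image_singleton,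
        Ideal.span_singleton_le_iff_mem, hσv] at hzl
      exact Polynomial.X_ne_zero (Ideal.mem_bot.mp hzl)

end Exceptional

/-! ### The total transform -/

section TotalTransform

variable {W : Type u} [CommRing W] {Y : Scheme.{u}} {f : Y ⟶ germ W} {n : ℕ} {r : ℕ → ℕ × ℕ}
  {D : ℕ → Y.IdealSheafData} {O : ℕ → Y.Opens} {k : ℕ} {z : MvPowerSeries (Fin 2) W} {m : ℕ}
  {G G' : Polynomial W} {C : Y.IdealSheafData}

lemma IsModel.isEffectiveCartier_of_form (hm : IsModel f n r D O) (hk : k ≤ n)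
    (hz : IsForm (r k).1 (r k).2 z m G G')
    (hz₀ : z ∈ nonZeroDivisors (MvPowerSeries (Fin 2) W))
    (hC : HasEquation f n r O C (chartEquation r k G G')) : IsEffectiveCartier C := by
  refine isEffectiveCartier_of_charts fun y ↦ ?_
  obtain ⟨c, hc, hyc⟩ := hm.cover y
  obtain ⟨B, _, φ, j, _, u, v, hjO, hjf, h, -, -, -⟩ := hm.chart c hc
  refine ⟨B, _, j, inferInstance, _, hjO ▸ hyc, ?_, hC c hc B φ j u v hjO hjf h⟩
  have h1 := h.map_mem hz₀
  rw [hm.map_form hk hz hc h] at h1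
  exact (mul_mem_nonZeroDivisors.mp h1).2

/-- The total transform of a curve is the sum of its proper transform and of multiples of
the exceptional divisors. -/
lemma IsModel.comap_curve (hm : IsModel f n r D O) (hk : k ≤ n)
    (hz : IsForm (r k).1 (r k).2 z m G G')
    (hC : HasEquation f n r O C (chartEquation r k G G')) :
    (idealSheaf (Ideal.span {z})).comap f =
      C * ∏ i : Fin n, D (i + 1) ^ (rayOrd (r k) (r (i + 1)) * m) := by
  have hprod : ∏ i : Fin n, D (i + 1) ^ (rayOrd (r k) (r (i + 1)) * m) =
      ∏ i ∈ Finset.range (n + 2), D i ^ (rayOrd (r k) (r i) * m) := by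
    rw [Finset.prod_range_succ, Finset.prod_range_succ', hm.ray_zero, hm.ray_last,
      Finset.prod_range]
    simp [rayOrd]
  rw [hprod]
  refine ext_of_exists_chart fun y ↦ ?_
  obtain ⟨c, hc, hyc⟩ := hm.cover y
  obtain ⟨B, _, φ, j, _, u, v, hjO, hjf, h, hu, hv, hR⟩ := hm.chart c hc
  refine ⟨B, _, j, inferInstance, hjO ▸ hyc, ?_⟩
  rw [← comap_comp, hjf, comap_idealSheaf, Ideal.map_span, Set.image_singleton,
    hm.map_form hk hz hc h, comap_mul_of_isOpenImmersion, comap_prod_of_isOpenImmersion,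
    hC c hc B φ j u v hjO hjf h,
    Finset.prod_eq_mul_of_mem c (c + 1) (by simp; lia) (by simp; lia) (by lia) (fun i _ hi ↦ by
      rw [comap_pow_of_isOpenImmersion, hR _ ⟨i, hi.1, hi.2, rfl⟩]
      exact one_pow _),
    comap_pow_of_isOpenImmersion, comap_pow_of_isOpenImmersion, hu, hv, ← idealSheaf_pow,
    ← idealSheaf_pow, ← idealSheaf_mul, ← idealSheaf_mul, Ideal.span_singleton_pow,
    Ideal.span_singleton_pow, Ideal.span_singleton_mul_span_singleton,
    Ideal.span_singleton_mul_span_singleton, mul_pow, ← pow_mul, ← pow_mul, mul_comm]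

/-- A curve whose proper transform has an equation is the sum of curves which have equations
whose product is this one. -/
lemma IsModel.eq_prod (hm : IsModel f n r D O) {κ : Type*} [Fintype κ] {C' : κ → Y.IdealSheafData}
    {H H' : κ → Polynomial W} (hC : HasEquation f n r O C (chartEquation r k G G'))
    (hC' : ∀ l, HasEquation f n r O (C' l) (chartEquation r k (H l) (H' l)))
    (hG : ∏ l, H l = G) (hG' : ∏ l, H' l = G') : C = ∏ l, C' l := by
  refine ext_of_exists_chart fun y ↦ ?_
  obtain ⟨c, hc, hyc⟩ := hm.cover y
  obtain ⟨B, _, φ, j, _, u, v, hjO, hjf, h, -, -, -⟩ := hm.chart c hc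
  refine ⟨B, _, j, inferInstance, hjO ▸ hyc, ?_⟩
  have h1 (l) := hC' l c hc B φ j u v hjO hjf h
  rw [comap_prod_of_isOpenImmersion, hC c hc B φ j u v hjO hjf h]
  simp only [h1]
  rw [← idealSheaf_prod, Ideal.prod_span_singleton, chartEquation]
  simp only [chartEquation, toricCoord_evalMonomial]
  rw [← Polynomial.eval₂_finsetProd]
  congr 4
  split_ifs
  exacts [hG.symm, hG'.symm]

/-- The proper transform of a curve and the exceptional divisors have normal crossings. -/
lemma IsModel.isSimpleRelNCD (hm : IsModel f n r D O) (hk : k ≤ n) {κ ι : Type}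
    [Fintype κ] [Fintype ι] {C : κ → Y.IdealSheafData} {H H' : κ → Polynomial W}
    (hC : ∀ l, HasEquation f n r O (C l) (chartEquation r k (H l) (H' l)))
    (hC₀ : ∀ l, IsEffectiveCartier (C l)) (hH : ∀ l, HasUnitEnds (H l))
    (hH' : ∀ l, HasUnitEnds (H' l)) {d : ℕ} (hd₀ : d ≠ 0) (hd : IsUnit (d : W))
    (hprod : ∏ l, H' l = Polynomial.X ^ d + 1)
    (hcop : Pairwise fun l l' ↦ IsCoprime (H' l) (H' l')) (e : ι → κ ⊕ ℕ)
    (he : Function.Injective e) {F : ι → Y.IdealSheafData} (hF : ∀ i, F i = Sum.elim C D (e i)) :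
    IsSmoothOver f ∧ IsSimpleRelNCD f F := by
  obtain rfl : F = Sum.elim C D ∘ e := funext hF
  have hself (l : κ) : chartEquation r k (H l) (H' l) k =
      Polynomial.eval₂RingHom MvPolynomial.C (MvPolynomial.X 1) (H' l) := by
    rw [chartEquation, evalMonomial, if_neg (lt_irrefl k), rayOff_self, hm.rayOff_succ hk, pow_zero,
      one_mul, pow_one]
    rfl
  have hco (y : Y) : HasCoordinates f (Sum.elim C D ∘ e) y := by
    refine (hm.hasCoordinates hC hk (fun l y hy ↦
      (hm.mem_of_mem_support hk (hH l) (hH' l) (hC l) hy).1) hd₀ hd ?_ ?_ y).comp e he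
    · simp only [hself]
      rw [← map_prod, hprod]
      simp [add_comm]
    · intro l l' h
      simp only [hself]
      exact (hcop h).map _
  refine ⟨isSmoothOver_of_hasCoordinates hco, fun i ↦ ?_,
    isSmoothOver_subschemeι_of_hasCoordinates hco, isRelNCD_of_hasCoordinates hco⟩
  rw [Function.comp_apply]
  obtain l | i := e i
  · exact hC₀ l
  · exact hm.isEffectiveCartier i

lemma hasUnitEnds_X_pow_add_one {d : ℕ} (hd : d ≠ 0) :
    HasUnitEnds (Polynomial.X ^ d + 1 : Polynomial W) :=
  ⟨by simp [Polynomial.coeff_one, hd.symm], by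
    have := Polynomial.monic_X_pow_add_C (1 : W) hd
    rw [Polynomial.C_1] at this
    rw [this.leadingCoeff]
    exact isUnit_one⟩

lemma hasUnitEnds_X_sub_C {η : W} (hη : IsUnit η) :
    HasUnitEnds (Polynomial.X - Polynomial.C η) :=
  ⟨by simpa using hη, by rw [(Polynomial.monic_X_sub_C η).leadingCoeff]; exact isUnit_one⟩

lemma hasUnitEnds_one_sub {η : W} (hη : IsUnit η) :
    HasUnitEnds (1 - Polynomial.C η * Polynomial.X) :=
  ⟨by simp, isUnit_leadingCoeff_one_sub hη⟩

/-- Outside the curve `x ^ b = η * y ^ a`, which passes through the origin, a toric modification is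
an isomorphism. -/
lemma IsModel.isIso_compl_curve (hm : IsModel f n r D O) {N M : ℕ} (hN : N ≠ 0) (hM : M ≠ 0) :
    IsIso (f ∣_ (curve W N M).support.compl) := by
  have := hm.iso
  refine isIso_morphismRestrict_of_le f (D := (origin W).ker.support.compl) ?_
  intro x hx hx'
  refine hx ?_
  obtain ⟨h0, h1⟩ := (mem_support_origin x).mp hx'
  refine (mem_support_idealSheaf _ _).mpr ((Ideal.span_singleton_le_iff_mem _).mpr ?_)
  exact Ideal.add_mem _ (Ideal.pow_mem_of_mem _ h0 _ (Nat.pos_of_ne_zero hN))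
    (Ideal.pow_mem_of_mem _ h1 _ (Nat.pos_of_ne_zero hM))

/-- The intersection of the proper transform of a curve with the exceptional divisor which it
meets. -/
lemma IsModel.exists_intersection (hm : IsModel f n r D O) (hk₁ : 1 ≤ k) (hk : k ≤ n)
    (hG : HasUnitEnds G) (hG' : HasUnitEnds G')
    (hC : HasEquation f n r O C (chartEquation r k G G')) {R : Type u} [CommRing R]
    (τ : Polynomial W →+* R) (hτ : Function.Surjective τ) (hker : RingHom.ker τ = Ideal.span {G'}) :
    ∃ e : (C ⊔ D k).subscheme ≅ Spec (CommRingCat.of R),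
      e.hom ≫ Spec.map (CommRingCat.ofHom (τ.comp Polynomial.C)) =
        (C ⊔ D k).subschemeι ≫ f ≫ germStr W := by
  obtain ⟨B, _, φ, j, _, u, v, hjO, hjf, h, hu, hv, -⟩ := hm.chart k hk
  have hpos := hm.pos k hk₁ hk
  obtain ⟨σ, hσφ, hσ, hσker⟩ := h.exists_quotient hpos.1 hpos.2 τ hτ hker
  obtain ⟨e, he⟩ := exists_iso_subscheme j (C ⊔ D k) hσ (by
    rw [comap_sup, hC k hk B φ j u v hjO hjf h, hu, hσker, idealSheaf_sup,
      hm.toricCoord_chartEquation_self hk]) (fun y hy ↦ by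
    rw [hjO]
    exact (hm.mem_of_mem_support hk hG hG' hC (mem_support_sup hy).1).1)
  refine ⟨e, ?_⟩
  have h1 : (σ.comp φ).comp (algebraMap W (MvPowerSeries (Fin 2) W)) = τ.comp Polynomial.C := by
    rw [hσφ]
    ext w
    simp [MvPowerSeries.algebraMap_apply]
  rw [← he]
  simp only [Category.assoc]
  rw [reassoc_of% hjf, ← Spec.map_comp, ← Spec.map_comp, ← CommRingCat.ofHom_comp,
    ← CommRingCat.ofHom_comp, ← RingHom.comp_assoc, h1]

lemma IsModel.isIntegral_branch [IsDomain W] (hm : IsModel f n r D O) (hk₁ : 1 ≤ k) (hk : k ≤ n)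
    {η : W} (hη : IsUnit η) (hG : HasUnitEnds G)
    (hC : HasEquation f n r O C (chartEquation r k G (1 - Polynomial.C η * Polynomial.X))) :
    IsIntegral C.subscheme := by
  obtain ⟨B, _, φ, j, _, u, v, hjO, hjf, h, hu, hv, -⟩ := hm.chart k hk
  have hpos := hm.pos k hk₁ hk
  have hp := h.isPrime_span hpos.1 hpos.2 (hm.det k hk) hη
  have hd : IsDomain (B ⧸ Ideal.span {1 - φ (MvPowerSeries.C η) * v}) := inferInstance
  obtain ⟨e, -⟩ := exists_iso_subscheme j C
    (Ideal.Quotient.mk_surjective (I := Ideal.span {1 - φ (MvPowerSeries.C η) * v})) (by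
      rw [hC k hk B φ j u v hjO hjf h, Ideal.mk_ker, hm.toricCoord_chartEquation_self hk]
      simp) (fun y hy ↦ by
      rw [hjO]
      exact (hm.mem_of_mem_support hk hG (hasUnitEnds_one_sub hη) hC hy).1)
  have : IsIntegral (Spec (CommRingCat.of (B ⧸ Ideal.span {1 - φ (MvPowerSeries.C η) * v}))) :=
    inferInstance
  have : Nonempty C.subscheme := (inferInstance : Nonempty (Spec (CommRingCat.of
    (B ⧸ Ideal.span {1 - φ (MvPowerSeries.C η) * v})))).map e.inv
  exact isIntegral_of_isOpenImmersion e.hom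

end TotalTransform

/-! ### The resolution -/

section Resolution

variable {W : Type u} [CommRing W]

/-- The intersection with an exceptional divisor of a branch is a section. -/
lemma exists_eval_of_isUnit {η : W} (hη : IsUnit η) : ∃ τ : Polynomial W →+* W,
    τ.comp Polynomial.C = RingHom.id W ∧ Function.Surjective τ ∧
      RingHom.ker τ = Ideal.span {1 - Polynomial.C η * Polynomial.X} := by
  obtain ⟨η', hη'⟩ := hη.exists_right_inv
  refine ⟨Polynomial.evalRingHom η', by ext; simp, fun w ↦ ⟨Polynomial.C w, by simp⟩, ?_⟩
  have h1 : (1 - Polynomial.C η * Polynomial.X : Polynomial W) =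
      -Polynomial.C η * (Polynomial.X - Polynomial.C η') := by
    have : (Polynomial.C η * Polynomial.C η' : Polynomial W) = 1 := by
      rw [← map_mul, hη', map_one]
    linear_combination -this
  rw [h1, Ideal.span_singleton_mul_left_unit (hη.map Polynomial.C).neg]
  ext p
  rw [RingHom.mem_ker, Ideal.mem_span_singleton, Polynomial.dvd_iff_isRoot]
  rfl

/-- The branches of the curve `x ^ N + y ^ M = 0` in a toric modification which contains its ray. -/
lemma IsModel.exists_branches {Y : Scheme.{u}} {f : Y ⟶ germ W} {n : ℕ} {r : ℕ → ℕ × ℕ}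
    {D : ℕ → Y.IdealSheafData} {O : ℕ → Y.Opens} {k : ℕ} (hm : IsModel f n r D O) (hk₁ : 1 ≤ k)
    (hk : k ≤ n) {d : ℕ} (hd₀ : 0 < d) (hd : IsUnit (d : W))
    {C' : Y.IdealSheafData} (hC' : HasEquation f n r O C' (chartEquation r k
      (Polynomial.X ^ d + 1) (Polynomial.X ^ d + 1)))
    (hz₀ : (MvPowerSeries.X 0 ^ (d * (r k).2) + MvPowerSeries.X 1 ^ (d * (r k).1) :
      MvPowerSeries (Fin 2) W) ∈ nonZeroDivisors (MvPowerSeries (Fin 2) W)) {ζ : W}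
    (hζ : (Polynomial.cyclotomic d W).IsRoot ζ) {η : W} (hη : η ^ d = -1) :
    ∃ C : Fin d → Y.IdealSheafData, C' = ∏ l, C l ∧
      IsSimpleRelNCD f (Sum.elim C fun i : Fin n ↦ D (i + 1)) ∧
      (∀ l l', l ≠ l' → AreDisjoint (C l) (C l')) ∧ (∀ l, MeetOnce f (C l) (D k)) ∧
      (IsDomain W → ∀ l, IsIntegral (C l).subscheme) := by
  have hfac {K : Type u} [CommRing K] (ι : W →+* K) (s t : K) :
      ∏ l : Fin d, (s - ι (η * ζ ^ (l : ℕ)) * t) = s ^ d + t ^ d := by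
    have hζ' : (Polynomial.cyclotomic d K).IsRoot (ι ζ) := by
      have := hζ.map (f := ι)
      rwa [Polynomial.map_cyclotomic] at this
    have := pow_sub_pow_eq_prod_of_isRoot_cyclotomic hd₀ hζ' s (ι η * t)
    rw [mul_pow, ← map_pow, hη, map_neg, map_one] at this
    rw [show s ^ d + t ^ d = s ^ d - -1 * t ^ d by ring, this]
    refine Finset.prod_congr rfl fun l _ ↦ ?_
    rw [map_mul, map_pow]
    ring
  have hpow (l : Fin d) : (η * ζ ^ (l : ℕ)) ^ d = -1 := by
    have := hfac (RingHom.id W) (η * ζ ^ (l : ℕ)) 1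
    rw [Finset.prod_eq_zero (Finset.mem_univ l) (by simp), one_pow] at this
    exact eq_neg_of_add_eq_zero_left this.symm
  have hunit (l : Fin d) : IsUnit (η * ζ ^ (l : ℕ)) :=
    (isUnit_pow_iff hd₀.ne').mp (hpow l ▸ isUnit_one.neg)
  have hsub (l l' : Fin d) (h : l ≠ l') : IsUnit (η * ζ ^ (l : ℕ) - η * ζ ^ (l' : ℕ)) :=
    isUnit_sub_of_prod_eq hd₀.ne' hd (fun l : Fin d ↦ η * ζ ^ (l : ℕ)) (-1) hpow isUnit_one.neg
      (fun s ↦ by simpa using (hfac Polynomial.C s 1).symm) h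
  have hform (l : Fin d) := isForm_pow_sub_pow (r k).1 (r k).2 (η * ζ ^ (l : ℕ))
  have hC (l : Fin d) := hm.hasEquation hk₁ hk (hform l) (hasUnitEnds_X_sub_C (hunit l))
    (hasUnitEnds_one_sub (hunit l))
  have hprod : ∏ l : Fin d, (1 - Polynomial.C (η * ζ ^ (l : ℕ)) * Polynomial.X) =
      Polynomial.X ^ d + 1 := by
    rw [hfac Polynomial.C 1 Polynomial.X, one_pow, add_comm]
  have hcop (l l' : Fin d) (h : l ≠ l') :
      IsCoprime (1 - Polynomial.C (η * ζ ^ (l : ℕ)) * Polynomial.X)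
        (1 - Polynomial.C (η * ζ ^ (l' : ℕ)) * Polynomial.X) := by
    obtain ⟨c, hc⟩ := (hsub l l' h).exists_left_inv
    refine ⟨-Polynomial.C c * Polynomial.C (η * ζ ^ (l' : ℕ)),
      Polynomial.C c * Polynomial.C (η * ζ ^ (l : ℕ)), ?_⟩
    have := congr_arg Polynomial.C hc
    rw [map_mul, map_sub, map_one] at this
    linear_combination this
  have hz₀' (l : Fin d) : MvPowerSeries.X 0 ^ (r k).2 - MvPowerSeries.C (η * ζ ^ (l : ℕ)) *
      MvPowerSeries.X 1 ^ (r k).1 ∈ nonZeroDivisors (MvPowerSeries (Fin 2) W) := by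
    have h1 := hfac (MvPowerSeries.C (σ := Fin 2)) (MvPowerSeries.X 0 ^ (r k).2)
      (MvPowerSeries.X 1 ^ (r k).1)
    rw [← pow_mul, ← pow_mul, mul_comm (r k).2, mul_comm (r k).1] at h1
    rw [← h1, ← Finset.mul_prod_erase _ _ (Finset.mem_univ l)] at hz₀
    exact (mul_mem_nonZeroDivisors.mp hz₀).1
  refine ⟨_, hm.eq_prod hC' hC ?_ hprod, ?_, fun l l' h ↦ ?_, fun l ↦ ?_, fun _ l ↦ ?_⟩
  · simpa using hfac Polynomial.C Polynomial.X 1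
  · refine (hm.isSimpleRelNCD hk hC (fun l ↦ hm.isEffectiveCartier_of_form hk (hform l) (hz₀' l)
      (hC l)) (fun l ↦ hasUnitEnds_X_sub_C (hunit l)) (fun l ↦ hasUnitEnds_one_sub (hunit l))
      hd₀.ne' hd hprod (fun l l' h ↦ hcop l l' h) (Sum.map id fun i : Fin n ↦ (i : ℕ) + 1)
      (Function.injective_id.sumMap fun i i' h ↦ Fin.ext (by lia)) ?_).2
    rintro (l | i) <;> rfl
  · refine areDisjoint_of_support fun y hy hy' ↦ ?_
    obtain ⟨B, _, φ, j, _, u, v, hjO, hjf, h', -, -, -⟩ := hm.chart k hk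
    have hyO := (hm.mem_of_mem_support hk (hasUnitEnds_X_sub_C (hunit l))
      (hasUnitEnds_one_sub (hunit l)) (hC l) hy).1
    rw [← hjO] at hyO
    obtain ⟨x, rfl⟩ := hyO
    rw [← mem_support_comap, hC _ k hk B φ j u v hjO hjf h', mem_support_idealSheaf,
      Ideal.span_singleton_le_iff_mem, hm.toricCoord_chartEquation_self hk] at hy hy'
    obtain ⟨a, a', h1⟩ := (hcop l l' h).map (Polynomial.eval₂RingHom (φ.comp MvPowerSeries.C) v)
    refine x.2.ne_top ((Ideal.eq_top_iff_one _).mpr ?_)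
    rw [← h1]
    exact Ideal.add_mem _ (Ideal.mul_mem_left _ _ hy) (Ideal.mul_mem_left _ _ hy')
  · obtain ⟨τ, hτC, hτ, hker⟩ := exists_eval_of_isUnit (hunit l)
    obtain ⟨e, he⟩ := hm.exists_intersection hk₁ hk (hasUnitEnds_X_sub_C (hunit l))
      (hasUnitEnds_one_sub (hunit l)) (hC l) τ hτ hker
    rw [hτC, CommRingCat.ofHom_id, Spec.map_id, Category.comp_id] at he
    rw [MeetOnce, ← he]
    infer_instance
  · exact hm.isIntegral_branch hk₁ hk (hunit l) (hasUnitEnds_X_sub_C (hunit l)) (hC l)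

end Resolution

end FermatResolution

end

theorem mainTheorem9 (W : Type u) [CommRing W] (N M : ℕ) (hN : 0 < N) (hM : 0 < M)
    (hNW : IsUnit (N : W)) (hMW : IsUnit (M : W))
    -- a primitive root of unity of order gcd(N, M) in W
    (ζ : W) (hζ : (Polynomial.cyclotomic (Nat.gcd N M) W).IsRoot ζ) :
    ∃ (X' : Scheme.{u}) (ρ : X' ⟶ FermatResolution.germ W)
      (n : ℕ) (m : Fin n → ℕ) (E : Fin n → X'.IdealSheafData) (C' : X'.IdealSheafData)
      (k : Fin n),
      -- ρ is proper, a composite of blow-ups, X' is smooth over W, and X' - D ≅ X - C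
      IsProper ρ ∧
      FermatResolution.IsIteratedBlowup ρ ∧
      FermatResolution.IsSmoothOver ρ ∧
      IsIso (ρ ∣_ (FermatResolution.curve W N M).support.compl) ∧
      -- C' is the proper transform of C, the E i are exceptional, D = C' + ∑ m i • E i
      C' = FermatResolution.properTransform ρ (FermatResolution.curve W N M) ∧
      (∀ i, (FermatResolution.origin W).ker.comap ρ ≤ E i) ∧
      (FermatResolution.curve W N M).comap ρ = C' * ∏ i, E i ^ m i ∧
      -- C' + ∑ E i is a simple relative NCD
      FermatResolution.IsSimpleRelNCD ρ
        (fun i : Option (Fin n) => i.elim C' E) ∧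
      -- the multiplicities
      (∀ i, (∃ a, 1 ≤ a ∧ a ≤ M ∧ m i = a * N) ∨ (∃ b, 1 ≤ b ∧ b ≤ N ∧ m i = b * M)) ∧
      -- the E i are irreducible and reduced if W is a domain
      (IsDomain W → ∀ i, IsIntegral (E i).subscheme) ∧
      -- the E i form a chain
      (∀ i j : Fin n, (i : ℕ) + 1 = j → FermatResolution.MeetOnce ρ (E i) (E j)) ∧
      (∀ i j : Fin n, (i : ℕ) + 1 < j → FermatResolution.AreDisjoint (E i) (E j)) ∧
      -- C' meets only E k, in the finite étale W-scheme given by T ^ d + 1 = 0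
      (∀ i, i ≠ k → FermatResolution.AreDisjoint C' (E i)) ∧
      (∃ e : (C' ⊔ E k).subscheme ≅ Spec (CommRingCat.of
            (AdjoinRoot (Polynomial.X ^ Nat.gcd N M + 1 : Polynomial W))),
          e.hom ≫ Spec.map (CommRingCat.ofHom (algebraMap W
            (AdjoinRoot (Polynomial.X ^ Nat.gcd N M + 1 : Polynomial W)))) =
          (C' ⊔ E k).subschemeι ≫ ρ ≫ FermatResolution.germStr W) ∧
      -- if -1 is a d-th power in W, then C' has d components, which are disjoint and cross E k once
      (∀ η : W, η ^ Nat.gcd N M = -1 →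
        ∃ C : Fin (Nat.gcd N M) → X'.IdealSheafData,
          C' = ∏ l, C l ∧
          FermatResolution.IsSimpleRelNCD ρ (Sum.elim C E) ∧
          (∀ l l', l ≠ l' → FermatResolution.AreDisjoint (C l) (C l')) ∧
          (∀ l, FermatResolution.MeetOnce ρ (C l) (E k)) ∧
          (IsDomain W → ∀ l, IsIntegral (C l).subscheme)) := by
  have hd₀ : 0 < Nat.gcd N M := Nat.gcd_pos_of_pos_left M hN
  obtain ⟨N', hN'⟩ := Nat.gcd_dvd_left N M
  obtain ⟨M', hM'⟩ := Nat.gcd_dvd_right N M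
  have hcop : Nat.Coprime M' N' := by
    have := Nat.coprime_div_gcd_div_gcd hd₀
    rw [Nat.div_eq_of_eq_mul_right hd₀ hN', Nat.div_eq_of_eq_mul_right hd₀ hM'] at this
    exact this.symm
  have hN'₀ : 0 < N' := Nat.pos_of_ne_zero fun h ↦ by
    rw [h, mul_zero] at hN'
    exact hN.ne' hN'
  have hM'₀ : 0 < M' := Nat.pos_of_ne_zero fun h ↦ by
    rw [h, mul_zero] at hM'
    exact hM.ne' hM'
  have hd : IsUnit ((Nat.gcd N M : ℕ) : W) :=
    isUnit_of_dvd_unit (Nat.cast_dvd_cast (Nat.gcd_dvd_left N M)) hNW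
  clear hNW hMW
  generalize Nat.gcd N M = d at *
  subst hN' hM'
  obtain ⟨X', ρ, n, r, D, O, k, hm, hk₁, hk, hrk, hle⟩ :=
    FermatResolution.exists_isModel_ray W (M', N') hcop hM'₀ hN'₀
  obtain ⟨h1, h2⟩ : (r k).1 = M' ∧ (r k).2 = N' := by rw [hrk]; exact ⟨rfl, rfl⟩
  have hends := FermatResolution.hasUnitEnds_X_pow_add_one (W := W) hd₀.ne'
  have hz := FermatResolution.isForm_pow_add_pow (W := W) (r k).1 (r k).2 d
  have hz₀ := FermatResolution.X_pow_add_X_pow_mem_nonZeroDivisors (W := W) (d * N') hM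
  rw [← h1, ← h2] at hz₀
  have hC := hm.hasEquation hk₁ hk hz hends hends
  have hcurve : FermatResolution.idealSheaf (Ideal.span {(MvPowerSeries.X 0 ^ (d * (r k).2) +
      MvPowerSeries.X 1 ^ (d * (r k).1) : MvPowerSeries (Fin 2) W)}) =
      FermatResolution.curve W (d * N') (d * M') := by rw [h1, h2]; rfl
  rw [hcurve] at hC
  have hcomap := hm.comap_curve hk hz hC
  rw [hcurve] at hcomap
  obtain ⟨k, rfl⟩ := Nat.exists_eq_add_of_le' hk₁
  obtain ⟨hsm, hncd⟩ := hm.isSimpleRelNCD hk (κ := Unit) (fun _ ↦ hC)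
    (fun _ ↦ hm.isEffectiveCartier_of_form hk hz hz₀ hC) (fun _ ↦ hends) (fun _ ↦ hends)
    hd₀.ne' hd (by simp) (fun l l' h ↦ (h rfl).elim)
    (fun i : Option (Fin n) ↦ i.elim (.inl ()) fun i ↦ .inr ((i : ℕ) + 1))
    (by
      rintro (_ | i) (_ | i') h
      · rfl
      · cases h
      · cases h
      · exact congr_arg some (Fin.ext (Nat.succ_injective (Sum.inr_injective h))))
    (F := fun i ↦ i.elim
      (FermatResolution.properTransform ρ (FermatResolution.curve W (d * N') (d * M')))
      fun i ↦ D (i + 1))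
    (by rintro (_ | i) <;> rfl)
  refine ⟨X', ρ, n, fun i ↦ FermatResolution.rayOrd (r (k + 1)) (r (i + 1)) * d, fun i ↦ D (i + 1),
    FermatResolution.properTransform ρ (FermatResolution.curve W (d * N') (d * M')), ⟨k, hk⟩,
    hm.proper, hm.iterated, hsm,
    hm.isIso_compl_curve hN.ne' hM.ne', rfl,
    fun i ↦ hm.comap_origin_le (Nat.le_add_left _ _) i.2, hcomap, hncd, fun i ↦ ?_,
    fun _ i ↦ hm.isIntegral (Nat.le_add_left _ _) i.2, ?_,
    fun i j h ↦ hm.areDisjoint (Nat.succ_lt_succ h), fun i h ↦ ?_, ?_,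
    fun η hη ↦ hm.exists_branches hk₁ hk hd₀ hd hC hz₀ hζ hη⟩
  · beta_reduce
    obtain ⟨h3, h4⟩ := hm.pos (i + 1) (Nat.le_add_left _ _) i.2
    obtain ⟨h5, h6⟩ := hle (i + 1) (Nat.le_add_left _ _) i.2
    rw [FermatResolution.rayOrd, h1, h2]
    obtain h | h := min_choice ((r (i + 1)).1 * N') ((r (i + 1)).2 * M') <;> rw [h]
    · exact .inl ⟨(r (i + 1)).1, Nat.one_le_iff_ne_zero.mpr h3,
        h5.trans (Nat.le_mul_of_pos_left _ hd₀), by ring⟩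
    · exact .inr ⟨(r (i + 1)).2, Nat.one_le_iff_ne_zero.mpr h4,
        h6.trans (Nat.le_mul_of_pos_left _ hd₀), by ring⟩
  · intro i j h
    have := hm.meetOnce (i := i + 1) (Nat.le_add_left _ _) (h ▸ j.2)
    beta_reduce
    rwa [← h]
  · refine FermatResolution.areDisjoint_of_support fun y hy ↦
      (hm.mem_of_mem_support hk hends hends hC hy).2 _ fun h' ↦ h (Fin.ext (Nat.succ_injective h'))
  · exact hm.exists_intersection hk₁ hk hends hends hC (AdjoinRoot.mk _) AdjoinRoot.mk_surjective
      Ideal.mk_ker
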